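/- Let $M$ be a smooth ($C^\infty$, Hausdorff, second countable) 3-manifold without boundary and let $L\subset M$ be a knot, i.e. the image of a smooth embedding $S^1\to M$, such that $M$ is orientable along $L$ (the restriction $TM|_L$ is orientable). An \emph{embedded Möbius band with center $L$} is the image $B\subset M$ of a smooth embedding of the Möbius band $[0,2\pi]\times[-1,1]/(0,y)\sim(2\pi,-y)$ that maps the center $[0,2\pi]\times\{0\}$ onto $L$. Two of them are \emph{isotopic} if they are joined by a smooth isotopy through embedded Möbius bands with center $L$. Let $h:\mathbb C\times S^1\to M$ be a tubular neighbourhood of $L$, that is, a diffeomorphism onto an open subset with $h(0\times S^1)=L$; put $T=h(D^2\times S^1)$, so $\partial T\cong S^1\times S^1$, and let $N=M\setminus\operatorname{int}T$. A \emph{surgery} $M\mapsto M_\phi=T\cup_\phi N$ along $L$ is given by an orientation preserving diffeomorphism $\phi$ of $\partial T$. It corresponds to the matrix $\begin{pmatrix}a&b\\c&d\end{pmatrix}\in SL(2,\mathbb Z)$ for which $\phi$ is homotopic (equivalently, isotopic) to $(u,v)\mapsto(u^av^b,u^cv^d)$; its coefficient (for $c\neq0$) is $a/c \bmod 1$. Two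 surgeries $\phi,\phi'$ are identified if $\phi'$ is homotopic (equivalently, isotopic) to $\phi\circ\Psi|_{\partial T}$ for some diffeomorphism $\Psi:T\to T$. A \emph{topological flop} of $L$ is a surgery with coefficient $\equiv\frac12\bmod 1$. Then $L$ has such a tubular neighbourhood, and for every such tubular neighbourhood $T$ there is a bijection between (1) isotopy classes of embedded Möbius bands $B\subset M$ with center $L$, and (2) topological flops of $L$ (up to the above identification). The class of $B$ corresponds to the class of $\phi$ if and only if these classes have representatives $B',\phi'$ with $B'\subset T$ and $\phi'(\text{meridian } S^1\times\{1\})=\partial B'$. -/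

import Mathlib

open Set Topology Manifold
open scoped ContDiff MatrixGroups

noncomputable section

namespace MobiusFlop

/-! Knots in a 3-manifold without boundary. -/

section Ambient

variable {M : Type*} [TopologicalSpace M] [ChartedSpace (EuclideanSpace ℝ (Fin 3)) M]

/-- `L` is a knot: the image of a smooth embedding of the circle. -/
def IsKnot (L : Set M) : Prop :=
  ∃ γ : Circle → M, IsSmoothEmbedding (𝓡 1) (𝓡 3) ∞ γ ∧ range γ = L

/-- `M` is orientable along `L`: the points of `L` can be covered by smooth charts of `M` whose
coordinate changes have positive Jacobian determinant at all points of `L`, i.e. the restriction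
of the tangent bundle of `M` to `L` is orientable. -/
def OrientableAlong [IsManifold (𝓡 3) ∞ M] (L : Set M) : Prop :=
  ∃ A ⊆ IsManifold.maximalAtlas (𝓡 3) ∞ M,
    (∀ x ∈ L, ∃ e ∈ A, x ∈ e.source) ∧
    ∀ e ∈ A, ∀ e' ∈ A, ∀ x ∈ L, x ∈ e.source → x ∈ e'.source →
      0 < (fderiv ℝ (e' ∘ e.symm) (e x)).det

/-! Embedded Möbius bands. -/

/-- The universal cover `ℝ × [-1,1]` of the Möbius band. -/
def strip : Set (ℝ × ℝ) := univ ×ˢ Icc (-1) 1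

/-- The deck group of `strip` over the Möbius band is generated by `(x, y) ↦ (x + 2π, -y)`. -/
def SamePoint (p q : ℝ × ℝ) : Prop :=
  ∃ n : ℤ, q.1 = p.1 + 2 * Real.pi * n ∧ q.2 = (-1 : ℝ) ^ n * p.2

/-- `F` is (the lift to `strip` of) a smooth embedding of the Möbius band
`[0,2π] × [-1,1] / (0,y) ∼ (2π,-y)` into `M` whose center is `L`. -/
structure IsMobiusEmbedding (F : ℝ × ℝ → M) (L : Set M) : Prop where
  smooth : ContMDiffOn 𝓘(ℝ, ℝ × ℝ) (𝓡 3) ∞ F strip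
  immersion : ∀ p ∈ strip,
    Function.Injective (mfderivWithin 𝓘(ℝ, ℝ × ℝ) (𝓡 3) F strip p)
  eq_iff : ∀ p ∈ strip, ∀ q ∈ strip, F p = F q ↔ SamePoint p q
  center : F '' (univ ×ˢ {0}) = L

/-- The embedded Möbius bands in `M` with center `L`, as subsets of `M`. -/
def MobiusBand (L : Set M) : Type _ :=
  {B : Set M // ∃ F : ℝ × ℝ → M, IsMobiusEmbedding F L ∧ F '' strip = B}

/-- Smooth isotopy through embedded Möbius bands with center `L`. -/
def MobiusBand.Isotopic {L : Set M} (B₀ B₁ : MobiusBand L) : Prop :=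
  ∃ H : ℝ × (ℝ × ℝ) → M,
    ContMDiffOn 𝓘(ℝ, ℝ × (ℝ × ℝ)) (𝓡 3) ∞ H (Icc 0 1 ×ˢ strip) ∧
    (∀ t ∈ Icc (0 : ℝ) 1, IsMobiusEmbedding (fun p => H (t, p)) L) ∧
    (fun p => H (0, p)) '' strip = B₀.1 ∧ (fun p => H (1, p)) '' strip = B₁.1

/-! Solid tori and diffeomorphisms of their boundaries. -/

/-- The solid torus `D² × S¹` inside `ℂ × S¹`. -/
def solidTorus : Set (ℂ × Circle) := Metric.closedBall 0 1 ×ˢ univ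

/-- The inclusion of the boundary `S¹ × S¹` of the solid torus `D² × S¹`. -/
def torusIncl (p : Circle × Circle) : ℂ × Circle := ((p.1 : ℂ), p.2)

/-- The meridian `C_{1,0}` of the solid torus. -/
def meridian : Set (Circle × Circle) := univ ×ˢ {1}

/-- Diffeomorphisms of the torus `S¹ × S¹`. -/
abbrev TorusDiffeo : Type :=
  Diffeomorph ((𝓡 1).prod (𝓡 1)) ((𝓡 1).prod (𝓡 1)) (Circle × Circle) (Circle × Circle) ∞

/-- The underlying continuous map of a diffeomorphism of the torus. -/
def TorusDiffeo.toC (φ : TorusDiffeo) : C(Circle × Circle, Circle × Circle) :=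
  ⟨φ, φ.continuous⟩

/-- The map `(u, v) ↦ (u ^ a * v ^ b, u ^ c * v ^ d)`. -/
def linearMap (A : SL(2, ℤ)) : C(Circle × Circle, Circle × Circle) where
  toFun p := (p.1 ^ A.1 0 0 * p.2 ^ A.1 0 1, p.1 ^ A.1 1 0 * p.2 ^ A.1 1 1)
  continuous_toFun := by fun_prop

/-- `φ` corresponds to the matrix `A`. (Diffeomorphisms of the torus are isotopic if and only if
they are homotopic, so the mapping class of `φ` is determined by this matrix.) -/
def TorusDiffeo.HasMatrix (φ : TorusDiffeo) (A : SL(2, ℤ)) : Prop :=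
  ContinuousMap.Homotopic φ.toC (linearMap A)

/-- `ψ` is the restriction to the boundary of a diffeomorphism `Ψ` of the solid torus. -/
def TorusDiffeo.ExtendsOverSolidTorus (ψ : TorusDiffeo) : Prop :=
  ∃ Ψ Ψ' : ℂ × Circle → ℂ × Circle,
    MapsTo Ψ solidTorus solidTorus ∧ MapsTo Ψ' solidTorus solidTorus ∧
    InvOn Ψ' Ψ solidTorus solidTorus ∧
    ContMDiffOn (𝓘(ℝ, ℂ).prod (𝓡 1)) (𝓘(ℝ, ℂ).prod (𝓡 1)) ∞ Ψ solidTorus ∧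
    ContMDiffOn (𝓘(ℝ, ℂ).prod (𝓡 1)) (𝓘(ℝ, ℂ).prod (𝓡 1)) ∞ Ψ' solidTorus ∧
    ∀ p, Ψ (torusIncl p) = torusIncl (ψ p)

/-! Surgeries along a knot. -/

/-- A (parametrized) tubular neighbourhood of `L` that is a solid torus: a diffeomorphism from
`ℂ × S¹` onto an open subset of `M` that takes `0 × S¹` to `L`. -/
structure Tube (L : Set M) where
  toFun : ℂ × Circle → M
  injective : Function.Injective toFun
  isLocalDiffeomorph : IsLocalDiffeomorph (𝓘(ℝ, ℂ).prod (𝓡 1)) (𝓡 3) ∞ toFun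
  core : toFun '' ({0} ×ˢ univ) = L

/-- The closed tubular neighbourhood `T ≅ D² × S¹`. -/
def Tube.solid {L : Set M} (T : Tube L) : Set M := T.toFun '' solidTorus

/-- The closure `N = M \ int T` of the complement of `T`. -/
def Tube.exterior {L : Set M} (T : Tube L) : Set M :=
  (T.toFun '' (Metric.ball 0 1 ×ˢ univ))ᶜ

/-- The identification of `S¹ × S¹` with the boundary of `T`. -/
def Tube.boundary {L : Set M} (T : Tube L) (p : Circle × Circle) : M := T.toFun (torusIncl p)

/-- A surgery `M ↦ M_φ` along the knot `L ⊂ T ⊂ M`: it is given by an orientation preserving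
diffeomorphism `φ` of `∂T ≅ S¹ × S¹`, i.e. one whose matrix is in `SL(2, ℤ)`. -/
structure Surgery {L : Set M} (T : Tube L) where
  gluing : TorusDiffeo
  orientationPreserving : ∃ A : SL(2, ℤ), gluing.HasMatrix A

/-- The relation on `T ⊔ N` that glues `x ∈ ∂T` to `φ x ∈ ∂N`. -/
inductive Surgery.Glue {L : Set M} {T : Tube L} (S : Surgery T) :
    (solidTorus ⊕ T.exterior) → (solidTorus ⊕ T.exterior) → Prop
  | glue (p : Circle × Circle) (x : solidTorus) (y : T.exterior) (hx : x.1 = torusIncl p)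
      (hy : y.1 = T.boundary (S.gluing p)) : Surgery.Glue S (Sum.inl x) (Sum.inr y)

/-- The result `M_φ = T ∪_φ N` of the surgery, with the quotient topology. -/
abbrev Surgery.Result {L : Set M} {T : Tube L} (S : Surgery T) : Type _ := Quot S.Glue

/-- The surgery coefficient `a / c` modulo `1` of a surgery with matrix `(a, b; c, d)`, `c ≠ 0`. -/
def Surgery.HasCoefficient {L : Set M} {T : Tube L} (S : Surgery T) (r : ℚ) : Prop :=
  ∃ A : SL(2, ℤ), S.gluing.HasMatrix A ∧ A.1 1 0 ≠ 0 ∧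
    (A.1 0 0 : ℚ) / (A.1 1 0 : ℚ) ≡ r [PMOD (1 : ℚ)]

/-- A topological flop: a surgery with coefficient congruent to `1/2` modulo `1`. -/
def TopologicalFlop {L : Set M} (T : Tube L) : Type _ :=
  {S : Surgery T // S.HasCoefficient (1 / 2)}

/-- Two surgeries are identified if, up to a diffeomorphism `Ψ` of the solid torus that is glued
in, the gluing maps are isotopic (for diffeomorphisms of the torus: equivalently, homotopic). -/
def TopologicalFlop.Same {L : Set M} {T : Tube L} (S S' : TopologicalFlop T) : Prop :=
  ∃ ψ : TorusDiffeo, ψ.ExtendsOverSolidTorus ∧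
    ContinuousMap.Homotopic S'.1.gluing.toC (S.1.gluing.toC.comp ψ.toC)

/-- `B ⊂ T`, and the gluing map `φ` takes the meridian of `T` to the boundary of `B`. -/
def MeridianToBoundary {L : Set M} {T : Tube L} (B : MobiusBand L) (S : TopologicalFlop T) :
    Prop :=
  ∃ F : ℝ × ℝ → M, IsMobiusEmbedding F L ∧ F '' strip = B.1 ∧ B.1 ⊆ T.solid ∧
    T.boundary '' (S.1.gluing '' meridian) = F '' (univ ×ˢ {1})

end Ambient

end MobiusFlop

end

/-!
Both sets of classes are indexed by the odd integers, by means of winding numbers in the tube.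

Fix a tube `T`. A loop in the punctured tube winds `p` times around the core and `q` times along it
(`LoopClass`). A parallel of the center of a Möbius band runs along the center twice, so it has
winding numbers `(a, 2)` up to a common sign, with `a` odd. These numbers are invariant under isotopy
and depend only on the image of the band (`bandInvariant_eq`, `bandInvariant_eq_of_mk_eq`). They are
a complete invariant (`exists_mk_eq_stdBand`). Indeed, shrinking the fibers moves a band into the
tube (`IsMobiusEmbedding.exists_cover`). By the Alexander trick `z (x, s y) / s` with `s → 0`, which
is smooth by Hadamard's lemma, it becomes a union of straight segments in the disks `D² × {u}`
(`exists_bandData_isotopic`). The logarithm of the direction of these segments is a function on `ℝ`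
with prescribed increment over a period, and such functions form a convex set
(`isotopic_linearBand`).

The image of the meridian under a gluing map with matrix `(a, b; c, d)` has winding numbers `(a, c)`.
They do not change when a diffeomorphism of the solid torus is applied first, because it maps the
meridian to plus or minus a meridian (`flopInvariant_eq_of_mk_eq`). Conversely, two matrices with the
same first column up to sign differ by a matrix that is upper triangular, and the corresponding
diffeomorphism extends over the solid torus (`same_of_column_eq`). The coefficient is `1 / 2` modulo
`1` exactly when the first column is `± (a, 2)` with `a` odd (`exists_mk_eq_stdFlop`).

If a gluing map takes the meridian to the boundary of a band, then both have the same winding numbers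
(`invariant_eq_of_meridianToBoundary`), and the standard band and the standard flop with the same `a`
are related in this way (`meridianToBoundary_std`). This gives the bijection (`exists_equiv`).

A tube is obtained by inverting a map `M → ℂ × S¹` near the knot (`nonempty_tube_of_map`). Its
components are `α + i β` and the argument of `W`, where `W : M → ℂ` restricts to the inverse of the
parametrization of the knot up to positive factors (`exists_angular`), and where `α` and `β` vanish
on the knot. The differential of `α` is made nonzero along the knot arc by arc, by small
perturbations that exist because a curve in the plane has dense complement
(`exists_local_nonvanishing`). Given `α` and `W`, the functions `β` for which the map has positive
Jacobian determinant along the knot form a convex set, so local choices can be glued; this is where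
orientability along the knot enters (`exists_jac_pos`).
-/

namespace MobiusFlop

/-! ### Lifting through the universal covers of the tube and of the punctured tube -/

section Lifting

theorem exists_circle_lift {A : Type*} [TopologicalSpace A] [SimplyConnectedSpace A]
    [LocallyPathConnectedSpace A] {f : A → Circle} (hf : Continuous f) :
    ∃ θ : A → ℝ, Continuous θ ∧ ∀ a, f a = Circle.exp (θ a) := by
  obtain ⟨a₀⟩ : Nonempty A := inferInstance
  obtain ⟨e, he⟩ := Circle.exp_surjective (f a₀)
  obtain ⟨θ, ⟨-, hθ⟩, -⟩ :=
    Circle.isCoveringMap_exp.existsUnique_continuousMap_lifts ⟨f, hf⟩ a₀ e he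
  exact ⟨θ, θ.continuous, fun a => (congrFun hθ a).symm⟩

theorem exists_complex_log {A : Type*} [TopologicalSpace A] [SimplyConnectedSpace A]
    [LocallyPathConnectedSpace A] {f : A → ℂ} (hf : Continuous f) (h0 : ∀ a, f a ≠ 0) :
    ∃ l : A → ℂ, Continuous l ∧ ∀ a, f a = Complex.exp (l a) := by
  obtain ⟨a₀⟩ : Nonempty A := inferInstance
  obtain ⟨l, ⟨-, hl⟩, -⟩ := Complex.isCoveringMapOn_exp.existsUnique_continuousMap_lifts
    ⟨f, hf⟩ (a₀ := a₀) (e₀ := Complex.log (f a₀)) (Complex.exp_log (h0 a₀)) (fun a => h0 a)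
  exact ⟨l, l.continuous, fun a => (congrFun hl a).symm⟩

theorem eq_of_forall_exists_int {A : Type*} [TopologicalSpace A] [PreconnectedSpace A]
    {f : A → ℝ} (hf : Continuous f) (h : ∀ a, ∃ n : ℤ, f a = n * (2 * Real.pi)) (a b : A) :
    f a = f b := by
  have hc : Continuous fun a => f a / (2 * Real.pi) := hf.div_const _
  have hpi : (2 * Real.pi) ≠ 0 := by positivity
  choose n hn using h
  have hn' : ∀ a, f a / (2 * Real.pi) = n a := fun a => by rw [hn a]; field_simp
  have hnc : Continuous n := by
    rw [Int.isClosedEmbedding_coe_real.isInducing.continuous_iff]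
    exact hc.congr hn'
  rw [hn a, hn b, PreconnectedSpace.constant inferInstance hnc]

/-- Two continuous families of angles of one circle-valued function differ by a constant
multiple of `2π`. -/
theorem exists_int_of_circleExp_eq {A : Type*} [TopologicalSpace A] [ConnectedSpace A]
    {f g : A → ℝ} (hf : Continuous f) (hg : Continuous g)
    (h : ∀ a, Circle.exp (f a) = Circle.exp (g a)) :
    ∃ n : ℤ, ∀ a, f a = g a + 2 * Real.pi * n := by
  obtain ⟨a₀⟩ : Nonempty A := inferInstance
  have h' : ∀ a, ∃ n : ℤ, f a - g a = n * (2 * Real.pi) := fun a => by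
    obtain ⟨n, hn⟩ := Circle.exp_eq_exp.1 (h a)
    exact ⟨n, by rw [hn]; ring⟩
  obtain ⟨n, hn⟩ := h' a₀
  refine ⟨n, fun a => ?_⟩
  have := eq_of_forall_exists_int (f := fun a => f a - g a) (hf.sub hg) h' a a₀
  linarith

theorem exists_int_of_complexExp_eq {A : Type*} [TopologicalSpace A] [ConnectedSpace A]
    {f g : A → ℂ} (hf : Continuous f) (hg : Continuous g)
    (h : ∀ a, Complex.exp (f a) = Complex.exp (g a)) :
    ∃ n : ℤ, ∀ a, f a = g a + 2 * Real.pi * n * Complex.I := by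
  obtain ⟨a₀⟩ : Nonempty A := inferInstance
  have h' : ∀ a, ∃ n : ℤ, f a = g a + n * (2 * Real.pi * Complex.I) := fun a =>
    Complex.exp_eq_exp_iff_exists_int.1 (h a)
  have h'' : ∀ a, ∃ n : ℤ, (f a).im - (g a).im = n * (2 * Real.pi) := fun a => by
    obtain ⟨n, hn⟩ := h' a
    exact ⟨n, by rw [hn]; simp⟩
  obtain ⟨n, hn⟩ := h'' a₀
  refine ⟨n, fun a => ?_⟩
  have h1 := eq_of_forall_exists_int (f := fun a => (f a).im - (g a).im)
    ((Complex.continuous_im.comp hf).sub (Complex.continuous_im.comp hg)) h'' a a₀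
  obtain ⟨m, hm⟩ := h' a
  rw [hn, hm] at h1
  have h2 : m = n := by
    have : (m : ℝ) * (2 * Real.pi) = n * (2 * Real.pi) := by simpa using h1
    exact_mod_cast mul_right_cancel₀ (by positivity) this
  rw [hm, h2]; ring

/-- A map into a space `X` that is swept out by a compact annulus, embedded as `f`, lifts to
the universal cover `ℝ × Y` of the annulus. -/
theorem exists_lift_of_annulus {X Y A : Type*} [TopologicalSpace X] [T2Space X]
    [TopologicalSpace Y] [CompactSpace Y]
    [TopologicalSpace A] [SimplyConnectedSpace A] [LocallyPathConnectedSpace A]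
    {f : ℝ × Y → X} (hf : Continuous f)
    (hinj : ∀ a b, f a = f b ↔ Circle.exp a.1 = Circle.exp b.1 ∧ a.2 = b.2)
    {c : A → X} (hc : Continuous c) (hmem : ∀ a, c a ∈ range f) :
    ∃ (ξ : A → ℝ) (υ : A → Y), Continuous ξ ∧ Continuous υ ∧ ∀ a, c a = f (ξ a, υ a) := by
  let F : Circle × Y → X := fun a => f (Complex.arg a.1, a.2)
  have hF : ∀ a : ℝ × Y, F (Circle.exp a.1, a.2) = f a := fun a =>
    (hinj _ _).2 ⟨Circle.exp_arg _, rfl⟩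
  have hq : IsOpenQuotientMap (Prod.map Circle.exp (id : Y → Y)) :=
    .prodMap ⟨Circle.exp_surjective, Circle.exp.continuous,
      isLocalHomeomorph_circleExp.isOpenMap⟩ .id
  have hFc : Continuous F := by
    rw [hq.isQuotientMap.continuous_iff]
    exact hf.congr fun a => (hF a).symm
  have hFi : Function.Injective F := by
    rintro ⟨u, y⟩ ⟨u', y'⟩ h
    have := (hinj _ _).1 h
    simp only [Circle.exp_arg] at this
    exact Prod.ext this.1 this.2
  have hFe : IsClosedEmbedding F := hFc.isClosedEmbedding hFi
  have hmem' : ∀ a, c a ∈ range F := fun a => by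
    obtain ⟨r, hr⟩ := hmem a
    exact ⟨_, (hF r).trans hr⟩
  choose g hg using hmem'
  have hgc : Continuous g := by
    rw [hFe.isInducing.continuous_iff]
    exact hc.congr fun a => (hg a).symm
  obtain ⟨ξ, hξ, hξ'⟩ := exists_circle_lift (continuous_fst.comp hgc)
  refine ⟨ξ, fun a => (g a).2, hξ, continuous_snd.comp hgc, fun a => ?_⟩
  rw [← hF, ← hg a, ← hξ']
  rfl

end Lifting

section Tube

variable {M : Type*} [TopologicalSpace M] [ChartedSpace (EuclideanSpace ℝ (Fin 3)) M]
  {L : Set M}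

theorem Tube.continuous (T : Tube L) : Continuous T.toFun :=
  T.isLocalDiffeomorph.contMDiff.continuous

theorem Tube.isOpenEmbedding (T : Tube L) : IsOpenEmbedding T.toFun :=
  .of_continuous_injective_isOpenMap T.continuous T.injective T.isLocalDiffeomorph.isOpenMap

theorem Tube.apply_mem_iff (T : Tube L) {z : ℂ} {u : Circle} : T.toFun (z, u) ∈ L ↔ z = 0 := by
  constructor
  · intro h
    obtain ⟨⟨z', u'⟩, ⟨h0, -⟩, h'⟩ := T.core.symm.subset h
    have := T.injective h'
    simp only [Prod.mk.injEq] at this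
    rw [← this.1]; exact h0
  · rintro rfl
    exact T.core.subset ⟨(0, u), ⟨rfl, mem_univ _⟩, rfl⟩

theorem Tube.subset_range (T : Tube L) : L ⊆ range T.toFun :=
  T.core.symm.subset.trans (image_subset_range _ _)

/-- The map `(z, t) ↦ T (z, e^{it})` from `ℂ × ℝ` to the tube, its universal cover. -/
noncomputable def Tube.cover (T : Tube L) (p : ℂ × ℝ) : M := T.toFun (p.1, Circle.exp p.2)

theorem Tube.cover_mem_iff (T : Tube L) {p : ℂ × ℝ} : T.cover p ∈ L ↔ p.1 = 0 :=
  T.apply_mem_iff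

theorem Tube.cover_mem_range (T : Tube L) (p : ℂ × ℝ) : T.cover p ∈ range T.toFun :=
  mem_range_self _

theorem Tube.cover_eq_iff (T : Tube L) {p q : ℂ × ℝ} :
    T.cover p = T.cover q ↔ p.1 = q.1 ∧ Circle.exp p.2 = Circle.exp q.2 := by
  rw [Tube.cover, Tube.cover, T.injective.eq_iff, Prod.mk.injEq]

theorem Tube.exists_lift (T : Tube L) {A : Type*} [TopologicalSpace A] [SimplyConnectedSpace A]
    [LocallyPathConnectedSpace A] {f : A → M} (hf : Continuous f)
    (h : ∀ a, f a ∈ range T.toFun) :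
    ∃ (z : A → ℂ) (θ : A → ℝ), Continuous z ∧ Continuous θ ∧ ∀ a, f a = T.cover (z a, θ a) := by
  choose g hg using h
  have hgc : Continuous g := by
    rw [T.isOpenEmbedding.isInducing.continuous_iff]
    exact hf.congr fun a => (hg a).symm
  obtain ⟨θ, hθ, hθ'⟩ := exists_circle_lift (continuous_snd.comp hgc)
  refine ⟨fun a => (g a).1, θ, continuous_fst.comp hgc, hθ, fun a => ?_⟩
  rw [Tube.cover, ← hθ', ← hg a]
  rfl

theorem Tube.exists_log_lift (T : Tube L) {A : Type*} [TopologicalSpace A]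
    [SimplyConnectedSpace A] [LocallyPathConnectedSpace A] {f : A → M} (hf : Continuous f)
    (h : ∀ a, f a ∈ range T.toFun \ L) :
    ∃ (l : A → ℂ) (θ : A → ℝ), Continuous l ∧ Continuous θ ∧
      ∀ a, f a = T.cover (Complex.exp (l a), θ a) := by
  obtain ⟨z, θ, hz, hθ, hf'⟩ := T.exists_lift hf fun a => (h a).1
  obtain ⟨l, hl, hl'⟩ := exists_complex_log hz fun a ha => (h a).2 (by
    rw [hf' a, T.cover_mem_iff]; exact ha)
  exact ⟨l, θ, hl, hθ, fun a => by rw [hf' a, hl' a]⟩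

/-- The loop `c : ℝ → M`, of period `2π` and in the punctured tube, winds `p` times around the core
and `q` times along it. -/
def LoopClass (T : Tube L) (c : ℝ → M) (p q : ℤ) : Prop :=
  ∃ (l : ℝ → ℂ) (θ : ℝ → ℝ), Continuous l ∧ Continuous θ ∧
    (∀ x, c x = T.cover (Complex.exp (l x), θ x)) ∧
    (∀ x, l (x + 2 * Real.pi) = l x + 2 * Real.pi * p * Complex.I) ∧
    ∀ x, θ (x + 2 * Real.pi) = θ x + 2 * Real.pi * q

theorem LoopClass.unique {T : Tube L} {c : ℝ → M} {p q p' q' : ℤ} (h : LoopClass T c p q)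
    (h' : LoopClass T c p' q') : p = p' ∧ q = q' := by
  obtain ⟨l, θ, hl, hθ, hc, hlp, hθq⟩ := h
  obtain ⟨l', θ', hl', hθ', hc', hlp', hθq'⟩ := h'
  have key := fun x => T.cover_eq_iff.1 ((hc x).symm.trans (hc' x))
  obtain ⟨n, hn⟩ := exists_int_of_complexExp_eq hl hl' fun x => (key x).1
  obtain ⟨m, hm⟩ := exists_int_of_circleExp_eq hθ hθ' fun x => (key x).2
  have hpi := Real.pi_pos.ne'
  constructor
  · have h1 := hn (0 + 2 * Real.pi)
    rw [hlp, hlp', hn 0] at h1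
    have h2 := congrArg Complex.im h1
    simp only [Complex.add_im, Complex.mul_im, Complex.I_im, Complex.I_re, Complex.mul_re,
      Complex.ofReal_re, Complex.ofReal_im, Complex.intCast_re, Complex.intCast_im,
      Complex.re_ofNat, Complex.im_ofNat] at h2
    have h3 : (2 * Real.pi) * (p : ℝ) = (2 * Real.pi) * p' := by linarith
    exact_mod_cast mul_left_cancel₀ (by positivity) h3
  · have h1 := hm (0 + 2 * Real.pi)
    rw [hθq, hθq', hm 0] at h1
    have h3 : (2 * Real.pi) * (q : ℝ) = (2 * Real.pi) * q' := by linarith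
    exact_mod_cast mul_left_cancel₀ (by positivity) h3

/-- The two winding numbers are the same for all loops of a continuous family. -/
theorem exists_loopClass_of_continuous (T : Tube L) {C : ℝ × ℝ → M} (hC : Continuous C)
    (hmem : ∀ a, C a ∈ range T.toFun \ L)
    (hper : ∀ s x, C (s, x + 2 * Real.pi) = C (s, x)) :
    ∃ p q : ℤ, ∀ s, LoopClass T (fun x => C (s, x)) p q := by
  obtain ⟨l, θ, hl, hθ, hf⟩ := T.exists_log_lift hC hmem
  have key := fun a : ℝ × ℝ => T.cover_eq_iff.1
    ((hf (a.1, a.2 + 2 * Real.pi)).symm.trans ((hper a.1 a.2).trans (hf a)))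
  obtain ⟨n, hn⟩ := exists_int_of_complexExp_eq (A := ℝ × ℝ) (by fun_prop) hl fun x => (key x).1
  obtain ⟨m, hm⟩ := exists_int_of_circleExp_eq (A := ℝ × ℝ) (by fun_prop) hθ fun x => (key x).2
  exact ⟨n, m, fun s => ⟨fun x => l (s, x), fun x => θ (s, x), by fun_prop, by fun_prop,
    fun x => hf (s, x), fun x => hn (s, x), fun x => hm (s, x)⟩⟩

theorem exists_loopClass_of_continuousOn (T : Tube L) {C : ℝ × ℝ → M} {a b : ℝ} (hab : a ≤ b)
    (hC : ContinuousOn C (Icc a b ×ˢ univ))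
    (hmem : ∀ s ∈ Icc a b, ∀ x, C (s, x) ∈ range T.toFun \ L)
    (hper : ∀ s ∈ Icc a b, ∀ x, C (s, x + 2 * Real.pi) = C (s, x)) :
    ∃ p q : ℤ, ∀ s ∈ Icc a b, LoopClass T (fun x => C (s, x)) p q := by
  have hpr : Continuous fun r : ℝ × ℝ => ((projIcc a b hab r.1 : ℝ), r.2) := by fun_prop
  obtain ⟨p, q, h⟩ := exists_loopClass_of_continuous T
    (C := fun r => C ((projIcc a b hab r.1 : ℝ), r.2))
    (hC.comp_continuous hpr fun r => ⟨(projIcc a b hab r.1).2, mem_univ _⟩)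
    (fun r => hmem _ (projIcc a b hab r.1).2 _) (fun s x => hper _ (projIcc a b hab s).2 _)
  refine ⟨p, q, fun s hs => ?_⟩
  simpa [projIcc_of_mem hab hs] using h s

theorem exists_loopClass (T : Tube L) {c : ℝ → M} (hc : Continuous c)
    (hmem : ∀ x, c x ∈ range T.toFun \ L) (hper : ∀ x, c (x + 2 * Real.pi) = c x) :
    ∃ p q : ℤ, LoopClass T c p q := by
  obtain ⟨p, q, h⟩ := exists_loopClass_of_continuous T (C := fun r => c r.2) (by fun_prop)
    (fun r => hmem _) (fun _ x => hper x)
  exact ⟨p, q, h 0⟩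

theorem apply_add_int_mul {f : ℝ → ℂ} {a : ℂ} (h : ∀ x, f (x + 2 * Real.pi) = f x + a) (n : ℤ)
    (x : ℝ) : f (x + 2 * Real.pi * n) = f x + n * a := by
  induction n with
  | zero => simp
  | succ n ih =>
    have := h (x + 2 * Real.pi * n)
    push_cast at ih ⊢
    rw [show x + 2 * Real.pi * (n + 1) = x + 2 * Real.pi * n + 2 * Real.pi by ring, this, ih]
    ring
  | pred n ih =>
    have := h (x + 2 * Real.pi * (-n - 1))
    push_cast at ih ⊢
    rw [show x + 2 * Real.pi * (-n - 1) + 2 * Real.pi = x + 2 * Real.pi * -n by ring, ih] at this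
    linear_combination -this

theorem apply_add_int_mul' {f : ℝ → ℝ} {a : ℝ} (h : ∀ x, f (x + 2 * Real.pi) = f x + a) (n : ℤ)
    (x : ℝ) : f (x + 2 * Real.pi * n) = f x + n * a := by
  have := apply_add_int_mul (f := fun x => (f x : ℂ)) (a := a) (fun x => by rw [h]; push_cast; rfl)
    n x
  exact_mod_cast this

theorem LoopClass.comp {T : Tube L} {c : ℝ → M} {p q : ℤ} (h : LoopClass T c p q) {g : ℝ → ℝ}
    (hg : Continuous g) {k : ℤ} (hk : ∀ x, g (x + 2 * Real.pi) = g x + 2 * Real.pi * k) :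
    LoopClass T (fun x => c (g x)) (k * p) (k * q) := by
  obtain ⟨l, θ, hl, hθ, hc, hlp, hθq⟩ := h
  refine ⟨fun x => l (g x), fun x => θ (g x), by fun_prop, by fun_prop, fun x => hc _,
    fun x => ?_, fun x => ?_⟩
  · simp only [hk, apply_add_int_mul hlp]; push_cast; ring
  · simp only [hk, apply_add_int_mul' hθq]; push_cast; ring

end Tube

end MobiusFlop

namespace MobiusFlop

/-! ### The winding numbers of a Möbius band -/

section Band

variable {M : Type*} [TopologicalSpace M] [ChartedSpace (EuclideanSpace ℝ (Fin 3)) M]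
  {L : Set M} {F : ℝ × ℝ → M}

theorem IsMobiusEmbedding.continuousOn (hF : IsMobiusEmbedding F L) : ContinuousOn F strip :=
  hF.smooth.continuousOn

theorem mem_strip {x y : ℝ} : (x, y) ∈ strip ↔ y ∈ Icc (-1 : ℝ) 1 := by simp [strip]

theorem neg_one_zpow_mul_mem_Icc {y δ : ℝ} (h : y ∈ Icc (-δ) δ) (n : ℤ) :
    (-1 : ℝ) ^ n * y ∈ Icc (-δ) δ := by
  rcases Int.even_or_odd n with hn | hn
  · rwa [hn.neg_one_zpow, one_mul]
  · rw [hn.neg_one_zpow]; constructor <;> linarith [h.1, h.2]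

theorem IsMobiusEmbedding.apply_add (hF : IsMobiusEmbedding F L) {x y : ℝ}
    (hy : y ∈ Icc (-1 : ℝ) 1) (n : ℤ) :
    F (x + 2 * Real.pi * n, (-1 : ℝ) ^ n * y) = F (x, y) :=
  ((hF.eq_iff _ (mem_strip.2 hy) _
    (mem_strip.2 (neg_one_zpow_mul_mem_Icc hy n))).2 ⟨n, rfl, rfl⟩).symm

theorem IsMobiusEmbedding.mem_iff (hF : IsMobiusEmbedding F L) {x y : ℝ}
    (hy : y ∈ Icc (-1 : ℝ) 1) : F (x, y) ∈ L ↔ y = 0 := by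
  rw [← hF.center]
  constructor
  · rintro ⟨⟨x', y'⟩, ⟨-, h0⟩, h⟩
    obtain rfl : y' = 0 := h0
    obtain ⟨n, -, hn⟩ := (hF.eq_iff _ (mem_strip.2 (by simp)) _ (mem_strip.2 hy)).1 h
    simpa using hn
  · rintro rfl
    exact ⟨(x, 0), ⟨mem_univ _, rfl⟩, rfl⟩

/-- On the half `y > 0` of the strip, the Möbius band is an annulus with angle `x / 2`. -/
theorem IsMobiusEmbedding.double_eq_iff (hF : IsMobiusEmbedding F L) {x x' y y' : ℝ}
    (hy : y ∈ Ioc (0 : ℝ) 1) (hy' : y' ∈ Ioc (0 : ℝ) 1) :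
    F (2 * x, y) = F (2 * x', y') ↔ Circle.exp x = Circle.exp x' ∧ y = y' := by
  have hm : ∀ {y : ℝ}, y ∈ Ioc (0 : ℝ) 1 → y ∈ Icc (-1 : ℝ) 1 := fun h =>
    ⟨by linarith [h.1], h.2⟩
  rw [hF.eq_iff _ (mem_strip.2 (hm hy)) _ (mem_strip.2 (hm hy')), eq_comm (a := Circle.exp x),
    Circle.exp_eq_exp]
  constructor
  · rintro ⟨n, h1, h2⟩
    simp only at h1 h2
    rcases Int.even_or_odd n with hn | hn
    · rw [hn.neg_one_zpow, one_mul] at h2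
      obtain ⟨m, rfl⟩ := hn
      refine ⟨⟨m, ?_⟩, h2.symm⟩
      push_cast at h1
      linarith
    · rw [hn.neg_one_zpow] at h2
      linarith [hy.1, hy'.1]
  · rintro ⟨⟨m, hm⟩, rfl⟩
    refine ⟨2 * m, ?_, ?_⟩
    · simp only; rw [hm]; push_cast; ring
    · simp [zpow_mul]

theorem IsMobiusEmbedding.exists_double (hF : IsMobiusEmbedding F L) {b : M}
    (hb : b ∈ F '' strip) :
    ∃ x ∈ Icc 0 (2 * Real.pi), ∃ y ∈ Icc (0 : ℝ) 1, b = F (2 * x, y) := by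
  obtain ⟨⟨x, y⟩, hxy, rfl⟩ := hb
  rw [mem_strip] at hxy
  obtain ⟨x', y', hy', h⟩ : ∃ x' : ℝ, ∃ y' ∈ Icc (0 : ℝ) 1, F (x, y) = F (x', y') := by
    rcases le_total 0 y with h0 | h0
    · exact ⟨x, y, ⟨h0, hxy.2⟩, rfl⟩
    · refine ⟨x + 2 * Real.pi * (1 : ℤ), -y, ⟨by linarith, by linarith [hxy.1]⟩, ?_⟩
      simpa using (hF.apply_add hxy 1).symm
  have hy'' : y' ∈ Icc (-1 : ℝ) 1 := ⟨by linarith [hy'.1], hy'.2⟩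
  obtain ⟨n, hn, -⟩ := existsUnique_add_zsmul_mem_Ico (a := 2 * Real.pi) (by positivity)
    (x' / 2) 0
  refine ⟨x' / 2 + n • (2 * Real.pi), ⟨hn.1, by linarith [hn.2]⟩, y', hy', ?_⟩
  rw [h, ← hF.apply_add hy'' (2 * n)]
  congr 2
  · push_cast; rw [zsmul_eq_mul]; ring
  · simp [zpow_mul]

theorem isClosed_image_double [T2Space M] (hF : IsMobiusEmbedding F L) {a : ℝ} (ha : 0 ≤ a) :
    IsClosed ((fun p : ℝ × ℝ => F (2 * p.1, p.2)) '' (Icc 0 (2 * Real.pi) ×ˢ Icc a 1)) := by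
  refine ((isCompact_Icc.prod isCompact_Icc).image_of_continuousOn ?_).isClosed
  refine hF.continuousOn.comp (by fun_prop) fun p hp => ?_
  exact mem_strip.2 ⟨by linarith [hp.2.1], hp.2.2⟩

/-- A family of Möbius bands with center `L`, parametrized by a compact interval, lies close to
`L` uniformly near its center lines. -/
theorem exists_forall_mem_of_family {H : ℝ × (ℝ × ℝ) → M}
    (hH : ContinuousOn H (Icc 0 1 ×ˢ strip))
    (hemb : ∀ t ∈ Icc (0 : ℝ) 1, IsMobiusEmbedding (fun p => H (t, p)) L) {U : Set M}
    (hU : IsOpen U) (hLU : L ⊆ U) :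
    ∃ δ ∈ Ioc (0 : ℝ) 1, ∀ t ∈ Icc (0 : ℝ) 1, ∀ x, ∀ y ∈ Icc (-δ) δ, H (t, (x, y)) ∈ U := by
  have hm1 : (-1 : ℝ) ≤ 1 := by norm_num
  let G : ℝ × (ℝ × ℝ) → M := fun r =>
    H (projIcc (0 : ℝ) 1 zero_le_one r.2.1, (r.2.2, projIcc (-1 : ℝ) 1 hm1 r.1))
  have hG : Continuous G := hH.comp_continuous (by fun_prop) fun r =>
    ⟨(projIcc (0 : ℝ) 1 zero_le_one r.2.1).2, mem_strip.2 (projIcc (-1 : ℝ) 1 hm1 r.1).2⟩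
  have h0 : ∀ r ∈ Icc (0 : ℝ) 1 ×ˢ Icc 0 (2 * Real.pi), ∀ᶠ z : ℝ × (ℝ × ℝ) in 𝓝 (0, r),
      G z ∈ U := by
    intro r hr
    refine hG.continuousAt.eventually_mem (hU.mem_nhds (hLU ?_))
    have hp0 : (projIcc (-1 : ℝ) 1 hm1 0 : ℝ) = 0 := by
      rw [projIcc_of_mem hm1 (x := 0) (by simp)]
    simp only [G, hp0]
    rw [(hemb _ (projIcc (0 : ℝ) 1 zero_le_one r.1).2).mem_iff (by simp)]
  have h1 := (isCompact_Icc.prod isCompact_Icc).eventually_forall_of_forall_eventually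
    (K := Icc (0 : ℝ) 1 ×ˢ Icc 0 (2 * Real.pi)) (x₀ := (0 : ℝ))
    (P := fun y r => G (y, r) ∈ U) h0
  obtain ⟨ε, hε, h2⟩ := Metric.eventually_nhds_iff.1 h1
  refine ⟨min (ε / 2) 1, ⟨by positivity, min_le_right _ _⟩, fun t ht x y hy => ?_⟩
  have hle := min_le_left (ε / 2) (1 : ℝ)
  have hle1 := min_le_right (ε / 2) (1 : ℝ)
  obtain ⟨n, hn, -⟩ := existsUnique_add_zsmul_mem_Ico (a := 2 * Real.pi) (by positivity) x 0
  have hy1 : y ∈ Icc (-1 : ℝ) 1 := ⟨by linarith [hy.1], by linarith [hy.2]⟩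
  have hyn := neg_one_zpow_mul_mem_Icc hy n
  have hyn1 := neg_one_zpow_mul_mem_Icc hy1 n
  have h3 := h2 (y := (-1 : ℝ) ^ n * y)
    (by rw [Real.dist_eq, sub_zero, abs_lt]; constructor <;> linarith [hyn.1, hyn.2])
    (t, x + n • (2 * Real.pi)) ⟨ht, ⟨hn.1, by linarith [hn.2]⟩⟩
  simp only [G, projIcc_of_mem _ ht, projIcc_of_mem _ hyn1] at h3
  have h4 := (hemb t ht).apply_add (x := x) hy1 n
  rw [← h4]
  convert h3 using 4
  rw [zsmul_eq_mul]; ring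

theorem IsMobiusEmbedding.exists_forall_mem (hF : IsMobiusEmbedding F L) {U : Set M}
    (hU : IsOpen U) (hLU : L ⊆ U) :
    ∃ δ ∈ Ioc (0 : ℝ) 1, ∀ x, ∀ y ∈ Icc (-δ) δ, F (x, y) ∈ U := by
  obtain ⟨δ, hδ, h⟩ := exists_forall_mem_of_family (H := fun r => F r.2)
    (hF.continuousOn.comp continuousOn_snd fun r hr => hr.2) (fun _ _ => hF) hU hLU
  exact ⟨δ, hδ, h 0 (by simp)⟩

theorem IsMobiusEmbedding.double_periodic (hF : IsMobiusEmbedding F L) {y : ℝ}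
    (hy : y ∈ Icc (-1 : ℝ) 1) (x : ℝ) : F (2 * (x + 2 * Real.pi), y) = F (2 * x, y) := by
  have := hF.apply_add (x := 2 * x) hy 2
  rw [← this]
  congr 2
  · push_cast; ring
  · simp

/-- The winding numbers in `T` of the curve parallel to the center of the Möbius band `F`,
which runs along the center twice. -/
def BandClass (T : Tube L) (F : ℝ × ℝ → M) (p q : ℤ) : Prop :=
  ∃ δ ∈ Ioc (0 : ℝ) 1, (∀ x, ∀ y ∈ Ioc 0 δ, F (x, y) ∈ range T.toFun) ∧
    ∀ y ∈ Ioc 0 δ, LoopClass T (fun x => F (2 * x, y)) p q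

theorem BandClass.of_loopClass (hF : IsMobiusEmbedding F L) {T : Tube L} {δ : ℝ}
    (hδ : δ ∈ Ioc (0 : ℝ) 1) (hmem : ∀ x, ∀ y ∈ Ioc 0 δ, F (x, y) ∈ range T.toFun) {p q : ℤ}
    (h : LoopClass T (fun x => F (2 * x, δ)) p q) : BandClass T F p q := by
  refine ⟨δ, hδ, hmem, fun y hy => ?_⟩
  have hI : ∀ s ∈ Icc y δ, s ∈ Ioc 0 δ := fun s hs => ⟨hy.1.trans_le hs.1, hs.2⟩
  have hI' : ∀ s ∈ Icc y δ, s ∈ Icc (-1 : ℝ) 1 := fun s hs =>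
    ⟨by linarith [(hI s hs).1], hs.2.trans hδ.2⟩
  obtain ⟨p', q', h'⟩ := exists_loopClass_of_continuousOn T (C := fun r => F (2 * r.2, r.1)) hy.2
    (hF.continuousOn.comp (by fun_prop) fun r hr => mem_strip.2 (hI' _ hr.1))
    (fun s hs x => ⟨hmem _ _ (hI s hs), fun h => (hI s hs).1.ne' ((hF.mem_iff (hI' s hs)).1 h)⟩)
    (fun s hs x => hF.double_periodic (hI' s hs) x)
  obtain ⟨rfl, rfl⟩ := (h' δ ⟨hy.2, le_rfl⟩).unique h
  exact h' y ⟨le_rfl, hy.2⟩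

/-- The winding numbers do not change along an isotopy. -/
theorem exists_bandClass_of_family (T : Tube L) {H : ℝ × (ℝ × ℝ) → M}
    (hH : ContinuousOn H (Icc 0 1 ×ˢ strip))
    (hemb : ∀ t ∈ Icc (0 : ℝ) 1, IsMobiusEmbedding (fun p => H (t, p)) L) :
    ∃ p q : ℤ, ∀ t ∈ Icc (0 : ℝ) 1, BandClass T (fun p => H (t, p)) p q := by
  obtain ⟨δ, hδ, hmem⟩ := exists_forall_mem_of_family hH hemb T.isOpenEmbedding.isOpen_range
    T.subset_range
  have hδ1 : δ ∈ Icc (-1 : ℝ) 1 := ⟨by linarith [hδ.1], hδ.2⟩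
  obtain ⟨p, q, h⟩ := exists_loopClass_of_continuousOn T (C := fun r => H (r.1, (2 * r.2, δ)))
    zero_le_one
    (hH.comp (by fun_prop) fun r hr => ⟨hr.1, mem_strip.2 hδ1⟩)
    (fun s hs x => ⟨hmem s hs _ _ ⟨by linarith [hδ.1], le_rfl⟩,
      fun h => hδ.1.ne' (((hemb s hs).mem_iff hδ1).1 h)⟩)
    (fun s hs x => (hemb s hs).double_periodic hδ1 x)
  exact ⟨p, q, fun t ht => .of_loopClass (hemb t ht) hδ
    (fun x y hy => hmem t ht x y ⟨by linarith [hy.1, hδ.1], hy.2⟩) (h t ht)⟩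

/-- A loop that runs in the image of a loop `c` which is injective up to its period is homotopic
to a power of `c`. -/
theorem LoopClass.exists_mul [T2Space M] {T : Tube L} {c c' : ℝ → M} {p q p' q' : ℤ}
    (h : LoopClass T c p q) (h' : LoopClass T c' p' q') (hc : Continuous c)
    (hc' : Continuous c') (hinj : ∀ x y, c x = c y ↔ Circle.exp x = Circle.exp y)
    (hper : ∀ x, c' (x + 2 * Real.pi) = c' x) (hsub : range c' ⊆ range c) :
    ∃ k : ℤ, p' = k * p ∧ q' = k * q := by
  obtain ⟨ξ, υ, hξ, -, hcξ⟩ := exists_lift_of_annulus (Y := Unit) (f := fun a => c a.1)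
    (by fun_prop) (fun a b => by simp [hinj]) hc' fun x => by
      obtain ⟨y, hy⟩ := hsub ⟨x, rfl⟩
      exact ⟨(y, ()), hy⟩
  obtain ⟨k, hk⟩ := exists_int_of_circleExp_eq (f := fun x => ξ (x + 2 * Real.pi)) (by fun_prop) hξ
    fun x => (hinj _ _).1 (by rw [← hcξ, ← hcξ, hper])
  have h2 := h.comp hξ hk
  obtain rfl : c' = fun x => c (ξ x) := funext hcξ
  exact ⟨k, h'.unique h2⟩

/-- The winding numbers of a band depend only on its image, up to a factor, and hence up to sign by
symmetry: a parallel of the center of `F'` close to `L` runs in an annulus of parallels of the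
center of `F`. -/
theorem BandClass.exists_mul [T2Space M] {T : Tube L} {F' : ℝ × ℝ → M} {p q p' q' : ℤ}
    (hF : IsMobiusEmbedding F L) (hF' : IsMobiusEmbedding F' L) (hsub : F' '' strip ⊆ F '' strip)
    (h : BandClass T F p q) (h' : BandClass T F' p' q') : ∃ k : ℤ, p' = k * p ∧ q' = k * q := by
  obtain ⟨δ, hδ, hmem, hcl⟩ := h
  obtain ⟨δ', hδ', hmem', hcl'⟩ := h'
  -- a parallel `c'` of the center of `F'` which is so close to `L` that it lies in `y < δ`
  obtain ⟨δ₁, hδ₁, h₁⟩ := hF'.exists_forall_mem (isClosed_image_double hF hδ.1.le).isOpen_compl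
    (fun b hb hb' => by
      obtain ⟨r, hr, rfl⟩ := hb'
      have := (hF.mem_iff ⟨by linarith [hr.2.1, hδ.1], hr.2.2⟩).1 hb
      linarith [hr.2.1, hδ.1])
  set y' := min δ' δ₁
  have hy' : y' ∈ Ioc 0 δ' := ⟨lt_min hδ'.1 hδ₁.1, min_le_left _ _⟩
  have hy'1 : y' ∈ Icc (-1 : ℝ) 1 := ⟨by linarith [hy'.1], hy'.2.trans hδ'.2⟩
  set c' : ℝ → M := fun x => F' (2 * x, y') with hc'def
  have hc' : Continuous c' := hF'.continuousOn.comp_continuous (by fun_prop)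
    fun x => mem_strip.2 hy'1
  have hper' : ∀ x, c' (x + 2 * Real.pi) = c' x := hF'.double_periodic hy'1
  have hcL : ∀ x, c' x ∉ L := fun x hx => hy'.1.ne' ((hF'.mem_iff hy'1).1 hx)
  have hrange : range c' = c' '' Icc 0 (0 + 2 * Real.pi) :=
    (Function.Periodic.image_Icc hper' (by positivity) 0).symm
  have hclosed : IsClosed (range c') := by
    rw [hrange]; exact (isCompact_Icc.image hc').isClosed
  obtain ⟨η, hη, h₂⟩ := hF.exists_forall_mem hclosed.isOpen_compl
    (by rintro b hb ⟨x, rfl⟩; exact hcL x hb)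
  have hex : ∀ x, ∃ s, ∃ y ∈ Icc η δ, c' x = F (2 * s, y) := fun x => by
    obtain ⟨s, hs, y, hy, e⟩ := hF.exists_double (hsub ⟨_, mem_strip.2 hy'1, rfl⟩ : c' x ∈ _)
    refine ⟨s, y, ⟨?_, ?_⟩, e⟩
    · by_contra! hlt
      exact h₂ (2 * s) y ⟨by linarith [hy.1, hη.1], hlt.le⟩ ⟨x, e⟩
    · by_contra! hlt
      exact h₁ (2 * x) y' ⟨by linarith [hy'.1, hδ₁.1], min_le_right _ _⟩
        ⟨(s, y), ⟨hs, hlt.le, hy.2⟩, e.symm⟩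
  have hI : ∀ y ∈ Icc η δ, y ∈ Ioc 0 δ := fun y hy => ⟨hη.1.trans_le hy.1, hy.2⟩
  have hI1 : ∀ y ∈ Icc η δ, y ∈ Ioc (0 : ℝ) 1 := fun y hy => ⟨(hI y hy).1, hy.2.trans hδ.2⟩
  have hI2 : ∀ y ∈ Icc η δ, y ∈ Icc (-1 : ℝ) 1 := fun y hy =>
    ⟨by linarith [(hI1 y hy).1], (hI1 y hy).2⟩
  have hinj : ∀ a b : ℝ × Icc η δ, F (2 * a.1, a.2) = F (2 * b.1, b.2) ↔
      Circle.exp a.1 = Circle.exp b.1 ∧ a.2 = b.2 := fun a b => by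
    rw [hF.double_eq_iff (hI1 _ a.2.2) (hI1 _ b.2.2), Subtype.ext_iff]
  obtain ⟨ξ, υ, hξ, hυ, hcξ⟩ := exists_lift_of_annulus (Y := Icc η δ)
    (f := fun a => F (2 * a.1, a.2))
    (hF.continuousOn.comp_continuous (by fun_prop) fun a => mem_strip.2 (hI2 _ a.2.2))
    hinj hc' fun x => by
      obtain ⟨s, y, hy, e⟩ := hex x
      exact ⟨(s, ⟨y, hy⟩), e.symm⟩
  have hp := fun x => (hinj (ξ (x + 2 * Real.pi), υ (x + 2 * Real.pi)) (ξ x, υ x)).1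
    ((hcξ _).symm.trans ((hper' x).trans (hcξ x)))
  obtain ⟨k, hk⟩ := exists_int_of_circleExp_eq (f := fun x => ξ (x + 2 * Real.pi)) (by fun_prop) hξ
    fun x => (hp x).1
  -- push `c'` radially to the parallel `y = δ` of the center of `F`
  have hηδ : η ≤ δ := (υ 0).2.1.trans (υ 0).2.2
  have hconv : ∀ s ∈ Icc (0 : ℝ) 1, ∀ x, (1 - s) * (υ x : ℝ) + s * δ ∈ Icc η δ := fun s hs x => by
    have h1 := (υ x).2.1
    have h2 := (υ x).2.2
    have hs1 := hs.1
    have hs2 := hs.2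
    constructor <;> nlinarith
  obtain ⟨p₁, q₁, hC⟩ := exists_loopClass_of_continuousOn T
    (C := fun r => F (2 * ξ r.2, (1 - r.1) * (υ r.2 : ℝ) + r.1 * δ)) zero_le_one
    (hF.continuousOn.comp (by fun_prop) fun r hr => mem_strip.2 (hI2 _ (hconv _ hr.1 _)))
    (fun s hs x => ⟨hmem _ _ (hI _ (hconv s hs x)), fun h =>
      (hI _ (hconv s hs x)).1.ne' ((hF.mem_iff (hI2 _ (hconv s hs x))).1 h)⟩)
    (fun s hs x => by
      have e : (υ (x + 2 * Real.pi) : ℝ) = υ x := congrArg _ (hp x).2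
      have h0 := hconv s hs x
      simp only [e]
      refine (hF.double_eq_iff (hI1 _ h0) (hI1 _ h0)).2 ⟨(hp x).1, rfl⟩)
  have e0 : LoopClass T c' p₁ q₁ := by
    have := hC 0 (by simp)
    simp only [sub_zero, one_mul, zero_mul, add_zero] at this
    rwa [show c' = fun x => F (2 * ξ x, υ x) from funext hcξ]
  have e1 : LoopClass T (fun x => F (2 * ξ x, δ)) p₁ q₁ := by
    simpa using hC 1 (by simp)
  have e2 := (hcl δ ⟨hδ.1, le_rfl⟩).comp hξ hk
  obtain ⟨rfl, rfl⟩ := (hcl' y' hy').unique e0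
  exact ⟨k, e1.unique e2⟩

theorem eq_or_eq_neg_of_mul {p q p' q' k k' : ℤ} (h : p' = k * p ∧ q' = k * q)
    (h' : p = k' * p' ∧ q = k' * q') : (p' = p ∧ q' = q) ∨ (p' = -p ∧ q' = -q) := by
  obtain ⟨rfl, rfl⟩ := h
  obtain ⟨h1, h2⟩ := h'
  have key : ∀ r : ℤ, r = k' * (k * r) → r = 0 ∨ k' * k = 1 := fun r hr => by
    have : r * (k' * k - 1) = 0 := by linear_combination -hr
    rcases mul_eq_zero.1 this with h | h
    · exact .inl h
    · exact .inr (by linarith)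
  by_cases hk : k' * k = 1
  · rcases Int.isUnit_iff.1 (IsUnit.of_mul_eq_one_right k' hk) with rfl | rfl <;> simp
  · have hp := (key p h1).resolve_right hk
    have hq := (key q h2).resolve_right hk
    subst hp hq; simp

/-- The winding numbers, up to a common sign, of a Möbius band. -/
def bandInvariant (T : Tube L) (B : MobiusBand L) : Set (ℤ × ℤ) :=
  {r | ∃ F : ℝ × ℝ → M, IsMobiusEmbedding F L ∧ F '' strip = B.1 ∧
    (BandClass T F r.1 r.2 ∨ BandClass T F (-r.1) (-r.2))}

theorem bandInvariant_eq [T2Space M] {T : Tube L} {B : MobiusBand L} {p q : ℤ}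
    (hF : IsMobiusEmbedding F L) (hB : F '' strip = B.1) (h : BandClass T F p q) :
    bandInvariant T B = {(p, q), (-p, -q)} := by
  have key : ∀ F' : ℝ × ℝ → M, IsMobiusEmbedding F' L → F' '' strip = B.1 → ∀ p' q' : ℤ,
      BandClass T F' p' q' → (p' = p ∧ q' = q) ∨ (p' = -p ∧ q' = -q) := by
    intro F' hF' hB' p' q' h'
    obtain ⟨k, hk⟩ := BandClass.exists_mul hF hF' (hB'.trans hB.symm).subset h h'
    obtain ⟨k', hk'⟩ := BandClass.exists_mul hF' hF (hB.trans hB'.symm).subset h' h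
    exact eq_or_eq_neg_of_mul hk hk'
  ext ⟨a, b⟩
  simp only [bandInvariant, mem_ofPred_eq, mem_insert_iff, mem_singleton_iff, Prod.mk.injEq]
  constructor
  · rintro ⟨F', hF', hB', h' | h'⟩
    · exact key F' hF' hB' _ _ h'
    · rcases key F' hF' hB' _ _ h' with h | h
      · right; omega
      · left; omega
  · rintro (⟨rfl, rfl⟩ | ⟨rfl, rfl⟩)
    · exact ⟨F, hF, hB, .inl h⟩
    · exact ⟨F, hF, hB, .inr (by simpa using h)⟩

theorem bandInvariant_eq_of_mk_eq [T2Space M] (T : Tube L) {B B' : MobiusBand L}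
    (h : Quot.mk MobiusBand.Isotopic B = Quot.mk _ B') :
    bandInvariant T B = bandInvariant T B' := by
  have hlift : ∀ B B' : MobiusBand L, B.Isotopic B' → bandInvariant T B = bandInvariant T B' := by
    rintro B B' ⟨H, hH, hemb, h0, h1⟩
    obtain ⟨p, q, hpq⟩ := exists_bandClass_of_family T hH.continuousOn hemb
    rw [bandInvariant_eq (hemb 0 (by simp)) h0 (hpq 0 (by simp)),
      bandInvariant_eq (hemb 1 (by simp)) h1 (hpq 1 (by simp))]
  exact congrArg (Quot.lift (bandInvariant T) hlift) h

end Band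

end MobiusFlop

namespace MobiusFlop

/-! ### Linear diffeomorphisms of the torus -/

section Torus

theorem contMDiff_circle_zpow (n : ℤ) : ContMDiff (𝓡 1) (𝓡 1) ∞ fun u : Circle => u ^ n := by
  cases n with
  | ofNat n => simpa using contMDiff_pow (I := 𝓡 1) (n := ∞) (G := Circle) n
  | negSucc n =>
    simpa [zpow_negSucc] using (contMDiff_pow (I := 𝓡 1) (n := ∞) (G := Circle) (n + 1)).inv

theorem linearMap_apply (A : SL(2, ℤ)) (p : Circle × Circle) :
    linearMap A p = (p.1 ^ A.1 0 0 * p.2 ^ A.1 0 1, p.1 ^ A.1 1 0 * p.2 ^ A.1 1 1) := rfl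

theorem linearMap_mul (A B : SL(2, ℤ)) :
    linearMap (A * B) = (linearMap A).comp (linearMap B) := by
  ext p <;>
  simp [linearMap_apply, Matrix.mul_apply, Fin.sum_univ_two, zpow_add, zpow_mul', mul_zpow,
    mul_assoc, mul_left_comm]

theorem linearMap_one : linearMap 1 = ContinuousMap.id _ := by
  ext p <;> simp [linearMap_apply]

theorem contMDiff_linearMap (A : SL(2, ℤ)) :
    ContMDiff ((𝓡 1).prod (𝓡 1)) ((𝓡 1).prod (𝓡 1)) ∞ (linearMap A) := by
  have h1 := fun n => (contMDiff_circle_zpow n).comp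
    (contMDiff_fst (I := 𝓡 1) (J := 𝓡 1) (M := Circle) (N := Circle))
  have h2 := fun n => (contMDiff_circle_zpow n).comp
    (contMDiff_snd (I := 𝓡 1) (J := 𝓡 1) (M := Circle) (N := Circle))
  exact ((h1 _).mul (h2 _)).prodMk ((h1 _).mul (h2 _))

/-- The linear diffeomorphism of the torus with the given matrix. -/
noncomputable def linearDiffeo (A : SL(2, ℤ)) : TorusDiffeo where
  toFun := linearMap A
  invFun := linearMap A⁻¹
  left_inv p := by
    rw [← ContinuousMap.comp_apply, ← linearMap_mul, inv_mul_cancel, linearMap_one]; rfl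
  right_inv p := by
    rw [← ContinuousMap.comp_apply, ← linearMap_mul, mul_inv_cancel, linearMap_one]; rfl
  contMDiff_toFun := contMDiff_linearMap A
  contMDiff_invFun := contMDiff_linearMap A⁻¹

theorem toC_linearDiffeo (A : SL(2, ℤ)) : (linearDiffeo A).toC = linearMap A := rfl

theorem linearDiffeo_apply (A : SL(2, ℤ)) (p : Circle × Circle) :
    linearDiffeo A p = linearMap A p := rfl

theorem hasMatrix_linearDiffeo (A : SL(2, ℤ)) : (linearDiffeo A).HasMatrix A :=
  ContinuousMap.Homotopic.refl _

theorem det_eq_one (A : SL(2, ℤ)) : A.1 0 0 * A.1 1 1 - A.1 0 1 * A.1 1 0 = 1 := by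
  rw [← Matrix.det_fin_two]; exact A.2

theorem exists_matrix {a : ℤ} (ha : Odd a) : ∃ A : SL(2, ℤ), A.1 0 0 = a ∧ A.1 1 0 = 2 := by
  obtain ⟨m, rfl⟩ := ha
  exact ⟨⟨!![2 * m + 1, m; 2, 1], by simp [Matrix.det_fin_two]; ring⟩, by simp, by simp⟩

theorem contMDiff_solid_shear (k : ℤ) :
    ContMDiff (𝓘(ℝ, ℂ).prod (𝓡 1)) (𝓘(ℝ, ℂ).prod (𝓡 1)) ∞
      fun p : ℂ × Circle => (p.1 * ((p.2 ^ k : Circle) : ℂ), p.2) := by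
  have := finrank_real_complex_fact'
  have h2 : ContMDiff (𝓘(ℝ, ℂ).prod (𝓡 1)) 𝓘(ℝ, ℂ) ∞
      fun p : ℂ × Circle => ((p.2 ^ k : Circle) : ℂ) :=
    (contMDiff_coe_sphere (E := ℂ) (n := 1)).comp ((contMDiff_circle_zpow k).comp contMDiff_snd)
  exact ((contDiff_mul (𝕜 := ℝ) (𝔸 := ℂ)).contMDiff.comp
    (contMDiff_fst.prodMk_space h2)).prodMk contMDiff_snd

theorem contMDiff_solid_conj :
    ContMDiff (𝓘(ℝ, ℂ).prod (𝓡 1)) (𝓘(ℝ, ℂ).prod (𝓡 1)) ∞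
      fun p : ℂ × Circle => ((starRingEnd ℂ) p.1, p.2⁻¹) :=
  (Complex.conjCLE.contDiff.contMDiff.comp contMDiff_fst).prodMk contMDiff_snd.inv

/-- The linear diffeomorphisms that preserve the meridian up to orientation extend over the solid
torus by Dehn twists along the meridian disk, and complex conjugation. -/
theorem extends_linearDiffeo {A : SL(2, ℤ)} (h : A.1 1 0 = 0) :
    (linearDiffeo A).ExtendsOverSolidTorus := by
  have hdet := det_eq_one A
  rw [h, mul_zero, sub_zero] at hdet
  have hs : ∀ k : ℤ, MapsTo (fun p : ℂ × Circle => (p.1 * ((p.2 ^ k : Circle) : ℂ), p.2))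
      solidTorus solidTorus := fun k p hp => by
    simpa [solidTorus, Circle.norm_coe] using hp
  have hc : MapsTo (fun p : ℂ × Circle => ((starRingEnd ℂ) p.1, p.2⁻¹))
      solidTorus solidTorus := fun p hp => by
    simpa [solidTorus] using hp
  have hu : ∀ (u : Circle) (k : ℤ), (u : ℂ) ^ k ≠ 0 := fun u k =>
    zpow_ne_zero _ (Circle.coe_ne_zero u)
  rcases Int.mul_eq_one_iff_eq_one_or_neg_one.1 hdet with ⟨h0, h1⟩ | ⟨h0, h1⟩
  · refine ⟨_, _, hs (A.1 0 1), hs (-A.1 0 1), ⟨fun p _ => ?_, fun p _ => ?_⟩,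
      (contMDiff_solid_shear _).contMDiffOn, (contMDiff_solid_shear _).contMDiffOn, fun p => ?_⟩
    · ext1
      · simp [hu]
      · rfl
    · ext1
      · simp [hu]
      · rfl
    · simp [torusIncl, linearDiffeo_apply, linearMap_apply, h0, h1, h]
  · refine ⟨_, _, hc.comp (hs (-A.1 0 1)), (hs (A.1 0 1)).comp (by exact hc.comp (hs 0)),
      ⟨fun p _ => ?_, fun p _ => ?_⟩,
      (contMDiff_solid_conj.comp (contMDiff_solid_shear _)).contMDiffOn,
      ((contMDiff_solid_shear _).comp
        (contMDiff_solid_conj.comp (contMDiff_solid_shear 0))).contMDiffOn, fun p => ?_⟩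
    · ext1
      · simp [hu]
      · simp
    · ext1
      · simp [hu]
      · simp
    · simp [torusIncl, linearDiffeo_apply, linearMap_apply, h0, h1, h, ← Circle.coe_inv_eq_conj]

end Torus

/-! ### The winding numbers of a surgery -/

section Surgery

variable {M : Type*} [TopologicalSpace M] [ChartedSpace (EuclideanSpace ℝ (Fin 3)) M]
  {L : Set M} {T : Tube L}

theorem Tube.boundary_mem (T : Tube L) (p : Circle × Circle) :
    T.boundary p ∈ range T.toFun \ L :=
  ⟨mem_range_self _, fun h => Circle.coe_ne_zero p.1 (T.apply_mem_iff.1 h)⟩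

theorem Tube.continuous_boundary (T : Tube L) : Continuous T.boundary :=
  T.continuous.comp (by unfold torusIncl; fun_prop)

theorem Tube.boundary_injective (T : Tube L) : Function.Injective T.boundary := fun p q h => by
  have := T.injective h
  simp only [torusIncl, Prod.mk.injEq, Circle.coe_inj] at this
  exact Prod.ext this.1 this.2

theorem LoopClass.of_homotopic {f g : C(Circle × Circle, Circle × Circle)}
    (h : ContinuousMap.Homotopic f g) {e : ℝ → Circle × Circle} (he : Continuous e)
    (hper : ∀ x, e (x + 2 * Real.pi) = e x) {p q : ℤ}
    (hf : LoopClass T (fun x => T.boundary (f (e x))) p q) :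
    LoopClass T (fun x => T.boundary (g (e x))) p q := by
  obtain ⟨H⟩ := h
  have hb := T.continuous_boundary
  obtain ⟨p', q', h'⟩ := exists_loopClass_of_continuous T
    (C := fun r => T.boundary (H (projIcc 0 1 zero_le_one r.1, e r.2)))
    (by fun_prop) (fun r => T.boundary_mem _) (fun s x => by simp only [hper])
  have h0 := h' 0
  have h1 := h' 1
  simp only [projIcc_left, projIcc_right, Icc.mk_zero, Icc.mk_one, H.apply_zero,
    H.apply_one] at h0 h1
  obtain ⟨rfl, rfl⟩ := hf.unique h0
  exact h1

theorem circleExp_int_mul (n : ℤ) (x : ℝ) : Circle.exp (n * x) = Circle.exp x ^ n := by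
  ext
  rw [Circle.coe_zpow, Circle.coe_exp, Circle.coe_exp, ← Complex.exp_int_mul]
  push_cast; ring_nf

theorem loopClass_linearMap (A : SL(2, ℤ)) {μ ν : ℝ → ℝ} (hμ : Continuous μ) (hν : Continuous ν)
    {m n : ℤ} (hm : ∀ x, μ (x + 2 * Real.pi) = μ x + 2 * Real.pi * m)
    (hn : ∀ x, ν (x + 2 * Real.pi) = ν x + 2 * Real.pi * n) :
    LoopClass T (fun x => T.boundary (linearMap A (Circle.exp (μ x), Circle.exp (ν x))))
      (A.1 0 0 * m + A.1 0 1 * n) (A.1 1 0 * m + A.1 1 1 * n) := by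
  refine ⟨fun x => ((A.1 0 0 * μ x + A.1 0 1 * ν x : ℝ) : ℂ) * Complex.I,
    fun x => A.1 1 0 * μ x + A.1 1 1 * ν x, by fun_prop, by fun_prop, fun x => ?_, fun x => ?_,
    fun x => ?_⟩
  · simp only [Tube.boundary, Tube.cover, torusIncl, linearMap_apply, ← Circle.coe_exp,
      Circle.exp_add, circleExp_int_mul]
  · simp only [hm, hn]; push_cast; ring
  · simp only [hm, hn]; push_cast; ring

theorem loopClass_of_hasMatrix {φ : TorusDiffeo} {A : SL(2, ℤ)} (h : φ.HasMatrix A) :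
    LoopClass T (fun x => T.boundary (φ (Circle.exp x, 1))) (A.1 0 0) (A.1 1 0) := by
  have := loopClass_linearMap (T := T) A (μ := id) (ν := fun _ => 0) continuous_id
    continuous_const (m := 1) (n := 0) (by simp) (by simp)
  simp only [mul_one, mul_zero, add_zero, Circle.exp_zero, id] at this
  exact LoopClass.of_homotopic (e := fun x => (Circle.exp x, 1)) h.symm (by fun_prop) (by simp) this

/-- A diffeomorphism that extends over the solid torus takes the meridian to a loop that does not
wind around the second factor, since it bounds a disk in the solid torus. -/
theorem exists_angles_of_extends {ψ : TorusDiffeo} (h : ψ.ExtendsOverSolidTorus) :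
    ∃ (μ ν : ℝ → ℝ) (m : ℤ), Continuous μ ∧ Continuous ν ∧
      (∀ x, ψ (Circle.exp x, 1) = (Circle.exp (μ x), Circle.exp (ν x))) ∧
      (∀ x, μ (x + 2 * Real.pi) = μ x + 2 * Real.pi * m) ∧ ∀ x, ν (x + 2 * Real.pi) = ν x := by
  obtain ⟨Ψ, -, -, -, -, hΨ, -, hΨψ⟩ := h
  have hψ : Continuous fun x : ℝ => ψ (Circle.exp x, 1) := ψ.continuous.comp (by fun_prop)
  obtain ⟨μ, hμ, hμ'⟩ := exists_circle_lift (continuous_fst.comp hψ)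
  obtain ⟨m, hm⟩ := exists_int_of_circleExp_eq (f := fun x => μ (x + 2 * Real.pi)) (g := μ)
    (by fun_prop) hμ fun x => by
      rw [← hμ', ← hμ']; simp
  -- the second component on the disk, in polar coordinates `(s, x)`
  have hpol : Continuous fun r : ℝ × ℝ =>
      (((projIcc (0 : ℝ) 1 zero_le_one r.1 : ℝ) : ℂ) * (Circle.exp r.2 : ℂ), (1 : Circle)) := by
    fun_prop
  have hD : Continuous fun r : ℝ × ℝ =>
      (Ψ (((projIcc (0 : ℝ) 1 zero_le_one r.1 : ℝ) : ℂ) * (Circle.exp r.2 : ℂ), 1)).2 := by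
    refine continuous_snd.comp (hΨ.continuousOn.comp_continuous hpol fun r => ⟨?_, mem_univ _⟩)
    have := (projIcc (0 : ℝ) 1 zero_le_one r.1).2
    simp [abs_of_nonneg this.1, this.2]
  obtain ⟨ν, hν, hν'⟩ := exists_circle_lift hD
  obtain ⟨n, hn⟩ := exists_int_of_circleExp_eq (A := ℝ × ℝ)
    (f := fun r => ν (r.1, r.2 + 2 * Real.pi)) (g := ν)
    (by fun_prop) hν fun r => by rw [← hν', ← hν']; simp
  -- `ν` is constant on the center `s = 0` of the disk
  obtain ⟨n', hn'⟩ := exists_int_of_circleExp_eq (A := ℝ)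
    (f := fun x => ν (0, x)) (g := fun _ => ν (0, 0)) (by fun_prop) (by fun_prop) fun x => by
      rw [← hν', ← hν']; simp
  have hn0 : 2 * Real.pi * (n : ℝ) = 0 := by
    have h1 := hn (0, 0)
    have h2 := hn' (0 + 2 * Real.pi)
    have h3 := hn' 0
    simp only at h1 h2 h3
    linarith
  refine ⟨μ, fun x => ν (1, x), m, hμ, by fun_prop, fun x => ?_, hm, fun x => ?_⟩
  · refine Prod.ext (hμ' x) ?_
    have h1 := hν' (1, x)
    have h2 := hΨψ (Circle.exp x, 1)
    simp only [torusIncl] at h2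
    simp only [projIcc_right, Complex.ofReal_one, one_mul, h2] at h1
    exact h1
  · have := hn (1, x)
    simp only at this ⊢
    rw [this, hn0, add_zero]

/-- The winding numbers, up to a common sign, of the image of the meridian. -/
def flopInvariant (S : TopologicalFlop T) : Set (ℤ × ℤ) :=
  {r | LoopClass T (fun x => T.boundary (S.1.gluing (Circle.exp x, 1))) r.1 r.2 ∨
    LoopClass T (fun x => T.boundary (S.1.gluing (Circle.exp x, 1))) (-r.1) (-r.2)}

theorem flopInvariant_eq {S : TopologicalFlop T} {p q : ℤ}
    (h : LoopClass T (fun x => T.boundary (S.1.gluing (Circle.exp x, 1))) p q) :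
    flopInvariant S = {(p, q), (-p, -q)} := by
  ext ⟨a, b⟩
  simp only [flopInvariant, mem_ofPred_eq, mem_insert_iff, mem_singleton_iff, Prod.mk.injEq]
  constructor
  · rintro (h' | h')
    · left; exact h'.unique h
    · right; have := h'.unique h; omega
  · rintro (⟨rfl, rfl⟩ | ⟨rfl, rfl⟩)
    · exact .inl h
    · exact .inr (by simpa using h)

theorem flopInvariant_eq_of_mk_eq {S S' : TopologicalFlop T}
    (h : Quot.mk TopologicalFlop.Same S = Quot.mk _ S') :
    flopInvariant S = flopInvariant S' := by
  have hlift : ∀ S S' : TopologicalFlop T, S.Same S' → flopInvariant S = flopInvariant S' := by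
    rintro S S' ⟨ψ, hψ, hh⟩
    obtain ⟨A, hA⟩ := S.1.orientationPreserving
    obtain ⟨A', hA'⟩ := S'.1.orientationPreserving
    obtain ⟨μ, ν, m, hμ, hν, hμν, hm, hn⟩ := exists_angles_of_extends hψ
    have h1 := loopClass_linearMap (T := T) A hμ hν (n := 0) hm (by simpa using hn)
    simp only [← hμν, mul_zero, add_zero] at h1
    have hcomp : ContinuousMap.Homotopic ((linearMap A).comp ψ.toC) S'.1.gluing.toC :=
      (hh.trans (hA.comp (ContinuousMap.Homotopic.refl _))).symm
    have h2 := LoopClass.of_homotopic (T := T) hcomp (e := fun x => (Circle.exp x, 1))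
      (by fun_prop) (by simp) h1
    have h3 := loopClass_of_hasMatrix (T := T) hA'
    obtain ⟨e0, e1⟩ := h3.unique h2
    have hdet := det_eq_one A'
    have hm1 : IsUnit m := by
      refine isUnit_of_dvd_one ⟨A.1 0 0 * A'.1 1 1 - A'.1 0 1 * A.1 1 0, ?_⟩
      linear_combination (-1) * hdet + A'.1 1 1 * e0 - A'.1 0 1 * e1
    rw [flopInvariant_eq h3, flopInvariant_eq (loopClass_of_hasMatrix hA), e0, e1]
    rcases Int.isUnit_iff.1 hm1 with rfl | rfl
    · simp
    · simp [pair_comm]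
  exact congrArg (Quot.lift flopInvariant hlift) h

/-- Two flops whose matrices have, up to sign, the same first column are identified. -/
theorem same_of_column_eq {S S' : TopologicalFlop T} {A A' : SL(2, ℤ)}
    (hA : S.1.gluing.HasMatrix A) (hA' : S'.1.gluing.HasMatrix A')
    (h : (A'.1 0 0 = A.1 0 0 ∧ A'.1 1 0 = A.1 1 0) ∨
      (A'.1 0 0 = -A.1 0 0 ∧ A'.1 1 0 = -A.1 1 0)) : S.Same S' := by
  refine ⟨linearDiffeo (A⁻¹ * A'), extends_linearDiffeo ?_, ?_⟩
  · simp only [Matrix.SpecialLinearGroup.coe_mul, Matrix.SpecialLinearGroup.coe_inv,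
      Matrix.adjugate_fin_two, Matrix.mul_apply, Fin.sum_univ_two]
    rcases h with ⟨h0, h1⟩ | ⟨h0, h1⟩
    · simp [h0, h1]; ring
    · simp [h0, h1]; ring
  · refine ContinuousMap.Homotopic.trans hA' ?_
    rw [toC_linearDiffeo]
    have : linearMap A' = (linearMap A).comp (linearMap (A⁻¹ * A')) := by
      rw [← linearMap_mul, mul_inv_cancel_left]
    rw [this]
    exact (hA.comp (ContinuousMap.Homotopic.refl _)).symm

/-- The flop with matrix `(a, *; 2, *)`. -/
noncomputable def stdFlop (T : Tube L) (a : {a : ℤ // Odd a}) : TopologicalFlop T :=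
  ⟨⟨linearDiffeo (exists_matrix a.2).choose, _, hasMatrix_linearDiffeo _⟩, by
    obtain ⟨h0, h1⟩ := (exists_matrix a.2).choose_spec
    refine ⟨_, hasMatrix_linearDiffeo _, by rw [h1]; norm_num, ?_⟩
    rw [h0, h1]
    obtain ⟨m, hm⟩ := a.2
    refine AddCommGroup.modEq_iff_zsmul.2 ⟨-m, ?_⟩
    rw [hm]; push_cast; simp; ring⟩

theorem stdFlop_gluing (a : {a : ℤ // Odd a}) : ∃ A : SL(2, ℤ),
    (stdFlop T a).1.gluing = linearDiffeo A ∧ A.1 0 0 = a ∧ A.1 1 0 = 2 :=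
  ⟨_, rfl, (exists_matrix a.2).choose_spec⟩

/-- Since `det A = 1`, the entry `c` of a matrix with `a / c ≡ 1 / 2` divides `2` and is even, so the
first column is `± (a, 2)` with `a` odd. -/
theorem exists_mk_eq_stdFlop (S : TopologicalFlop T) : ∃ a,
    Quot.mk TopologicalFlop.Same S = Quot.mk _ (stdFlop T a) := by
  obtain ⟨A, hA, hc, hmod⟩ := S.2
  obtain ⟨z, hz⟩ := AddCommGroup.modEq_iff_zsmul.1 hmod
  have hc' : (A.1 1 0 : ℚ) ≠ 0 := by exact_mod_cast hc
  have h2 : 2 * A.1 0 0 = A.1 1 0 * (1 - 2 * z) := by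
    have : (2 : ℚ) * A.1 0 0 = A.1 1 0 * (1 - 2 * z) := by
      simp only [zsmul_eq_mul, mul_one] at hz
      rw [hz]; field_simp; ring
    exact_mod_cast this
  have hdet := det_eq_one A
  have hdvd : A.1 1 0 ∣ 2 :=
    ⟨(1 - 2 * z) * A.1 1 1 - 2 * A.1 0 1, by linear_combination (-2) * hdet + A.1 1 1 * h2⟩
  obtain ⟨a, ha, h⟩ : ∃ a : ℤ, Odd a ∧
      ((A.1 0 0 = a ∧ A.1 1 0 = 2) ∨ (A.1 0 0 = -a ∧ A.1 1 0 = -2)) := by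
    refine ⟨1 - 2 * z, ⟨-z, by ring⟩, ?_⟩
    have hle : |A.1 1 0| ≤ 2 := Int.le_of_dvd two_pos ((abs_dvd _ _).2 hdvd)
    rw [abs_le] at hle
    generalize A.1 1 0 = c at *
    have : c = -2 ∨ c = -1 ∨ c = 1 ∨ c = 2 := by omega
    rcases this with rfl | rfl | rfl | rfl <;> omega
  refine ⟨⟨a, ha⟩, ?_⟩
  obtain ⟨A', hgl, h0, h1⟩ := stdFlop_gluing (T := T) ⟨a, ha⟩
  refine (Quot.sound (same_of_column_eq (A := A') (by rw [hgl]; exact hasMatrix_linearDiffeo A')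
    hA ?_)).symm
  rwa [h0, h1]

theorem flopInvariant_stdFlop (a : {a : ℤ // Odd a}) :
    flopInvariant (stdFlop T a) = {((a : ℤ), 2), (-(a : ℤ), -2)} := by
  obtain ⟨A, hgl, h0, h1⟩ := stdFlop_gluing (T := T) a
  rw [← h0, ← h1]
  exact flopInvariant_eq (loopClass_of_hasMatrix (by rw [hgl]; exact hasMatrix_linearDiffeo A))

theorem mk_stdFlop_injective : Function.Injective
    fun a => Quot.mk TopologicalFlop.Same (stdFlop T a) := fun a a' h => by
  have := flopInvariant_eq_of_mk_eq h
  rw [flopInvariant_stdFlop, flopInvariant_stdFlop] at this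
  have h1 : ((a : ℤ), (2 : ℤ)) ∈ ({((a' : ℤ), 2), (-(a' : ℤ), -2)} : Set (ℤ × ℤ)) := by
    rw [← this]; simp
  simpa [Subtype.ext_iff] using h1

/-- If `φ` takes the meridian to the boundary of `B`, both have the same winding numbers. -/
theorem invariant_eq_of_meridianToBoundary [T2Space M] {B : MobiusBand L} {S : TopologicalFlop T}
    (h : MeridianToBoundary B S) : bandInvariant T B = flopInvariant S := by
  obtain ⟨F, hF, hFB, hsub, hm⟩ := h
  obtain ⟨A, hA⟩ := S.1.orientationPreserving
  have h1I : (1 : ℝ) ∈ Icc (-1 : ℝ) 1 := by norm_num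
  have hmem : ∀ x, ∀ y ∈ Ioc (0 : ℝ) 1, F (x, y) ∈ range T.toFun := fun x y hy => by
    have : F (x, y) ∈ B.1 := hFB ▸ ⟨_, mem_strip.2 ⟨by linarith [hy.1], hy.2⟩, rfl⟩
    exact image_subset_range _ _ (hsub this)
  have hFc : Continuous fun x => F (2 * x, 1) :=
    hF.continuousOn.comp_continuous (by fun_prop) fun x => mem_strip.2 h1I
  have hSc : Continuous fun x : ℝ => T.boundary (S.1.gluing (Circle.exp x, 1)) :=
    T.continuous_boundary.comp (S.1.gluing.continuous.comp (by fun_prop))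
  obtain ⟨p, q, hpq⟩ := exists_loopClass T hFc
    (fun x => ⟨hmem _ _ (by simp), fun h => by simpa using (hF.mem_iff h1I).1 h⟩)
    (fun x => hF.double_periodic h1I x)
  have hS := loopClass_of_hasMatrix (T := T) hA
  have hr1 : range (fun x => F (2 * x, 1)) = F '' (univ ×ˢ {1}) := by
    ext b; constructor
    · rintro ⟨x, rfl⟩; exact ⟨(2 * x, 1), ⟨mem_univ _, rfl⟩, rfl⟩
    · rintro ⟨⟨x, y⟩, ⟨-, hy⟩, rfl⟩
      obtain rfl : y = 1 := hy
      exact ⟨x / 2, by simp only; congr 2; ring⟩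
  have hr2 : range (fun x : ℝ => T.boundary (S.1.gluing (Circle.exp x, 1))) =
      T.boundary '' (S.1.gluing '' meridian) := by
    ext b; constructor
    · rintro ⟨x, rfl⟩; exact ⟨_, ⟨(Circle.exp x, 1), ⟨mem_univ _, rfl⟩, rfl⟩, rfl⟩
    · rintro ⟨_, ⟨⟨u, v⟩, ⟨-, hv⟩, rfl⟩, rfl⟩
      obtain rfl : v = 1 := hv
      obtain ⟨x, rfl⟩ := Circle.exp_surjective u
      exact ⟨x, rfl⟩
  have hrr := hr2.trans (hm.trans hr1.symm)
  obtain ⟨k, hk⟩ := hpq.exists_mul hS hFc hSc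
    (fun x y => by rw [hF.double_eq_iff (by simp) (by simp)]; simp) (by simp) hrr.subset
  obtain ⟨k', hk'⟩ := hS.exists_mul hpq hSc hFc
    (fun x y => by simp [T.boundary_injective.eq_iff])
    (hF.double_periodic h1I) hrr.symm.subset
  rw [bandInvariant_eq hF hFB (.of_loopClass hF (by simp) hmem hpq), flopInvariant_eq hS]
  rcases eq_or_eq_neg_of_mul hk hk' with ⟨h0, h1⟩ | ⟨h0, h1⟩
  · rw [h0, h1]
  · rw [h0, h1, neg_neg, neg_neg, pair_comm]

end Surgery

end MobiusFlop

namespace MobiusFlop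

universe u

/-! ### Smooth division by a coordinate, and smooth logarithms -/

section Calculus

open MeasureTheory in
theorem hasFDerivAt_intervalIntegral_of_contDiff {E F : Type u} [NormedAddCommGroup E]
    [NormedSpace ℝ E] [FiniteDimensional ℝ E] [NormedAddCommGroup F] [NormedSpace ℝ F]
    [CompleteSpace F] {f : E × ℝ → F} (hf : ContDiff ℝ 1 f) (x : E) :
    HasFDerivAt (fun x => ∫ τ in (0 : ℝ)..1, f (x, τ))
      (∫ τ in (0 : ℝ)..1, (fderiv ℝ f (x, τ)).comp (.inl ℝ E ℝ)) x := by
  have hf' : Continuous fun r : E × ℝ => (fderiv ℝ f r).comp (.inl ℝ E ℝ) :=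
    (hf.continuous_fderiv one_ne_zero).clm_comp continuous_const
  obtain ⟨K, hK⟩ := ((isCompact_closedBall x 1).prod (isCompact_Icc (a := (0 : ℝ)) (b := 1)))
    |>.exists_bound_of_continuousOn hf'.continuousOn
  have hfc := hf.continuous
  have := secondCountableTopologyEither_of_left ℝ (E →L[ℝ] F)
  refine intervalIntegral.hasFDerivAt_integral_of_dominated_of_fderiv_le (bound := fun _ => K)
    (Metric.closedBall_mem_nhds x one_pos)
    (.of_forall fun y => Continuous.aestronglyMeasurable (by fun_prop))
    (Continuous.intervalIntegrable (by fun_prop) _ _)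
    (Continuous.aestronglyMeasurable (by fun_prop))
    (.of_forall fun t ht y hy => hK (y, t) ⟨hy, ?_⟩) intervalIntegrable_const
    (.of_forall fun t ht y hy => ?_)
  · rw [uIoc_of_le zero_le_one] at ht; exact ⟨ht.1.le, ht.2⟩
  · exact HasFDerivAt.comp y (g := f) (f := fun e => (e, t))
      (hf.differentiable one_ne_zero (y, t)).hasFDerivAt (hasFDerivAt_prodMk_left y t)

theorem contDiff_intervalIntegral_nat (n : ℕ) {E : Type u} [NormedAddCommGroup E]
    [NormedSpace ℝ E] [FiniteDimensional ℝ E] :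
    ∀ {F : Type u} [NormedAddCommGroup F] [NormedSpace ℝ F] [CompleteSpace F]
      {f : E × ℝ → F}, ContDiff ℝ ∞ f → ContDiff ℝ n fun x => ∫ τ in (0 : ℝ)..1, f (x, τ) := by
  induction n with
  | zero =>
    intro F _ _ _ f hf
    refine contDiff_zero.2 (continuous_iff_continuousAt.2 fun x => ?_)
    exact (hasFDerivAt_intervalIntegral_of_contDiff (hf.of_le (by simp)) x).continuousAt
  | succ n ih =>
    intro F _ _ _ f hf
    push_cast
    exact contDiff_succ_iff_hasFDerivAt.2 ⟨_,
      ih (f := fun r => (fderiv ℝ f r).comp (.inl ℝ E ℝ))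
        ((hf.fderiv_right (m := ∞) (by simp)).clm_comp contDiff_const),
      fun x => hasFDerivAt_intervalIntegral_of_contDiff (hf.of_le (by simp)) x⟩

theorem contDiff_intervalIntegral {E F : Type u} [NormedAddCommGroup E]
    [NormedSpace ℝ E] [FiniteDimensional ℝ E] [NormedAddCommGroup F] [NormedSpace ℝ F]
    [CompleteSpace F] {f : E × ℝ → F} (hf : ContDiff ℝ ∞ f) :
    ContDiff ℝ ∞ fun x => ∫ τ in (0 : ℝ)..1, f (x, τ) :=
  contDiff_infty.2 fun n => contDiff_intervalIntegral_nat n hf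

/-- Hadamard's lemma: a smooth function that vanishes on the line `y = 0` is divisible by `y`. -/
theorem exists_eq_smul_of_eq_zero {F : Type} [NormedAddCommGroup F] [NormedSpace ℝ F]
    [CompleteSpace F] {z : ℝ × ℝ → F} (hz : ContDiff ℝ ∞ z) (h0 : ∀ x, z (x, 0) = 0) :
    ∃ k : ℝ × ℝ → F, ContDiff ℝ ∞ k ∧ ∀ x y, z (x, y) = y • k (x, y) := by
  have hz' : ContDiff ℝ ∞ fun r : (ℝ × ℝ) × ℝ => fderiv ℝ z (r.1.1, r.2 * r.1.2) (0, 1) :=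
    ((hz.fderiv_right (m := ∞) (by simp)).comp
      (g := fderiv ℝ z) (f := fun r : (ℝ × ℝ) × ℝ => (r.1.1, r.2 * r.1.2))
      (by fun_prop)).clm_apply contDiff_const
  refine ⟨_, contDiff_intervalIntegral hz', fun x y => ?_⟩
  have hd : ∀ τ : ℝ, HasDerivAt (fun τ => z (x, τ * y)) (y • fderiv ℝ z (x, τ * y) (0, 1)) τ := by
    intro τ
    have h1 := (hz.differentiable (by simp) (x, τ * y)).hasFDerivAt
    have h2 : HasDerivAt (fun τ : ℝ => (x, τ * y)) ((0 : ℝ), y) τ := by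
      simpa using (hasDerivAt_const τ x).prodMk ((hasDerivAt_id τ).mul_const y)
    have h3 := h1.comp_hasDerivAt τ h2
    have h4 : y • fderiv ℝ z (x, τ * y) (0, 1) = fderiv ℝ z (x, τ * y) (0, y) := by
      rw [← map_smul]; simp
    rw [h4]; exact h3
  have hc : Continuous fun τ : ℝ => y • fderiv ℝ z (x, τ * y) (0, 1) := by
    have h1 : Continuous fun τ : ℝ => ((x, y), τ) := by fun_prop
    exact (hz'.continuous.comp h1).const_smul y
  have := intervalIntegral.integral_eq_sub_of_hasDerivAt (fun τ _ => hd τ)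
    (hc.intervalIntegrable 0 1)
  rw [intervalIntegral.integral_smul] at this
  simp only [one_mul, zero_mul, h0, sub_zero] at this
  exact this.symm

/-- A continuous logarithm of a smooth function is smooth. -/
theorem contDiff_of_exp {l : ℝ → ℂ} (hl : Continuous l) {n : ℝ → ℂ} (hn : ContDiff ℝ ∞ n)
    (h : ∀ x, n x = Complex.exp (l x)) : ContDiff ℝ ∞ l := by
  refine contDiff_iff_contDiffAt.2 fun x => ?_
  have h1 : ContDiffAt ℝ ∞ (fun y => l x + Complex.log (n y / n x)) x := by
    refine contDiffAt_const.add (ContDiffAt.comp x (g := Complex.log) ?_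
      (hn.div_const (n x)).contDiffAt)
    rw [div_self (by rw [h]; exact Complex.exp_ne_zero _)]
    exact (Complex.contDiffAt_log (by simp)).restrict_scalars ℝ
  refine h1.congr_of_eventuallyEq ?_
  have h2 : ∀ᶠ y in 𝓝 x, ‖l y - l x‖ < Real.pi := by
    have : Continuous fun y => ‖l y - l x‖ := by fun_prop
    exact this.continuousAt.eventually_lt continuousAt_const (by simpa using Real.pi_pos)
  filter_upwards [h2] with y hy
  have h3 := (Complex.abs_im_le_norm _).trans_lt hy
  rw [abs_lt] at h3
  rw [h, h, ← Complex.exp_sub, Complex.log_exp h3.1 h3.2.le]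
  ring

end Calculus

/-! ### The universal cover of the tube as a local diffeomorphism -/

section Cover

theorem contMDiff_coe_circle : ContMDiff (𝓡 1) 𝓘(ℝ, ℂ) ∞ (fun u : Circle => (u : ℂ)) := by
  have := finrank_real_complex_fact'
  exact contMDiff_coe_sphere (E := ℂ) (n := 1)

/-- The map `(z, t) ↦ (z, e^{it})`. -/
noncomputable def expCover (p : ℂ × ℝ) : ℂ × Circle := (p.1, Circle.exp p.2)

theorem contMDiff_expCover :
    ContMDiff 𝓘(ℝ, ℂ × ℝ) (𝓘(ℝ, ℂ).prod (𝓡 1)) ∞ expCover :=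
  contDiff_fst.contMDiff.prodMk (contMDiff_circleExp.comp contDiff_snd.contMDiff)

theorem isLocalDiffeomorph_expCover :
    IsLocalDiffeomorph 𝓘(ℝ, ℂ × ℝ) (𝓘(ℝ, ℂ).prod (𝓡 1)) ∞ expCover := by
  rintro ⟨z₀, t₀⟩
  let g : ℂ × Circle → ℂ × ℝ := fun p => (p.1, t₀ + Complex.arg (p.2 * Circle.exp (-t₀) : Circle))
  have hcont : Continuous fun p : ℂ × Circle => ((p.2 * Circle.exp (-t₀) : Circle) : ℂ) := by
    fun_prop
  have hsm : ContMDiff (𝓘(ℝ, ℂ).prod (𝓡 1)) 𝓘(ℝ, ℂ) ∞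
      fun p : ℂ × Circle => ((p.2 * Circle.exp (-t₀) : Circle) : ℂ) :=
    contMDiff_coe_circle.comp (contMDiff_snd.mul contMDiff_const)
  have harg : ∀ t ∈ Ioo (t₀ - Real.pi) (t₀ + Real.pi),
      Complex.arg (Circle.exp t * Circle.exp (-t₀) : Circle) = t - t₀ := fun t ht => by
    rw [← Circle.exp_add, Circle.arg_exp] <;> linarith [ht.1, ht.2]
  have hslit : ∀ t ∈ Ioo (t₀ - Real.pi) (t₀ + Real.pi),
      ((Circle.exp t * Circle.exp (-t₀) : Circle) : ℂ) ∈ Complex.slitPlane := fun t ht => by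
    rw [Complex.mem_slitPlane_iff_arg, harg t ht]
    exact ⟨by linarith [ht.2], Circle.coe_ne_zero _⟩
  let Φ : PartialDiffeomorph 𝓘(ℝ, ℂ × ℝ) (𝓘(ℝ, ℂ).prod (𝓡 1)) (ℂ × ℝ) (ℂ × Circle) ∞ :=
    { toFun := expCover
      invFun := g
      source := {p | p.2 ∈ Ioo (t₀ - Real.pi) (t₀ + Real.pi)}
      target := {p | ((p.2 * Circle.exp (-t₀) : Circle) : ℂ) ∈ Complex.slitPlane}
      map_source' := fun p hp => hslit p.2 hp
      map_target' := fun p hp => by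
        have h1 := Complex.neg_pi_lt_arg ((p.2 * Circle.exp (-t₀) : Circle) : ℂ)
        have h2 := Complex.arg_le_pi ((p.2 * Circle.exp (-t₀) : Circle) : ℂ)
        have h3 := (Complex.mem_slitPlane_iff_arg.1 hp).1
        exact ⟨by simp only [g]; linarith, by simp only [g]; linarith [lt_of_le_of_ne h2 h3]⟩
      left_inv' := fun p hp => by
        refine Prod.ext rfl ?_
        simp only [g, expCover]
        rw [harg p.2 hp]; ring
      right_inv' := fun p hp => by
        refine Prod.ext rfl ?_
        simp only [g, expCover]
        rw [Circle.exp_add, Circle.exp_arg, Circle.exp_neg]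
        simp
      open_source := isOpen_Ioo.preimage continuous_snd
      open_target := Complex.isOpen_slitPlane.preimage hcont
      contMDiffOn_toFun := contMDiff_expCover.contMDiffOn
      contMDiffOn_invFun := fun p hp => ContMDiffAt.contMDiffWithinAt <| by
        refine contMDiffAt_fst.prodMk_space (contMDiffAt_const.add ?_)
        have h1 : ContDiffAt ℝ ∞ (fun z : ℂ => (Complex.log z).im)
            ((p.2 * Circle.exp (-t₀) : Circle) : ℂ) :=
          Complex.imCLM.contDiff.contDiffAt.comp _
            ((Complex.contDiffAt_log hp).restrict_scalars ℝ)
        simp only [Complex.log_im] at h1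
        exact h1.contMDiffAt.comp p (hsm p) }
  exact ⟨Φ, by simp [Φ, Real.pi_pos], fun _ _ => rfl⟩

variable {M : Type*} [TopologicalSpace M] [ChartedSpace (EuclideanSpace ℝ (Fin 3)) M]
  {L : Set M} (T : Tube L)

theorem Tube.isLocalDiffeomorph_cover :
    IsLocalDiffeomorph 𝓘(ℝ, ℂ × ℝ) (𝓡 3) ∞ T.cover := fun p =>
  (isLocalDiffeomorph_expCover p).comp (𝓡 3) M (T.isLocalDiffeomorph _)

theorem Tube.contMDiff_cover : ContMDiff 𝓘(ℝ, ℂ × ℝ) (𝓡 3) ∞ T.cover :=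
  T.isLocalDiffeomorph_cover.contMDiff

theorem Tube.contDiff_of_cover {E : Type*} [NormedAddCommGroup E] [NormedSpace ℝ E]
    {G : E → ℂ × ℝ} (hG : Continuous G)
    (h : ContMDiff 𝓘(ℝ, E) (𝓡 3) ∞ fun a => T.cover (G a)) : ContDiff ℝ ∞ G := by
  refine contDiff_iff_contDiffAt.2 fun a => ?_
  have hloc := T.isLocalDiffeomorph_cover (G a)
  have h1 : ContMDiffAt 𝓘(ℝ, E) 𝓘(ℝ, ℂ × ℝ) ∞ (fun b => hloc.localInverse (T.cover (G b))) a :=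
    hloc.localInverse_contMDiffAt.comp a (h a)
  refine h1.contDiffAt.congr_of_eventuallyEq ?_
  filter_upwards [hG.continuousAt.eventually hloc.localInverse_eventuallyEq_left] with b hb
  exact hb.symm

theorem uniqueDiffOn_strip : UniqueDiffOn ℝ strip :=
  uniqueDiffOn_univ.prod (uniqueDiffOn_Icc (by norm_num))

theorem Tube.mfderivWithin_cover_injective_iff {G : ℝ × ℝ → ℂ × ℝ} {p : ℝ × ℝ}
    (hG : DifferentiableAt ℝ G p) (hp : p ∈ strip) :
    Function.Injective (mfderivWithin 𝓘(ℝ, ℝ × ℝ) (𝓡 3) (fun q => T.cover (G q)) strip p) ↔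
      Function.Injective (fderiv ℝ G p) := by
  have hu : UniqueMDiffWithinAt 𝓘(ℝ, ℝ × ℝ) strip p := (uniqueDiffOn_strip p hp).uniqueMDiffWithinAt
  have hloc := T.isLocalDiffeomorph_cover (G p)
  have h1 : mfderivWithin 𝓘(ℝ, ℝ × ℝ) (𝓡 3) (T.cover ∘ G) strip p =
      (mfderiv 𝓘(ℝ, ℂ × ℝ) (𝓡 3) T.cover (G p)).comp (fderiv ℝ G p) := by
    rw [mfderiv_comp_mfderivWithin p (hloc.mdifferentiableAt (by simp))
      hG.mdifferentiableAt.mdifferentiableWithinAt hu,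
      mfderivWithin_eq_mfderiv hu hG.mdifferentiableAt, mfderiv_eq_fderiv]
    rfl
  have h2 : Function.Injective (mfderiv 𝓘(ℝ, ℂ × ℝ) (𝓡 3) T.cover (G p)) :=
    (hloc.mfderivToContinuousLinearEquiv (by simp)).injective
  change Function.Injective (mfderivWithin 𝓘(ℝ, ℝ × ℝ) (𝓡 3) (T.cover ∘ G) strip p) ↔ _
  rw [h1]
  exact h2.of_comp_iff _

end Cover

end MobiusFlop

namespace MobiusFlop

/-! ### Linear Möbius bands in the tube -/

section LinearBand

/-- The data of a Möbius band that is a line bundle in the tube: the line over the point with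
angle `θ x` is spanned by `exp (l x)`. The line makes `a` half twists while the angle `θ` runs
around the core once, in the direction `ε = ± 1`. -/
structure BandData (l : ℝ → ℂ) (θ : ℝ → ℝ) (a ε : ℤ) : Prop where
  contDiff_log : ContDiff ℝ ∞ l
  contDiff_angle : ContDiff ℝ ∞ θ
  odd : Odd a
  sq_eq_one : ε * ε = 1
  log_add : ∀ x, l (x + 2 * Real.pi) = l x + Real.pi * a * Complex.I
  angle_add : ∀ x, θ (x + 2 * Real.pi) = θ x + 2 * Real.pi * ε
  deriv_pos : ∀ x, 0 < ε * deriv θ x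

namespace BandData

variable {l l' : ℝ → ℂ} {θ θ' : ℝ → ℝ} {a ε : ℤ}

theorem log_add_int (h : BandData l θ a ε) (n : ℤ) (x : ℝ) :
    l (x + 2 * Real.pi * n) = l x + n * (Real.pi * a * Complex.I) :=
  apply_add_int_mul h.log_add n x

theorem angle_add_int (h : BandData l θ a ε) (n : ℤ) (x : ℝ) :
    θ (x + 2 * Real.pi * n) = θ x + n * (2 * Real.pi * ε) :=
  apply_add_int_mul' h.angle_add n x

theorem exp_log_add_int (h : BandData l θ a ε) (n : ℤ) (x : ℝ) :
    Complex.exp (l (x + 2 * Real.pi * n)) = (-1) ^ n * Complex.exp (l x) := by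
  have h1 : Complex.exp (Real.pi * a * Complex.I) = -1 := by
    rw [show Real.pi * a * Complex.I = (a : ℂ) * (Real.pi * Complex.I) by ring,
      Complex.exp_int_mul, Complex.exp_pi_mul_I, h.odd.neg_one_zpow]
  rw [h.log_add_int, Complex.exp_add, Complex.exp_int_mul, h1, mul_comm]

theorem sq_eq_one_real (h : BandData l θ a ε) : (ε : ℝ) * ε = 1 := by
  exact_mod_cast h.sq_eq_one

theorem injective (h : BandData l θ a ε) : Function.Injective θ := by
  have h1 : StrictMono fun x => ε * θ x := by
    refine strictMono_of_deriv_pos fun x => ?_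
    rw [deriv_const_mul _ (h.contDiff_angle.differentiable (by simp) x)]
    exact h.deriv_pos x
  exact fun x y hxy => h1.injective (by simp only [hxy])

theorem surjective (h : BandData l θ a ε) : Function.Surjective θ := by
  intro t
  have hN : ∀ N : ℤ, θ (0 + 2 * Real.pi * (ε * N : ℤ)) = θ 0 + 2 * Real.pi * N := fun N => by
    rw [h.angle_add_int]; push_cast
    linear_combination (2 * Real.pi * N) * h.sq_eq_one_real
  have hpi : 0 < 2 * Real.pi := by positivity
  refine mem_range_of_exists_le_of_exists_ge h.contDiff_angle.continuous
    ⟨_, (hN ⌊(t - θ 0) / (2 * Real.pi)⌋).trans_le ?_⟩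
    ⟨_, le_of_le_of_eq ?_ (hN ⌈(t - θ 0) / (2 * Real.pi)⌉).symm⟩
  · have := mul_le_mul_of_nonneg_left (Int.floor_le ((t - θ 0) / (2 * Real.pi))) hpi.le
    rw [mul_div_cancel₀ _ hpi.ne'] at this
    linarith
  · have := mul_le_mul_of_nonneg_left (Int.le_ceil ((t - θ 0) / (2 * Real.pi))) hpi.le
    rw [mul_div_cancel₀ _ hpi.ne'] at this
    linarith

theorem convex (h : BandData l θ a ε) (h' : BandData l' θ' a ε) {t : ℝ} (ht : t ∈ Icc (0 : ℝ) 1) :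
    BandData (fun x => (1 - t) * l x + t * l' x) (fun x => (1 - t) * θ x + t * θ' x) a ε where
  contDiff_log := by
    have := h.contDiff_log
    have := h'.contDiff_log
    fun_prop
  contDiff_angle := by
    have := h.contDiff_angle
    have := h'.contDiff_angle
    fun_prop
  odd := h.odd
  sq_eq_one := h.sq_eq_one
  log_add x := by rw [h.log_add, h'.log_add]; ring
  angle_add x := by rw [h.angle_add, h'.angle_add]; ring
  deriv_pos x := by
    have e1 := h.contDiff_angle.differentiable (by simp) x
    have e2 := h'.contDiff_angle.differentiable (by simp) x
    have h1 := h.deriv_pos x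
    have h2 := h'.deriv_pos x
    have e3 := ((e1.hasDerivAt.const_mul (1 - t)).add (e2.hasDerivAt.const_mul t)).deriv
    have e4 : deriv (fun x => (1 - t) * θ x + t * θ' x) x =
      (1 - t) * deriv θ x + t * deriv θ' x := e3
    rw [e4]
    rcases ht.1.eq_or_lt with rfl | h0
    · simpa using h1
    · nlinarith [mul_pos h0 h2, mul_nonneg (sub_nonneg.2 ht.2) h1.le]

end BandData

variable {M : Type*} [TopologicalSpace M] [ChartedSpace (EuclideanSpace ℝ (Fin 3)) M]
  {L : Set M} (T : Tube L)

/-- The line bundle over the core with the given data, see `BandData`. -/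
noncomputable def linearBand (l : ℝ → ℂ) (θ : ℝ → ℝ) (p : ℝ × ℝ) : M :=
  T.cover (p.2 • Complex.exp (l p.1), θ p.1)

theorem image_center_eq {G : ℝ × ℝ → ℂ × ℝ} {θ : ℝ → ℝ} (hθ : Function.Surjective θ)
    (hG : ∀ x, G (x, 0) = (0, θ x)) : (fun p => T.cover (G p)) '' (univ ×ˢ {0}) = L := by
  refine Subset.antisymm ?_ fun b hb => ?_
  · rintro _ ⟨⟨x, y⟩, ⟨-, hy⟩, rfl⟩
    obtain rfl : y = 0 := hy
    simp only [hG]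
    exact T.cover_mem_iff.2 rfl
  · obtain ⟨⟨z, u⟩, ⟨hz, -⟩, rfl⟩ := T.core.symm.subset hb
    obtain rfl : z = 0 := hz
    obtain ⟨t, rfl⟩ := Circle.exp_surjective u
    obtain ⟨x, rfl⟩ := hθ t
    exact ⟨(x, 0), ⟨mem_univ _, rfl⟩, by simp only [hG]; rfl⟩

theorem BandData.isMobiusEmbedding {l : ℝ → ℂ} {θ : ℝ → ℝ} {a ε : ℤ} (h : BandData l θ a ε) :
    IsMobiusEmbedding (linearBand T l θ) L where
  smooth := by
    have h1 := h.contDiff_log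
    have h2 := h.contDiff_angle
    exact (T.contMDiff_cover.comp (ContDiff.contMDiff (f := fun p : ℝ × ℝ =>
      (p.2 • Complex.exp (l p.1), θ p.1)) (by fun_prop))).contMDiffOn
  immersion := by
    rintro ⟨x, y⟩ hp
    have h1 : HasDerivAt (fun x => Complex.exp (l x)) (Complex.exp (l x) * deriv l x) x :=
      (h.contDiff_log.differentiable (by simp) x).hasDerivAt.cexp
    have h2 := (h.contDiff_angle.differentiable (by simp) x).hasDerivAt
    have hf : HasFDerivAt (fun p : ℝ × ℝ => p.1) (ContinuousLinearMap.fst ℝ ℝ ℝ) (x, y) :=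
      hasFDerivAt_fst
    have hs : HasFDerivAt (fun p : ℝ × ℝ => p.2) (ContinuousLinearMap.snd ℝ ℝ ℝ) (x, y) :=
      hasFDerivAt_snd
    have h3 := hs.smul (h1.hasFDerivAt.comp (x, y) hf)
    have h4 := h2.hasFDerivAt.comp (x, y) hf
    have h5 : HasFDerivAt (fun p : ℝ × ℝ => (p.2 • Complex.exp (l p.1), θ p.1)) _ (x, y) :=
      h3.prodMk h4
    refine (T.mfderivWithin_cover_injective_iff h5.differentiableAt hp).2 ?_
    rw [h5.fderiv, injective_iff_map_eq_zero]
    rintro ⟨v, w⟩ hv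
    rw [ContinuousLinearMap.prod_apply, Prod.mk_eq_zero] at hv
    obtain ⟨hv1, hv2⟩ := hv
    have hθ : deriv θ x ≠ 0 := fun h0 => by simpa [h0] using h.deriv_pos x
    have hv0 : v = 0 := by simpa [hθ] using hv2
    subst hv0
    simpa using hv1
  eq_iff := by
    rintro ⟨x, y⟩ - ⟨x', y'⟩ -
    simp only [linearBand, T.cover_eq_iff, SamePoint]
    constructor
    · rintro ⟨h1, h2⟩
      obtain ⟨m, hm⟩ := Circle.exp_eq_exp.1 h2
      have hx : x' = x + 2 * Real.pi * (-(ε * m) : ℤ) := by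
        apply h.injective
        rw [h.angle_add_int, hm]; push_cast
        linear_combination (2 * Real.pi * m) * h.sq_eq_one_real
      refine ⟨-(ε * m), hx, ?_⟩
      rw [hx, h.exp_log_add_int] at h1
      generalize (-(ε * m) : ℤ) = n at *
      have h3 : (y : ℂ) = y' * (-1) ^ n := by
        refine mul_right_cancel₀ (Complex.exp_ne_zero (l x)) ?_
        rw [← Complex.real_smul, h1, Complex.real_smul]; ring
      have h4 : y = y' * (-1) ^ n := Complex.ofReal_injective (by push_cast; exact h3)
      rw [h4, mul_left_comm, ← mul_zpow]; simp
    · rintro ⟨n, rfl, rfl⟩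
      refine ⟨?_, ?_⟩
      · rw [h.exp_log_add_int, Complex.real_smul, Complex.real_smul]
        push_cast
        rw [mul_mul_mul_comm, ← mul_assoc, mul_comm ((-1 : ℂ) ^ n), mul_assoc, mul_assoc,
          ← mul_assoc ((-1 : ℂ) ^ n), ← mul_zpow]
        simp
      · rw [h.angle_add_int, eq_comm, Circle.exp_eq_exp]
        exact ⟨n * ε, by push_cast; ring⟩
  center := image_center_eq T h.surjective (G := fun p => (p.2 • Complex.exp (l p.1), θ p.1))
    fun x => by simp

/-- The image of an embedding of the Möbius band. -/
def IsMobiusEmbedding.band {F : ℝ × ℝ → M} (hF : IsMobiusEmbedding F L) : MobiusBand L :=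
  ⟨F '' strip, F, hF, rfl⟩

theorem isotopic_linearBand {l l' : ℝ → ℂ} {θ θ' : ℝ → ℝ} {a ε : ℤ} (h : BandData l θ a ε)
    (h' : BandData l' θ' a ε) :
    (h.isMobiusEmbedding T).band.Isotopic (h'.isMobiusEmbedding T).band := by
  have h1 := h.contDiff_log
  have h2 := h.contDiff_angle
  have h1' := h'.contDiff_log
  have h2' := h'.contDiff_angle
  refine ⟨fun r => linearBand T (fun x => (1 - r.1) * l x + r.1 * l' x)
    (fun x => (1 - r.1) * θ x + r.1 * θ' x) r.2, ?_,
    fun t ht => (h.convex h' ht).isMobiusEmbedding T, ?_, ?_⟩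
  · have h1f : ContDiff ℝ ∞ fun r : ℝ × (ℝ × ℝ) => l r.2.1 := by fun_prop
    have h1f' : ContDiff ℝ ∞ fun r : ℝ × (ℝ × ℝ) => l' r.2.1 := by fun_prop
    have hr : ContDiff ℝ ∞ fun r : ℝ × (ℝ × ℝ) => (r.1 : ℂ) :=
      Complex.ofRealCLM.contDiff.comp contDiff_fst
    have hsm : ContDiff ℝ ∞ fun r : ℝ × (ℝ × ℝ) =>
        (r.2.2 • Complex.exp ((1 - (r.1 : ℂ)) * l r.2.1 + r.1 * l' r.2.1),
          (1 - r.1) * θ r.2.1 + r.1 * θ' r.2.1) := by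
      have h3 := (((contDiff_const (c := (1 : ℂ))).sub hr).mul h1f).add (hr.mul h1f')
      exact (contDiff_snd.snd.smul h3.cexp).prodMk (by fun_prop)
    exact (T.contMDiff_cover.comp hsm.contMDiff).contMDiffOn
  · simp [IsMobiusEmbedding.band]
  · simp [IsMobiusEmbedding.band]

theorem bandData_std {a ε : ℤ} (ha : Odd a) (hε : ε * ε = 1) :
    BandData (fun x => (a * x / 2 : ℝ) * Complex.I) (fun x => ε * x) a ε where
  contDiff_log := (Complex.ofRealCLM.contDiff.comp (f := fun x : ℝ => (a * x / 2 : ℝ))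
    (by fun_prop)).mul contDiff_const
  contDiff_angle := by fun_prop
  odd := ha
  sq_eq_one := hε
  log_add x := by push_cast; ring
  angle_add x := by ring
  deriv_pos x := by
    have h1 : deriv (fun x : ℝ => (ε : ℝ) * x) x = ε := by
      simp
    have h2 : (ε : ℝ) * ε = 1 := by exact_mod_cast hε
    rw [h1, h2]; exact one_pos

/-- The standard Möbius band with `a` half twists, as a map. -/
noncomputable def stdEmb (a : ℤ) : ℝ × ℝ → M :=
  linearBand T (fun x => (a * x / 2 : ℝ) * Complex.I) (fun x => (1 : ℤ) * x)

theorem isMobiusEmbedding_stdEmb {a : ℤ} (ha : Odd a) : IsMobiusEmbedding (stdEmb T a) L :=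
  (bandData_std ha rfl).isMobiusEmbedding T

/-- The standard Möbius band with `a` half twists. -/
noncomputable def stdBand (a : {a : ℤ // Odd a}) : MobiusBand L :=
  (isMobiusEmbedding_stdEmb T a.2).band

theorem stdEmb_apply (a : ℤ) (x y : ℝ) : stdEmb T a (x, y) =
    T.toFun (y * (Circle.exp (a * x / 2) : ℂ), Circle.exp x) := by
  simp [stdEmb, linearBand, Tube.cover, Circle.coe_exp]

theorem mk_eq_stdBand_of_bandData {l : ℝ → ℂ} {θ : ℝ → ℝ} {a ε : ℤ} (h : BandData l θ a ε) :
    ∃ a, Quot.mk MobiusBand.Isotopic (h.isMobiusEmbedding T).band = Quot.mk _ (stdBand T a) := by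
  have hε2 := h.sq_eq_one
  have hε : ε = 1 ∨ ε = -1 := by
    rcases Int.mul_eq_one_iff_eq_one_or_neg_one.1 hε2 with h | h
    · exact .inl h.1
    · exact .inr h.1
  have hodd : Odd (ε * a) := by
    rcases hε with rfl | rfl
    · simp [h.odd]
    · simp [h.odd]
  refine ⟨⟨ε * a, hodd⟩, (Quot.sound (isotopic_linearBand T h (bandData_std h.odd hε2))).trans ?_⟩
  -- running through the core in the opposite direction does not change the image
  refine congrArg _ (Subtype.ext ?_)
  have hεr : (ε : ℝ) * ε = 1 := by exact_mod_cast hε2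
  have key : ∀ x y : ℝ, linearBand T (fun x => (a * x / 2 : ℝ) * Complex.I) (fun x => ε * x)
      (x, y) = stdEmb T (ε * a) (ε * x, y) := fun x y => by
    have e1 : ((ε * a : ℤ) : ℝ) * (ε * x) / 2 = a * x / 2 := by
      push_cast
      linear_combination ((a : ℝ) * x / 2) * hεr
    simp only [stdEmb, linearBand, e1, Int.cast_one, one_mul]
  ext b
  constructor
  · rintro ⟨⟨x, y⟩, hxy, rfl⟩
    exact ⟨(ε * x, y), mem_strip.2 (mem_strip.1 hxy), (key x y).symm⟩
  · rintro ⟨⟨x, y⟩, hxy, rfl⟩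
    refine ⟨(ε * x, y), mem_strip.2 (mem_strip.1 hxy), (key _ _).trans ?_⟩
    rw [← mul_assoc, hεr, one_mul]

theorem bandInvariant_stdBand [T2Space M] (a : {a : ℤ // Odd a}) :
    bandInvariant T (stdBand T a) = {((a : ℤ), 2), (-(a : ℤ), -2)} := by
  refine bandInvariant_eq (isMobiusEmbedding_stdEmb T a.2) rfl
    (.of_loopClass (isMobiusEmbedding_stdEmb T a.2) (δ := 1) (by simp)
      (fun x y _ => T.cover_mem_range _) ?_)
  refine ⟨fun x => (a * x : ℝ) * Complex.I, fun x => 2 * x, by fun_prop, by fun_prop, fun x => ?_,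
    fun x => ?_, fun x => ?_⟩
  · simp only [stdEmb_apply, Tube.cover, Circle.coe_exp]
    congr 4
    simp only [Complex.ofReal_one, one_mul]
    congr 3; ring
  · push_cast; ring
  · push_cast; ring

theorem mk_stdBand_injective [T2Space M] : Function.Injective
    fun a => Quot.mk MobiusBand.Isotopic (stdBand T a) := fun a a' h => by
  have := bandInvariant_eq_of_mk_eq T h
  rw [bandInvariant_stdBand, bandInvariant_stdBand] at this
  have h1 : ((a : ℤ), (2 : ℤ)) ∈ ({((a' : ℤ), 2), (-(a' : ℤ), -2)} : Set (ℤ × ℤ)) := by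
    rw [← this]; simp
  simpa [Subtype.ext_iff] using h1

/-- The linear flop takes the meridian to the curve `(u ^ a, u ^ 2)`, the boundary of the standard
Möbius band. -/
theorem meridianToBoundary_std (a : {a : ℤ // Odd a}) :
    MeridianToBoundary (stdBand T a) (stdFlop T a) := by
  refine ⟨_, isMobiusEmbedding_stdEmb T a.2, rfl, ?_, ?_⟩
  · rintro _ ⟨⟨x, y⟩, hxy, rfl⟩
    rw [stdEmb_apply]
    refine mem_image_of_mem _ ⟨?_, mem_univ _⟩
    rw [mem_closedBall_zero_iff, norm_mul, Circle.norm_coe, mul_one, Complex.norm_real,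
      Real.norm_eq_abs, abs_le]
    exact mem_strip.1 hxy
  · obtain ⟨A, hgl, h0, h1⟩ := stdFlop_gluing (T := T) a
    have key : ∀ x : ℝ, T.boundary ((stdFlop T a).1.gluing (Circle.exp (x / 2), 1)) =
        stdEmb T a (x, 1) := fun x => by
      rw [hgl, linearDiffeo_apply, stdEmb_apply, linearMap_apply, Tube.boundary, torusIncl]
      simp only [h0, h1, one_zpow, mul_one, ← circleExp_int_mul, Complex.ofReal_one, one_mul]
      congr 4
      · ring_nf
      · push_cast; ring_nf
    ext b; constructor
    · rintro ⟨_, ⟨⟨u, v⟩, ⟨-, hv⟩, rfl⟩, rfl⟩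
      obtain rfl : v = 1 := hv
      obtain ⟨x, rfl⟩ := Circle.exp_surjective u
      refine ⟨(2 * x, 1), ⟨mem_univ _, rfl⟩, ?_⟩
      rw [← key]; congr 4; ring
    · rintro ⟨⟨x, y⟩, ⟨-, hy⟩, rfl⟩
      obtain rfl : y = 1 := hy
      exact ⟨_, ⟨(Circle.exp (x / 2), 1), ⟨mem_univ _, rfl⟩, rfl⟩, key x⟩

end LinearBand

end MobiusFlop

namespace MobiusFlop

/-! ### Straightening a Möbius band -/

section Straighten

variable {M : Type*} [TopologicalSpace M] [ChartedSpace (EuclideanSpace ℝ (Fin 3)) M]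
  {L : Set M} {F : ℝ × ℝ → M}

theorem odd_zpow_mul {g : ℝ → ℝ} (hodd : ∀ y, g (-y) = -g y) (n : ℤ) (y : ℝ) :
    g ((-1) ^ n * y) = (-1) ^ n * g y := by
  rcases Int.even_or_odd n with hn | hn
  · simp [hn.neg_one_zpow]
  · simp [hn.neg_one_zpow, hodd]

theorem IsMobiusEmbedding.comp_fiber (hF : IsMobiusEmbedding F L) {g : ℝ → ℝ}
    (hg : ContDiff ℝ ∞ g) (hodd : ∀ y, g (-y) = -g y) (hpos : ∀ y, 0 < deriv g y)
    (hmaps : ∀ y ∈ Icc (-1 : ℝ) 1, g y ∈ Icc (-1 : ℝ) 1) :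
    IsMobiusEmbedding (fun p => F (p.1, g p.2)) L := by
  have hsm : ContDiff ℝ ∞ fun p : ℝ × ℝ => (p.1, g p.2) := by fun_prop
  have hm : MapsTo (fun p : ℝ × ℝ => (p.1, g p.2)) strip strip := fun p hp =>
    mem_strip.2 (hmaps p.2 (mem_strip.1 hp))
  have hinj : Function.Injective g := (strictMono_of_deriv_pos hpos).injective
  have h0 : g 0 = 0 := by have := hodd 0; rw [neg_zero] at this; linarith
  refine ⟨hF.smooth.comp hsm.contMDiff.contMDiffOn hm, ?_, ?_, ?_⟩
  · rintro ⟨x, y⟩ hp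
    have hu : UniqueMDiffWithinAt 𝓘(ℝ, ℝ × ℝ) strip (x, y) :=
      (uniqueDiffOn_strip _ hp).uniqueMDiffWithinAt
    have hd : HasFDerivAt (fun p : ℝ × ℝ => (p.1, g p.2)) _ (x, y) :=
      HasFDerivAt.prodMk (hasFDerivAt_fst (𝕜 := ℝ) (p := (x, y)))
        ((hg.differentiable (by simp) y).hasDerivAt.hasFDerivAt.comp (x, y)
          (hasFDerivAt_snd (𝕜 := ℝ) (p := (x, y))))
    have hdi : Function.Injective (fderiv ℝ (fun p : ℝ × ℝ => (p.1, g p.2)) (x, y)) := by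
      rw [hd.fderiv, injective_iff_map_eq_zero]
      rintro ⟨v, w⟩ hv
      rw [ContinuousLinearMap.prod_apply, Prod.mk_eq_zero] at hv
      have h1 : v = 0 := hv.1
      have h2 : w = 0 := by simpa [(hpos y).ne'] using hv.2
      rw [h1, h2]; rfl
    have e1 := mfderivWithin_comp (x, y) (I := 𝓘(ℝ, ℝ × ℝ)) (I' := 𝓘(ℝ, ℝ × ℝ)) (I'' := 𝓡 3)
      (g := F) (f := fun p : ℝ × ℝ => (p.1, g p.2))
      (hF.smooth.mdifferentiableOn (by simp) _ (hm hp))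
      hd.differentiableAt.mdifferentiableAt.mdifferentiableWithinAt hm hu
    rw [mfderivWithin_eq_mfderiv hu hd.differentiableAt.mdifferentiableAt, mfderiv_eq_fderiv] at e1
    change Function.Injective (mfderivWithin 𝓘(ℝ, ℝ × ℝ) (𝓡 3)
      (F ∘ fun p : ℝ × ℝ => (p.1, g p.2)) strip (x, y))
    rw [e1]
    refine (hF.immersion _ (hm hp)).comp hdi
  · rintro ⟨x, y⟩ hp ⟨x', y'⟩ hq
    rw [hF.eq_iff _ (hm hp) _ (hm hq)]
    refine exists_congr fun n => and_congr_right fun _ => ?_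
    simp only
    rw [← odd_zpow_mul hodd, hinj.eq_iff]
  · rw [← hF.center]
    ext b; constructor
    · rintro ⟨⟨x, y⟩, ⟨-, hy⟩, rfl⟩
      obtain rfl : y = 0 := hy
      exact ⟨(x, 0), ⟨mem_univ _, rfl⟩, by simp only [h0]⟩
    · rintro ⟨⟨x, y⟩, ⟨-, hy⟩, rfl⟩
      obtain rfl : y = 0 := hy
      exact ⟨(x, 0), ⟨mem_univ _, rfl⟩, by simp only [h0]⟩

theorem abs_arctan_le_one {y : ℝ} (hy : y ∈ Icc (-1 : ℝ) 1) : Real.arctan y ∈ Icc (-1 : ℝ) 1 := by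
  have h1 : Real.arctan 1 ≤ 1 := by rw [Real.arctan_one]; linarith [Real.pi_le_four]
  constructor
  · have h2 := Real.arctan_strictMono.monotone hy.1
    rw [Real.arctan_neg] at h2
    linarith
  · exact (Real.arctan_strictMono.monotone hy.2).trans h1

/-- Shrinking the fibers of the Möbius band. The shrunk band extends to an open Möbius band, with
fibers `ℝ`. -/
theorem IsMobiusEmbedding.isotopic_shrink (hF : IsMobiusEmbedding F L) {c : ℝ}
    (hc : c ∈ Ioc (0 : ℝ) 1) :
    ∃ hF' : IsMobiusEmbedding (fun p => F (p.1, c * Real.arctan p.2)) L,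
      hF.band.Isotopic hF'.band := by
  let g : ℝ → ℝ → ℝ := fun t y => (1 - t) * y + t * (c * Real.arctan y)
  have hg : ContDiff ℝ ∞ fun r : ℝ × ℝ => g r.1 r.2 := by
    have h1 : ContDiff ℝ ∞ fun r : ℝ × ℝ => Real.arctan r.2 := Real.contDiff_arctan.comp contDiff_snd
    fun_prop
  have hmaps : ∀ t ∈ Icc (0 : ℝ) 1, ∀ y ∈ Icc (-1 : ℝ) 1, g t y ∈ Icc (-1 : ℝ) 1 := by
    intro t ht y hy
    have h1 : c * Real.arctan y ∈ Icc (-1 : ℝ) 1 := by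
      have := abs_arctan_le_one hy
      constructor <;> nlinarith [this.1, this.2, hc.1, hc.2]
    have := (convex_Icc (-1 : ℝ) 1) hy h1 (sub_nonneg.2 ht.2) ht.1 (by ring)
    simpa using this
  have hemb : ∀ t ∈ Icc (0 : ℝ) 1, IsMobiusEmbedding (fun p => F (p.1, g t p.2)) L := by
    intro t ht
    refine hF.comp_fiber (hg.comp (f := fun y => (t, y)) (by fun_prop)) (fun y => ?_) (fun y => ?_)
      (hmaps t ht)
    · simp only [g, Real.arctan_neg]; ring
    · have h1 : HasDerivAt (g t) ((1 - t) * 1 + t * (c * (1 / (1 + y ^ 2)))) y :=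
        ((hasDerivAt_id y).const_mul _).add (((Real.hasDerivAt_arctan y).const_mul c).const_mul t)
      rw [h1.deriv]
      have h2 : 0 < c * (1 / (1 + y ^ 2)) := mul_pos hc.1 (by positivity)
      rcases ht.1.eq_or_lt with rfl | h0
      · simp
      · have := mul_pos h0 h2
        linarith [ht.2]
  have h1 := hemb 1 (by simp)
  simp only [g, sub_self, zero_mul, one_mul, zero_add] at h1
  refine ⟨h1, fun r => F (r.2.1, g r.1 r.2.2), ?_, hemb, ?_, ?_⟩
  · refine hF.smooth.comp (ContDiff.contMDiff (f := fun r : ℝ × (ℝ × ℝ) =>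
      (r.2.1, g r.1 r.2.2)) ?_).contMDiffOn fun r hr =>
        mem_strip.2 (hmaps _ hr.1 _ (mem_strip.1 hr.2))
    exact contDiff_snd.fst.prodMk
      (hg.comp (f := fun r : ℝ × (ℝ × ℝ) => (r.1, r.2.2)) (by fun_prop))
  · simp [g, IsMobiusEmbedding.band]
  · simp [g, IsMobiusEmbedding.band]

/-- Every Möbius band is isotopic to one that is given by a smooth map of `ℝ × ℝ` into the
universal cover of the tube. -/
theorem IsMobiusEmbedding.exists_cover (hF : IsMobiusEmbedding F L) (T : Tube L) :
    ∃ (z : ℝ × ℝ → ℂ) (θ : ℝ × ℝ → ℝ), ContDiff ℝ ∞ z ∧ ContDiff ℝ ∞ θ ∧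
      (∀ x y, z (x + 2 * Real.pi, -y) = z (x, y)) ∧
      (∃ n : ℤ, ∀ x y, θ (x + 2 * Real.pi, -y) = θ (x, y) + 2 * Real.pi * n) ∧
      ∃ hF' : IsMobiusEmbedding (fun p => T.cover (z p, θ p)) L, hF.band.Isotopic hF'.band := by
  obtain ⟨δ, hδ, hmem⟩ := hF.exists_forall_mem T.isOpenEmbedding.isOpen_range T.subset_range
  obtain ⟨hF', hiso⟩ := hF.isotopic_shrink (c := δ / 2)
    ⟨by linarith [hδ.1], by linarith [hδ.2]⟩
  have hlt : ∀ y, δ / 2 * Real.arctan y ∈ Ioo (-δ) δ := fun y => by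
    have h1 := Real.neg_pi_div_two_lt_arctan y
    have h2 := Real.arctan_lt_pi_div_two y
    have h3 := Real.pi_le_four
    have h4 : 0 < δ := hδ.1
    constructor <;> nlinarith
  have hlt1 : ∀ y, δ / 2 * Real.arctan y ∈ Ioo (-1 : ℝ) 1 := fun y =>
    ⟨by linarith [(hlt y).1, hδ.2], by linarith [(hlt y).2, hδ.2]⟩
  have hsm1 : ContDiff ℝ ∞ fun p : ℝ × ℝ => (p.1, δ / 2 * Real.arctan p.2) :=
    contDiff_fst.prodMk (contDiff_const.mul (Real.contDiff_arctan.comp contDiff_snd))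
  have hsm : ContMDiff 𝓘(ℝ, ℝ × ℝ) (𝓡 3) ∞ fun p : ℝ × ℝ => F (p.1, δ / 2 * Real.arctan p.2) := by
    intro p
    have h1 : strip ∈ 𝓝 (p.1, δ / 2 * Real.arctan p.2) :=
      prod_mem_nhds Filter.univ_mem (Icc_mem_nhds (hlt1 p.2).1 (hlt1 p.2).2)
    exact (hF.smooth.contMDiffAt h1).comp p (hsm1.contMDiff p)
  obtain ⟨z, θ, hz, hθ, hcov⟩ := T.exists_lift hsm.continuous
    (fun p => hmem _ _ (Ioo_subset_Icc_self (hlt p.2)))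
  have hG : ContDiff ℝ ∞ fun p => (z p, θ p) := by
    refine T.contDiff_of_cover (by fun_prop) ?_
    simpa only [hcov] using hsm
  have hper := fun p : ℝ × ℝ => T.cover_eq_iff.1 <| (hcov (p.1 + 2 * Real.pi, -p.2)).symm.trans
    ((show _ = F (p.1, δ / 2 * Real.arctan p.2) from by
      simpa [Real.arctan_neg] using hF.apply_add (x := p.1) (Ioo_subset_Icc_self (hlt1 p.2)) 1).trans
        (hcov p))
  obtain ⟨n, hn⟩ := exists_int_of_circleExp_eq (A := ℝ × ℝ)
    (f := fun p => θ (p.1 + 2 * Real.pi, -p.2)) (by fun_prop) hθ fun p => (hper p).2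
  have hfun : (fun p : ℝ × ℝ => F (p.1, δ / 2 * Real.arctan p.2)) =
      fun p => T.cover (z p, θ p) := funext hcov
  refine ⟨z, θ, hG.fst, hG.snd, fun x y => (hper (x, y)).1, ⟨n, fun x y => hn (x, y)⟩, ?_⟩
  rw [← hfun]
  exact ⟨hF', hiso⟩

/-- The center line of an embedded Möbius band runs around the circle once. -/
theorem eq_one_of_injective_mod {θ : ℝ → ℝ} (hθ : Continuous θ) (hmono : StrictMono θ) {n : ℤ}
    (hn : ∀ x, θ (x + 2 * Real.pi) = θ x + 2 * Real.pi * n)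
    (hinj : ∀ x x', Circle.exp (θ x) = Circle.exp (θ x') → ∃ m : ℤ, x' = x + 2 * Real.pi * m) :
    n = 1 := by
  have hpi : 0 < 2 * Real.pi := by positivity
  have h1 : 0 < n := by
    have h2 := hmono (show (0 : ℝ) < 0 + 2 * Real.pi by simpa using hpi)
    rw [hn] at h2
    have : 0 < 2 * Real.pi * (n : ℝ) := by linarith
    exact_mod_cast pos_of_mul_pos_right this hpi.le
  by_contra hne
  have h2 : (2 : ℝ) ≤ n := by exact_mod_cast (show 2 ≤ n by omega)
  obtain ⟨x, hx, hx'⟩ := intermediate_value_Ioo (show (0 : ℝ) ≤ 0 + 2 * Real.pi by simpa using hpi.le)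
    hθ.continuousOn (show θ 0 + 2 * Real.pi ∈ Ioo (θ 0) (θ (0 + 2 * Real.pi)) by
      rw [hn]; constructor <;> nlinarith)
  obtain ⟨m, hm⟩ := hinj 0 x (by rw [hx', Circle.exp_add_two_pi])
  rw [zero_add] at hm hx
  rw [hm] at hx
  have h3 : 0 < (m : ℝ) := pos_of_mul_pos_right hx.1 hpi.le
  have h4 : (m : ℝ) < 1 := by nlinarith [hx.2]
  have h5 : 0 < m := by exact_mod_cast h3
  have h6 : m < 1 := by exact_mod_cast h4
  omega

theorem forall_pos_or_forall_neg {f : ℝ → ℝ} (hf : Continuous f) (h0 : ∀ x, f x ≠ 0) :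
    (∀ x, 0 < f x) ∨ ∀ x, f x < 0 := by
  by_contra! h
  obtain ⟨⟨x, hx⟩, y, hy⟩ := h
  obtain ⟨w, hw⟩ := mem_range_of_exists_le_of_exists_ge hf ⟨x, hx⟩ ⟨y, hy⟩
  exact h0 w hw

/-- The straight band that is tangent to the given one along the center, and the Alexander trick:
the isotopy `(z (x, s y) / s, θ (x, s y))` to this straight band. -/
theorem exists_bandData_isotopic (T : Tube L) {z : ℝ × ℝ → ℂ} {θ : ℝ × ℝ → ℝ}
    (hz : ContDiff ℝ ∞ z) (hθ : ContDiff ℝ ∞ θ)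
    (hzper : ∀ x y, z (x + 2 * Real.pi, -y) = z (x, y)) {n : ℤ}
    (hn : ∀ x y, θ (x + 2 * Real.pi, -y) = θ (x, y) + 2 * Real.pi * n)
    (hF : IsMobiusEmbedding (fun p => T.cover (z p, θ p)) L) :
    ∃ (l : ℝ → ℂ) (θ₀ : ℝ → ℝ) (a ε : ℤ) (h : BandData l θ₀ a ε),
      hF.band.Isotopic (h.isMobiusEmbedding T).band := by
  have h0I : (0 : ℝ) ∈ Icc (-1 : ℝ) 1 := by simp
  have hz0 : ∀ x, z (x, 0) = 0 := fun x => T.cover_mem_iff.1 ((hF.mem_iff (x := x) h0I).2 rfl)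
  obtain ⟨k, hk, hzk⟩ := exists_eq_smul_of_eq_zero hz hz0
  have hzd : Differentiable ℝ z := hz.differentiable (by simp)
  have hθd : Differentiable ℝ θ := hθ.differentiable (by simp)
  have hkd : Differentiable ℝ k := hk.differentiable (by simp)
  have hG : Differentiable ℝ fun p => (z p, θ p) := hzd.prodMk hθd
  have himm : ∀ p ∈ strip, Function.Injective (fderiv ℝ (fun p => (z p, θ p)) p) := fun p hp =>
    (T.mfderivWithin_cover_injective_iff (hG p) hp).1 (hF.immersion p hp)
  -- the derivatives of `z` and `θ` at a point of the center line
  have hzk' : z = fun p => p.2 • k p := funext fun p => hzk p.1 p.2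
  have hzD : ∀ x v w, fderiv ℝ z (x, 0) (v, w) = w • k (x, 0) := fun x v w => by
    have h1 : HasFDerivAt (fun p : ℝ × ℝ => p.2 • k p) _ (x, 0) :=
      (hasFDerivAt_snd (𝕜 := ℝ) (p := (x, (0 : ℝ)))).smul (hkd (x, 0)).hasFDerivAt
    rw [hzk', h1.fderiv]
    simp
  have hθ₀ : ∀ x, HasDerivAt (fun x => θ (x, 0)) (fderiv ℝ θ (x, 0) (1, 0)) x := fun x => by
    have h1 : HasDerivAt (fun x : ℝ => (x, (0 : ℝ))) (1, 0) x :=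
      (hasDerivAt_id x).prodMk (hasDerivAt_const x 0)
    exact (hθd (x, 0)).hasFDerivAt.comp_hasDerivAt x h1
  have hGD : ∀ x v w, fderiv ℝ (fun p => (z p, θ p)) (x, 0) (v, w) =
      (w • k (x, 0), v * fderiv ℝ θ (x, 0) (1, 0) + w * fderiv ℝ θ (x, 0) (0, 1)) := fun x v w => by
    rw [(hzd (x, 0)).fderiv_prodMk (hθd (x, 0)), ContinuousLinearMap.prod_apply, hzD]
    congr 1
    rw [show ((v, w) : ℝ × ℝ) = v • (1, 0) + w • (0, 1) by simp, map_add, map_smul, map_smul]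
    rfl
  have hθ' : ∀ x, fderiv ℝ θ (x, 0) (1, 0) ≠ 0 := fun x h => by
    have h1 := himm (x, 0) (mem_strip.2 h0I) (a₁ := (1, 0)) (a₂ := 0) (by
      rw [hGD, h, map_zero]; simp)
    simp at h1
  have hk0 : ∀ x, k (x, 0) ≠ 0 := fun x h => by
    have h1 := himm (x, 0) (mem_strip.2 h0I)
      (a₁ := (-(fderiv ℝ θ (x, 0) (0, 1) / fderiv ℝ θ (x, 0) (1, 0)), 1)) (a₂ := 0) (by
      rw [hGD, h, map_zero]
      have := hθ' x
      simp only [smul_zero, one_mul, Prod.mk_eq_zero, true_and]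
      field_simp; ring)
    simp at h1
  have hkper : ∀ x, k (x + 2 * Real.pi, 0) = -k (x, 0) := fun x => by
    have h1 : (fun y : ℝ => k (x + 2 * Real.pi, -y)) = fun y => -k (x, y) := by
      refine Continuous.ext_on (dense_compl_singleton (0 : ℝ)) ?_ ?_ fun y hy => ?_
      · have := hk.continuous; fun_prop
      · have := hk.continuous; fun_prop
      · have h2 := hzper x y
        rw [hzk, hzk, neg_smul, ← smul_neg] at h2
        have h3 := smul_right_injective ℂ hy h2
        rw [← h3, neg_neg]
    simpa using congrFun h1 0
  -- the angle of the center line, and the logarithm of the direction of the fibers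
  have hθsm : ContDiff ℝ ∞ fun x => θ (x, 0) := hθ.comp (f := fun x : ℝ => (x, (0 : ℝ))) (by fun_prop)
  have hksm : ContDiff ℝ ∞ fun x => k (x, 0) := hk.comp (f := fun x : ℝ => (x, (0 : ℝ))) (by fun_prop)
  have hθn : ∀ x, θ (x + 2 * Real.pi, 0) = θ (x, 0) + 2 * Real.pi * n := fun x => by
    simpa using hn x 0
  have hθinj : ∀ x x', Circle.exp (θ (x, 0)) = Circle.exp (θ (x', 0)) →
      ∃ m : ℤ, x' = x + 2 * Real.pi * m := fun x x' h => by
    obtain ⟨m, hm, -⟩ := (hF.eq_iff (x, 0) (mem_strip.2 h0I) (x', 0) (mem_strip.2 h0I)).1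
      (T.cover_eq_iff.2 ⟨by simp [hz0], h⟩)
    exact ⟨m, hm⟩
  have hunit : n * n = 1 ∧ ∀ x, 0 < n * deriv (fun x => θ (x, 0)) x := by
    have hder : ∀ x, deriv (fun x => θ (x, 0)) x = fderiv ℝ θ (x, 0) (1, 0) := fun x => (hθ₀ x).deriv
    rcases forall_pos_or_forall_neg (hθsm.continuous_deriv (by simp))
      (fun x => by rw [hder]; exact hθ' x) with hp | hp
    · have h1 := eq_one_of_injective_mod hθsm.continuous (strictMono_of_deriv_pos hp) hθn hθinj
      subst h1
      exact ⟨rfl, by simpa using hp⟩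
    · have h1 := eq_one_of_injective_mod (θ := fun x => -θ (x, 0)) (n := -n)
        hθsm.continuous.neg
        (strictMono_of_deriv_pos fun x => by rw [deriv.fun_neg]; linarith [hp x])
        (fun x => by rw [hθn]; push_cast; ring)
        (fun x x' h => hθinj x x' (by
          simpa [Circle.exp_neg] using h))
      obtain rfl : n = -1 := by omega
      exact ⟨rfl, fun x => by push_cast; linarith [hp x]⟩
  obtain ⟨l, hl, hl'⟩ := exists_complex_log hksm.continuous hk0
  obtain ⟨m, hm⟩ := exists_int_of_complexExp_eq (f := fun x => l (x + 2 * Real.pi))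
    (g := fun x => l x + Real.pi * Complex.I) (by fun_prop) (by fun_prop) fun x => by
      rw [← hl', hkper, hl', Complex.exp_add, Complex.exp_pi_mul_I]; ring
  have hB : BandData l (fun x => θ (x, 0)) (2 * m + 1) n :=
    { contDiff_log := contDiff_of_exp hl hksm hl'
      contDiff_angle := hθsm
      odd := ⟨m, rfl⟩
      sq_eq_one := hunit.1
      log_add := fun x => by rw [hm]; push_cast; ring
      angle_add := hθn
      deriv_pos := hunit.2 }
  have hlin : (fun p : ℝ × ℝ => T.cover (p.2 • k (p.1, 0), θ (p.1, 0))) =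
      linearBand T l fun x => θ (x, 0) := funext fun p => by simp only [linearBand, hl']
  refine ⟨l, _, _, n, hB, fun r => T.cover (r.2.2 • k (r.2.1, (1 - r.1) * r.2.2),
    θ (r.2.1, (1 - r.1) * r.2.2)), ?_, fun t ht => ?_, ?_, ?_⟩
  · refine (T.contMDiff_cover.comp (ContDiff.contMDiff (f := fun r : ℝ × (ℝ × ℝ) =>
      (r.2.2 • k (r.2.1, (1 - r.1) * r.2.2), θ (r.2.1, (1 - r.1) * r.2.2))) ?_)).contMDiffOn
    fun_prop
  · rcases ht.2.eq_or_lt with rfl | ht1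
    · simp only [sub_self, zero_mul, hlin]
      exact hB.isMobiusEmbedding T
    · obtain ⟨s, hs⟩ : ∃ s, s = 1 - t := ⟨_, rfl⟩
      have hs0 : 0 < s := by linarith
      have hs1 : s ≤ 1 := by linarith [ht.1]
      have hmap : ∀ {p : ℝ × ℝ}, p ∈ strip → (p.1, s * p.2) ∈ strip := fun {p} hp => by
        have := mem_strip.1 hp
        refine mem_strip.2 ⟨?_, ?_⟩ <;> nlinarith [this.1, this.2]
      -- up to scaling of the fibers of the tube, this is a shrunk band
      have hscale : ∀ p : ℝ × ℝ, p.2 • k (p.1, s * p.2) = s⁻¹ • z (p.1, s * p.2) := fun p => by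
        rw [hzk, smul_smul, inv_mul_cancel_left₀ hs0.ne']
      simp only [← hs, hscale]
      have hss : Function.Injective fun w : ℂ => s⁻¹ • w :=
        smul_right_injective ℂ (inv_ne_zero hs0.ne')
      refine ⟨(T.contMDiff_cover.comp (ContDiff.contMDiff (f := fun p : ℝ × ℝ =>
        (s⁻¹ • z (p.1, s * p.2), θ (p.1, s * p.2))) (by fun_prop))).contMDiffOn,
        ?_, ?_, ?_⟩
      · intro p hp
        have hinner : HasFDerivAt (fun p : ℝ × ℝ => (p.1, s * p.2))
            ((ContinuousLinearMap.fst ℝ ℝ ℝ).prod (s • ContinuousLinearMap.snd ℝ ℝ ℝ)) p :=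
          hasFDerivAt_fst.prodMk (hasFDerivAt_snd.const_mul s)
        have houter : HasFDerivAt (fun q : ℂ × ℝ => (s⁻¹ • q.1, q.2))
            ((s⁻¹ • ContinuousLinearMap.fst ℝ ℂ ℝ).prod (ContinuousLinearMap.snd ℝ ℂ ℝ))
            (z (p.1, s * p.2), θ (p.1, s * p.2)) :=
          (hasFDerivAt_fst.const_smul s⁻¹).prodMk hasFDerivAt_snd
        have hcomp : HasFDerivAt (fun p : ℝ × ℝ => (s⁻¹ • z (p.1, s * p.2), θ (p.1, s * p.2)))
            _ p :=
          houter.comp p ((hG (p.1, s * p.2)).hasFDerivAt.comp p hinner)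
        refine (T.mfderivWithin_cover_injective_iff hcomp.differentiableAt hp).2 ?_
        rw [hcomp.fderiv]
        refine Function.Injective.comp (g := ContinuousLinearMap.prod _ _) ?_
          ((himm _ (hmap hp)).comp (f := ContinuousLinearMap.prod _ _) ?_)
        · rintro ⟨v, w⟩ ⟨v', w'⟩ h
          simpa [hs0.ne'] using h
        · rintro ⟨v, w⟩ ⟨v', w'⟩ h
          simpa [hs0.ne'] using h
      · intro p hp q hq
        have h1 := hF.eq_iff _ (hmap hp) _ (hmap hq)
        rw [T.cover_eq_iff] at h1 ⊢
        simp only at h1 ⊢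
        rw [hss.eq_iff, h1]
        refine exists_congr fun n => and_congr_right fun _ => ?_
        simp only
        rw [mul_left_comm, mul_right_inj' hs0.ne']
      · exact image_center_eq T hB.surjective
          (G := fun p => (s⁻¹ • z (p.1, s * p.2), θ (p.1, s * p.2))) fun x => by simp [hz0]
  · simp [IsMobiusEmbedding.band, ← hzk]
  · simp only [IsMobiusEmbedding.band, sub_self, zero_mul, hlin]

/-- Every Möbius band is isotopic to a standard one, through a straight band. -/
theorem exists_mk_eq_stdBand (T : Tube L) (B : MobiusBand L) :
    ∃ a, Quot.mk MobiusBand.Isotopic B = Quot.mk _ (stdBand T a) := by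
  obtain ⟨B, F, hF, rfl⟩ := B
  obtain ⟨z, θ, hz, hθ, hzper, ⟨n, hn⟩, hF', h1⟩ := hF.exists_cover T
  obtain ⟨l, θ₀, a, ε, h, h2⟩ := exists_bandData_isotopic T hz hθ hzper hn hF'
  obtain ⟨a, ha⟩ := mk_eq_stdBand_of_bandData T h
  exact ⟨a, (Quot.sound h1).trans ((Quot.sound h2).trans ha)⟩

/-- The bijection, both sides of which are indexed by the odd numbers. -/
theorem exists_equiv [T2Space M] (T : Tube L) :
    ∃ e : Quot (MobiusBand.Isotopic (L := L)) ≃ Quot (TopologicalFlop.Same (T := T)),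
      ∀ (B : MobiusBand L) (S : TopologicalFlop T),
        e (Quot.mk _ B) = Quot.mk _ S ↔
          ∃ (B' : MobiusBand L) (S' : TopologicalFlop T),
            Quot.mk MobiusBand.Isotopic B' = Quot.mk _ B ∧
            Quot.mk TopologicalFlop.Same S' = Quot.mk _ S ∧ MeridianToBoundary B' S' := by
  let eB : {a : ℤ // Odd a} ≃ Quot (MobiusBand.Isotopic (L := L)) :=
    Equiv.ofBijective _ ⟨mk_stdBand_injective T, fun b => by
      induction b using Quot.ind with
      | mk B => exact (exists_mk_eq_stdBand T B).imp fun _ h => h.symm⟩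
  let eS : {a : ℤ // Odd a} ≃ Quot (TopologicalFlop.Same (T := T)) :=
    Equiv.ofBijective _ ⟨mk_stdFlop_injective, fun b => by
      induction b using Quot.ind with
      | mk S => exact (exists_mk_eq_stdFlop S).imp fun _ h => h.symm⟩
  refine ⟨eB.symm.trans eS, fun B S => ?_⟩
  obtain ⟨a, ha⟩ := exists_mk_eq_stdBand T B
  obtain ⟨a', ha'⟩ := exists_mk_eq_stdFlop S
  have hB : eB.symm (Quot.mk _ B) = a := by rw [Equiv.symm_apply_eq, ha]; rfl
  rw [Equiv.trans_apply, hB, ha']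
  constructor
  · intro h
    obtain rfl : a = a' := mk_stdFlop_injective h
    exact ⟨_, _, ha.symm, rfl, meridianToBoundary_std T a⟩
  · rintro ⟨B', S', hB', hS', h⟩
    have h1 := invariant_eq_of_meridianToBoundary h
    rw [bandInvariant_eq_of_mk_eq T (hB'.trans ha), flopInvariant_eq_of_mk_eq hS',
      bandInvariant_stdBand, flopInvariant_stdFlop] at h1
    have h2 : ((a : ℤ), (2 : ℤ)) ∈ ({((a' : ℤ), 2), (-(a' : ℤ), -2)} : Set (ℤ × ℤ)) := by
      rw [← h1]; simp
    obtain rfl : a = a' := by simpa [Subtype.ext_iff] using h2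
    rfl

end Straighten

end MobiusFlop

namespace MobiusFlop

/-! ### Local diffeomorphisms -/

section LocalDiffeomorph

/-- The inverse function theorem, in terms of local diffeomorphisms. -/
theorem isLocalDiffeomorphAt_of_hasFDerivAt {E F : Type*} [NormedAddCommGroup E] [NormedSpace ℝ E]
    [CompleteSpace E] [NormedAddCommGroup F] [NormedSpace ℝ F]
    {f : E → F} {x : E} {f' : E ≃L[ℝ] F} (hf : ∀ᶠ y in 𝓝 x, ContDiffAt ℝ ∞ f y)
    (hf' : HasFDerivAt f (f' : E →L[ℝ] F) x) : IsLocalDiffeomorphAt 𝓘(ℝ, E) 𝓘(ℝ, F) ∞ f x := by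
  have hx := hf.self_of_nhds
  have hstrict : HasStrictFDerivAt f (f' : E →L[ℝ] F) x := hx.hasStrictFDerivAt' hf' (by simp)
  have hcont : ContinuousAt (fderiv ℝ f) x :=
    (hx.fderiv_right (m := 0) (by simp)).continuousAt
  have hev : ∀ᶠ y in 𝓝 x, ContDiffAt ℝ ∞ f y ∧
      fderiv ℝ f y ∈ range ((↑) : (E ≃L[ℝ] F) → E →L[ℝ] F) :=
    hf.and (hcont (by
      rw [hf'.fderiv]
      exact ContinuousLinearEquiv.isOpen.mem_nhds ⟨f', rfl⟩))
  obtain ⟨s, hs, hso, hxs⟩ := eventually_nhds_iff.1 hev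
  let e := (hstrict.toOpenPartialHomeomorph f).restrOpen s hso
  have hes : ∀ y ∈ e.source, y ∈ s := fun y hy => hy.2
  have he : (e : E → F) = f := rfl
  let Φ : PartialDiffeomorph 𝓘(ℝ, E) 𝓘(ℝ, F) E F ∞ :=
    { toPartialEquiv := e.toPartialEquiv
      open_source := e.open_source
      open_target := e.open_target
      contMDiffOn_toFun := fun y hy =>
        (hs y (hes y hy)).1.contMDiffAt.contMDiffWithinAt
      contMDiffOn_invFun := fun y hy => by
        have h1 := hs _ (hes _ (e.map_target hy))
        obtain ⟨A, hA⟩ := h1.2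
        refine (e.contDiffAt_symm hy (f₀' := A) ?_ h1.1).contMDiffAt.contMDiffWithinAt
        rw [hA, he]
        exact (h1.1.differentiableAt (by simp)).hasFDerivAt }
  exact ⟨Φ, ⟨hstrict.mem_toOpenPartialHomeomorph_source, hxs⟩, fun y _ => rfl⟩

variable {E H E' H' : Type*} [NormedAddCommGroup E] [NormedSpace ℝ E] [TopologicalSpace H]
  [NormedAddCommGroup E'] [NormedSpace ℝ E'] [TopologicalSpace H']
  {I : ModelWithCorners ℝ E H} {J : ModelWithCorners ℝ E' H'}
  {M N : Type*} [TopologicalSpace M] [ChartedSpace H M] [TopologicalSpace N] [ChartedSpace H' N]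

/-- The restriction of a partial diffeomorphism to an open subset. -/
noncomputable def restrictPartialDiffeomorph (Φ : PartialDiffeomorph I J M N ∞) (s : Set M)
    (hs : IsOpen s) : PartialDiffeomorph I J M N ∞ where
  toPartialEquiv := (Φ.toOpenPartialHomeomorph.restrOpen s hs).toPartialEquiv
  open_source := (Φ.toOpenPartialHomeomorph.restrOpen s hs).open_source
  open_target := (Φ.toOpenPartialHomeomorph.restrOpen s hs).open_target
  contMDiffOn_toFun := Φ.contMDiffOn_toFun.mono fun _ h => h.1
  contMDiffOn_invFun := Φ.contMDiffOn_invFun.mono fun _ h => h.1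

theorem isLocalDiffeomorphAt_congr {f g : M → N} {x : M} (hf : IsLocalDiffeomorphAt I J ∞ f x)
    (h : g =ᶠ[𝓝 x] f) : IsLocalDiffeomorphAt I J ∞ g x := by
  obtain ⟨Φ, hx, hΦ⟩ := hf
  obtain ⟨s, hs, hso, hxs⟩ := eventually_nhds_iff.1 h
  exact ⟨restrictPartialDiffeomorph Φ s hso, ⟨hx, hxs⟩,
    fun y hy => (hs y hy.2).trans (hΦ hy.1)⟩

theorem isOpen_setOf_isLocalDiffeomorphAt (f : M → N) :
    IsOpen {x | IsLocalDiffeomorphAt I J ∞ f x} := by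
  refine isOpen_iff_mem_nhds.2 fun x ⟨Φ, hx, hΦ⟩ => ?_
  filter_upwards [Φ.open_source.mem_nhds hx] with y hy
  exact ⟨Φ, hy, hΦ⟩

/-- A chart of the maximal atlas, as a partial diffeomorphism to the model space. -/
noncomputable def partialDiffeomorphOfChart [ChartedSpace E M] [IsManifold 𝓘(ℝ, E) ∞ M]
    (e : OpenPartialHomeomorph M E) (he : e ∈ IsManifold.maximalAtlas 𝓘(ℝ, E) ∞ M) :
    PartialDiffeomorph 𝓘(ℝ, E) 𝓘(ℝ, E) M E ∞ where
  toPartialEquiv := e.toPartialEquiv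
  open_source := e.open_source
  open_target := e.open_target
  contMDiffOn_toFun := contMDiffOn_of_mem_maximalAtlas he
  contMDiffOn_invFun := contMDiffOn_symm_of_mem_maximalAtlas he

theorem isLocalDiffeomorph_continuousLinearEquiv (A : E ≃L[ℝ] E') :
    IsLocalDiffeomorph 𝓘(ℝ, E) 𝓘(ℝ, E') ∞ A :=
  A.toDiffeomorph.isLocalDiffeomorph

end LocalDiffeomorph

section TubeOfMap

variable {M : Type*} [TopologicalSpace M] [ChartedSpace (EuclideanSpace ℝ (Fin 3)) M]

/-- A map to `ℂ × S¹` that is a local diffeomorphism at the points of a compact set `L` and takes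
`L` bijectively to `0 × S¹` is invertible near `L`, and its inverse gives a tube around `L`. -/
theorem nonempty_tube_of_map {L : Set M} (hL : IsCompact L) {P : M → ℂ × Circle}
    (hP : ∀ q ∈ L, IsLocalDiffeomorphAt (𝓡 3) (𝓘(ℝ, ℂ).prod (𝓡 1)) ∞ P q)
    (hinj : InjOn P L) (h0 : ∀ q ∈ L, (P q).1 = 0) (hsurj : ∀ u, ∃ q ∈ L, P q = (0, u)) :
    Nonempty (Tube L) := by
  obtain ⟨t, ht, htinj⟩ := hinj.exists_mem_nhdsSet hL
    (fun q hq => (hP q hq).contMDiffAt.continuousAt) (fun q hq => by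
      obtain ⟨Φ, hx, hΦ⟩ := hP q hq
      exact ⟨Φ.source, Φ.open_source.mem_nhds hx,
        Φ.injOn.congr hΦ.symm⟩)
  obtain ⟨t', ht'o, hLt', ht't⟩ := mem_nhdsSet_iff_exists.1 ht
  let V : Set M := t' ∩ {q | IsLocalDiffeomorphAt (𝓡 3) (𝓘(ℝ, ℂ).prod (𝓡 1)) ∞ P q}
  have hVo : IsOpen V := ht'o.inter (isOpen_setOf_isLocalDiffeomorphAt P)
  have hLV : L ⊆ V := fun q hq => ⟨hLt' hq, hP q hq⟩
  have hVinj : InjOn P V := htinj.mono fun q hq => ht't hq.1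
  have hΩ : IsOpen (P '' V) := by
    refine isOpen_iff_mem_nhds.2 ?_
    rintro _ ⟨q, hq, rfl⟩
    obtain ⟨Φ, hx, hΦ⟩ := hq.2
    have h1 := Φ.toOpenPartialHomeomorph.image_mem_nhds (x := q) hx
      (Filter.inter_mem (hVo.mem_nhds hq) (Φ.open_source.mem_nhds hx))
    rw [hΦ hx]
    refine Filter.mem_of_superset h1 ?_
    rintro _ ⟨y, hy, rfl⟩
    exact ⟨y, hy.1, hΦ hy.2⟩
  obtain ⟨u, v, huo, -, h0u, hv, huv⟩ := generalized_tube_lemma (isCompact_singleton (x := (0 : ℂ)))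
    (isCompact_univ (X := Circle)) hΩ (by
      rintro ⟨z, w⟩ ⟨hz, -⟩
      obtain ⟨q, hq, hqw⟩ := hsurj w
      have hz' : z = 0 := hz
      exact ⟨q, hLV hq, by rw [hqw, hz']⟩)
  obtain ⟨ε, hε, hεu⟩ := Metric.isOpen_iff.1 huo 0 (h0u rfl)
  let b := OpenPartialHomeomorph.univBall (0 : ℂ) ε
  have hb : ∀ z, b z ∈ Metric.ball (0 : ℂ) ε := fun z => by
    have := b.map_source (x := z) (by simp [b])
    rwa [OpenPartialHomeomorph.univBall_target _ hε] at this
  let B : ℂ × Circle → ℂ × Circle := Prod.map b id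
  have hBΩ : ∀ p, B p ∈ P '' V := fun p => huv ⟨hεu (hb p.1), hv trivial⟩
  have hBinj : Function.Injective B := by
    refine Function.Injective.prodMap (fun x y h => ?_) Function.injective_id
    exact b.injOn (by simp [b]) (by simp [b]) h
  have hB : IsLocalDiffeomorph (𝓘(ℝ, ℂ).prod (𝓡 1)) (𝓘(ℝ, ℂ).prod (𝓡 1)) ∞ B := by
    intro p
    let Φ : PartialDiffeomorph (𝓘(ℝ, ℂ).prod (𝓡 1)) (𝓘(ℝ, ℂ).prod (𝓡 1))
        (ℂ × Circle) (ℂ × Circle) ∞ :=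
      { toPartialEquiv := (b.prod (OpenPartialHomeomorph.refl Circle)).toPartialEquiv
        open_source := (b.prod (OpenPartialHomeomorph.refl Circle)).open_source
        open_target := (b.prod (OpenPartialHomeomorph.refl Circle)).open_target
        contMDiffOn_toFun := ContMDiff.contMDiffOn
          (ContMDiff.prodMap OpenPartialHomeomorph.contDiff_univBall.contMDiff contMDiff_id)
        contMDiffOn_invFun := by
          have h1 : ContMDiffOn 𝓘(ℝ, ℂ) 𝓘(ℝ, ℂ) ∞ b.symm b.target := by
            rw [OpenPartialHomeomorph.univBall_target _ hε]
            exact OpenPartialHomeomorph.contDiffOn_univBall_symm.contMDiffOn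
          exact h1.prodMap (contMDiffOn_id (s := univ)) }
    exact ⟨Φ, ⟨by simp [b], trivial⟩, fun _ _ => rfl⟩
  choose g hgV hPg using hBΩ
  have hgP : ∀ q ∈ V, ∀ p, B p = P q → g p = q := fun q hq p h =>
    hVinj (hgV p) hq ((hPg p).trans h)
  refine ⟨⟨g, fun x y h => hBinj ?_, fun p => ?_, ?_⟩⟩
  · rw [← hPg, ← hPg, h]
  · have h1 := (hgV p).2
    have h2 : IsLocalDiffeomorphAt (𝓘(ℝ, ℂ).prod (𝓡 1)) (𝓡 3) ∞ h1.localInverse (B p) := by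
      rw [← hPg p]; exact h1.localInverse_isLocalDiffeomorphAt
    refine isLocalDiffeomorphAt_congr ((hB p).comp (𝓡 3) M h2) ?_
    have hsrc : B p ∈ h1.localInverse.source := by
      rw [← hPg p]; exact h1.localInverse_mem_source
    have hBc : Continuous B := hB.contMDiff.continuous
    have hcl : ContinuousAt (fun y => h1.localInverse (B y)) p :=
      ContinuousAt.comp (g := h1.localInverse) h2.contMDiffAt.continuousAt hBc.continuousAt
    have hval : h1.localInverse (B p) = g p := by
      rw [← hPg p]
      exact h1.localInverse_left_inv h1.localInverse_mem_target
    have hev1 : ∀ᶠ y in 𝓝 p, h1.localInverse (B y) ∈ V :=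
      hcl.eventually_mem (hVo.mem_nhds (by rw [hval]; exact hgV p))
    have hev2 : ∀ᶠ y in 𝓝 p, B y ∈ h1.localInverse.source :=
      hBc.continuousAt.eventually_mem (h1.localInverse_open_source.mem_nhds hsrc)
    filter_upwards [hev1, hev2] with y hy1 hy2
    exact hgP _ hy1 y (h1.localInverse_right_inv hy2).symm
  · have hB0 : ∀ w, B (0, w) = (0, w) := fun w => by
      simp [B, b, OpenPartialHomeomorph.univBall_apply_zero]
    ext q
    constructor
    · rintro ⟨⟨z, w⟩, ⟨hz, -⟩, rfl⟩
      obtain ⟨q, hq, hqw⟩ := hsurj w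
      rw [mem_singleton_iff] at hz
      subst hz
      rwa [hgP q (hLV hq) (0, w) (by rw [hB0, hqw])]
    · intro hq
      refine ⟨(0, (P q).2), ⟨rfl, trivial⟩, hgP q (hLV hq) _ ?_⟩
      rw [hB0]
      exact Prod.ext (h0 q hq).symm rfl

end TubeOfMap

end MobiusFlop

namespace MobiusFlop

/-! ### Derivatives in local coordinates -/

section Coordinates

variable {M : Type*} [TopologicalSpace M] [ChartedSpace (EuclideanSpace ℝ (Fin 3)) M]

variable (M) in
/-- Local coordinates of a 3-manifold with values in `ℂ × ℝ`, the universal cover of the model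
`ℂ × S¹` of a tube. -/
abbrev Coord : Type _ := PartialDiffeomorph (𝓡 3) 𝓘(ℝ, ℂ × ℝ) M (ℂ × ℝ) ∞

variable {F : Type*} [NormedAddCommGroup F] [NormedSpace ℝ F]

/-- The derivative of `f` at `q`, written in the coordinates `e`. -/
noncomputable def dIn (e : Coord M) (f : M → F) (q : M) : ℂ × ℝ →L[ℝ] F :=
  fderiv ℝ (f ∘ e.symm) (e q)

variable {e e' : Coord M} {f g : M → F} {q : M}

theorem Coord.eventually_target (hq : q ∈ e.source) : ∀ᶠ y in 𝓝 (e q), y ∈ e.target :=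
  e.open_target.mem_nhds (e.map_source' hq)

theorem Coord.symm_apply (hq : q ∈ e.source) : e.symm (e q) = q := e.left_inv' hq

theorem Coord.continuousAt (hq : q ∈ e.source) : ContinuousAt e q :=
  (e.contMDiffOn_toFun.contMDiffAt (e.open_source.mem_nhds hq)).continuousAt

theorem contDiffAt_comp_symm (hf : ContMDiffAt (𝓡 3) 𝓘(ℝ, F) ∞ f q) (hq : q ∈ e.source) :
    ContDiffAt ℝ ∞ (f ∘ e.symm) (e q) := by
  have h1 : ContMDiffAt 𝓘(ℝ, ℂ × ℝ) (𝓡 3) ∞ e.symm (e q) :=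
    e.contMDiffOn_invFun.contMDiffAt (e.open_target.mem_nhds (e.map_source' hq))
  refine (ContMDiffAt.comp (e q) (g := f) ?_ h1).contDiffAt
  rwa [Coord.symm_apply hq]

theorem contDiffOn_comp_symm (hf : ContMDiff (𝓡 3) 𝓘(ℝ, F) ∞ f) :
    ContDiffOn ℝ ∞ (f ∘ e.symm) e.target :=
  (hf.comp_contMDiffOn e.contMDiffOn_invFun).contDiffOn

theorem differentiableAt_comp_symm (hf : ContMDiffAt (𝓡 3) 𝓘(ℝ, F) ∞ f q) (hq : q ∈ e.source) :
    DifferentiableAt ℝ (f ∘ e.symm) (e q) :=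
  (contDiffAt_comp_symm hf hq).differentiableAt (by simp)

theorem dIn_add (hf : ContMDiffAt (𝓡 3) 𝓘(ℝ, F) ∞ f q) (hg : ContMDiffAt (𝓡 3) 𝓘(ℝ, F) ∞ g q)
    (hq : q ∈ e.source) : dIn e (fun x => f x + g x) q = dIn e f q + dIn e g q :=
  fderiv_fun_add (differentiableAt_comp_symm hf hq) (differentiableAt_comp_symm hg hq)

theorem dIn_const_mul {f : M → ℝ} (r : ℝ) (hf : ContMDiffAt (𝓡 3) 𝓘(ℝ, ℝ) ∞ f q)
    (hq : q ∈ e.source) : dIn e (fun x => r * f x) q = r • dIn e f q :=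
  fderiv_const_mul (differentiableAt_comp_symm hf hq) r

/-- At a zero of `g`, the derivative of `χ * g` does not involve the derivative of `χ`. -/
theorem dIn_mul_of_eq_zero {χ g : M → ℝ} (hχ : ContMDiffAt (𝓡 3) 𝓘(ℝ, ℝ) ∞ χ q)
    (hg : ContMDiffAt (𝓡 3) 𝓘(ℝ, ℝ) ∞ g q) (h0 : g q = 0) (hq : q ∈ e.source) :
    dIn e (fun x => χ x * g x) q = χ q • dIn e g q := by
  refine (fderiv_mul (differentiableAt_comp_symm hχ hq) (differentiableAt_comp_symm hg hq)).trans ?_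
  simp only [Function.comp_apply, Coord.symm_apply hq, h0, dIn, zero_smul, add_zero]

theorem dIn_change (hf : ContMDiffAt (𝓡 3) 𝓘(ℝ, F) ∞ f q) (hq : q ∈ e.source)
    (hq' : q ∈ e'.source) :
    dIn e f q = (dIn e' f q).comp (fderiv ℝ (e' ∘ e.symm) (e q)) := by
  have h1 : ContMDiffAt (𝓡 3) 𝓘(ℝ, ℂ × ℝ) ∞ e' q :=
    e'.contMDiffOn_toFun.contMDiffAt (e'.open_source.mem_nhds hq')
  have h2 : f ∘ e.symm =ᶠ[𝓝 (e q)] (f ∘ e'.symm) ∘ (e' ∘ e.symm) := by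
    have h3 : ContinuousAt e.symm (e q) :=
      (e.contMDiffOn_invFun.contMDiffAt (e.open_target.mem_nhds (e.map_source' hq))).continuousAt
    have h4 : ∀ᶠ y in 𝓝 (e q), e.symm y ∈ e'.source :=
      h3.eventually_mem (e'.open_source.mem_nhds (by rwa [Coord.symm_apply hq]))
    filter_upwards [h4] with y hy
    simp only [Function.comp_apply, Coord.symm_apply hy]
  have h5 : (e' ∘ e.symm) (e q) = e' q := by
    simp only [Function.comp_apply, Coord.symm_apply hq]
  rw [dIn, h2.fderiv_eq, fderiv_comp _ (by rw [h5]; exact differentiableAt_comp_symm hf hq')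
    (differentiableAt_comp_symm h1 hq), h5]
  rfl

theorem continuousOn_dIn (hf : ContMDiff (𝓡 3) 𝓘(ℝ, F) ∞ f) : ContinuousOn (dIn e f) e.source :=
  ((contDiffOn_comp_symm hf).continuousOn_fderiv_of_isOpen e.open_target (by simp)).comp
    e.contMDiffOn_toFun.continuousOn fun _ h => e.map_source' h

/-- The map `v ↦ (a v + i b v, c v)`. -/
noncomputable def packForms (a b c : ℂ × ℝ →L[ℝ] ℝ) : ℂ × ℝ →L[ℝ] ℂ × ℝ :=
  (Complex.equivRealProdCLM.symm.toContinuousLinearMap.comp (a.prod b)).prod c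

/-- The volume `a ∧ b ∧ c` of three covectors on `ℂ × ℝ`. -/
noncomputable def vol (a b c : ℂ × ℝ →L[ℝ] ℝ) : ℝ := (packForms a b c).det

@[simp] theorem packForms_apply (a b c : ℂ × ℝ →L[ℝ] ℝ) (v : ℂ × ℝ) :
    packForms a b c v = (⟨a v, b v⟩, c v) := by
  simp [packForms, Complex.ext_iff]

theorem vol_comp (a b c : ℂ × ℝ →L[ℝ] ℝ) (A : ℂ × ℝ →L[ℝ] ℂ × ℝ) :
    vol (a.comp A) (b.comp A) (c.comp A) = vol a b c * A.det := by
  have : packForms (a.comp A) (b.comp A) (c.comp A) = (packForms a b c).comp A := by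
    ext v <;> simp
  rw [vol, this]
  exact LinearMap.det_comp _ _

theorem vol_eq (a b c : ℂ × ℝ →L[ℝ] ℝ) :
    vol a b c = a (1, 0) * (b (Complex.I, 0) * c (0, 1) - b (0, 1) * c (Complex.I, 0))
      - a (Complex.I, 0) * (b (1, 0) * c (0, 1) - b (0, 1) * c (1, 0))
      + a (0, 1) * (b (1, 0) * c (Complex.I, 0) - b (Complex.I, 0) * c (1, 0)) := by
  let E : (ℂ × ℝ) ≃ₗ[ℝ] (Fin 3 → ℝ) :=
    { toFun := fun z => ![z.1.re, z.1.im, z.2]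
      invFun := fun v => (⟨v 0, v 1⟩, v 2)
      map_add' := fun x y => by ext i; fin_cases i <;> simp
      map_smul' := fun c x => by ext i; fin_cases i <;> simp
      left_inv := fun z => by simp
      right_inv := fun v => by ext i; fin_cases i <;> simp }
  have h0 : E.symm (Pi.single 0 1) = ((1, 0) : ℂ × ℝ) := by
    rw [LinearEquiv.symm_apply_eq]; ext i; fin_cases i <;> simp [E]
  have h1 : E.symm (Pi.single 1 1) = ((Complex.I, 0) : ℂ × ℝ) := by
    rw [LinearEquiv.symm_apply_eq]; ext i; fin_cases i <;> simp [E]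
  have h2 : E.symm (Pi.single 2 1) = ((0, 1) : ℂ × ℝ) := by
    rw [LinearEquiv.symm_apply_eq]; ext i; fin_cases i <;> simp [E]
  rw [vol, ContinuousLinearMap.det, ← LinearMap.det_toMatrix (Module.Basis.ofEquivFun E),
    Matrix.det_fin_three]
  simp only [LinearMap.toMatrix_apply, Module.Basis.coe_ofEquivFun, h0, h1, h2,
    Module.Basis.ofEquivFun_repr_apply, ContinuousLinearMap.coe_coe, packForms_apply,
    LinearEquiv.coe_mk, LinearMap.coe_mk, AddHom.coe_mk, E, Matrix.cons_val, Matrix.cons_val_zero]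
  ring

/-- Covectors without a common zero are linearly independent. -/
theorem vol_ne_zero {a b c : ℂ × ℝ →L[ℝ] ℝ}
    (h : ∀ v, a v = 0 → b v = 0 → c v = 0 → v = 0) : vol a b c ≠ 0 := by
  have : LinearMap.ker (packForms a b c : ℂ × ℝ →ₗ[ℝ] ℂ × ℝ) = ⊥ := by
    refine LinearMap.ker_eq_bot'.2 fun v hv => ?_
    simp only [ContinuousLinearMap.coe_coe, packForms_apply, Prod.ext_iff, Complex.ext_iff] at hv
    exact h v hv.1.1 hv.1.2 hv.2
  intro h0
  exact absurd (LinearMap.bot_lt_ker_of_det_eq_zero h0) (by rw [this]; exact lt_irrefl _)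

/-- `|W|²` times the differential of the argument of `W`. -/
noncomputable def angForm (e : Coord M) (W : M → ℂ) (q : M) : ℂ × ℝ →L[ℝ] ℝ :=
  Complex.imCLM.comp (((starRingEnd ℂ) (W q)) • dIn e W q)

theorem angForm_apply (e : Coord M) (W : M → ℂ) (q : M) (v : ℂ × ℝ) :
    angForm e W q v = ((starRingEnd ℂ) (W q) * dIn e W q v).im := rfl

/-- The Jacobian determinant in the coordinates `e` of the map with components `α`, `β` and, up to
the positive factor `|W|²`, the argument of `W`. -/
noncomputable def jac (e : Coord M) (α β : M → ℝ) (W : M → ℂ) (q : M) : ℝ :=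
  vol (dIn e α q) (dIn e β q) (angForm e W q)

variable {α β β' : M → ℝ} {W : M → ℂ}

theorem jac_change (hα : ContMDiffAt (𝓡 3) 𝓘(ℝ, ℝ) ∞ α q) (hβ : ContMDiffAt (𝓡 3) 𝓘(ℝ, ℝ) ∞ β q)
    (hW : ContMDiffAt (𝓡 3) 𝓘(ℝ, ℂ) ∞ W q) (hq : q ∈ e.source) (hq' : q ∈ e'.source) :
    jac e α β W q = jac e' α β W q * (fderiv ℝ (e' ∘ e.symm) (e q)).det := by
  rw [jac, jac, ← vol_comp, dIn_change hα hq hq', dIn_change hβ hq hq']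
  congr 1
  refine ContinuousLinearMap.ext fun v => ?_
  rw [angForm_apply, dIn_change hW hq hq']
  rfl

theorem continuousOn_jac (hα : ContMDiff (𝓡 3) 𝓘(ℝ, ℝ) ∞ α) (hβ : ContMDiff (𝓡 3) 𝓘(ℝ, ℝ) ∞ β)
    (hW : ContMDiff (𝓡 3) 𝓘(ℝ, ℂ) ∞ W) : ContinuousOn (jac e α β W) e.source := by
  have h1 := continuousOn_dIn (e := e) hα
  have h2 := continuousOn_dIn (e := e) hβ
  have h3 : ContinuousOn (angForm e W) e.source :=
    continuousOn_const.clm_comp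
      (((Complex.continuous_conj.comp hW.continuous).continuousOn).smul
        (continuousOn_dIn (e := e) hW))
  unfold jac
  simp only [vol_eq]
  fun_prop

theorem jac_add (hβ : ContMDiffAt (𝓡 3) 𝓘(ℝ, ℝ) ∞ β q) (hβ' : ContMDiffAt (𝓡 3) 𝓘(ℝ, ℝ) ∞ β' q)
    (hq : q ∈ e.source) :
    jac e α (fun x => β x + β' x) W q = jac e α β W q + jac e α β' W q := by
  simp only [jac, vol_eq, dIn_add hβ hβ' hq, add_apply]
  ring

theorem jac_mul {χ : M → ℝ} (hχ : ContMDiffAt (𝓡 3) 𝓘(ℝ, ℝ) ∞ χ q)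
    (hβ : ContMDiffAt (𝓡 3) 𝓘(ℝ, ℝ) ∞ β q) (h0 : β q = 0) (hq : q ∈ e.source) :
    jac e α (fun x => χ x * β x) W q = χ q * jac e α β W q := by
  simp only [jac, vol_eq, dIn_mul_of_eq_zero hχ hβ h0 hq, smul_apply,
    smul_eq_mul]
  ring

end Coordinates

end MobiusFlop

namespace MobiusFlop

/-! ### Coordinates adapted to a knot -/

section Slice

variable {M : Type*} [TopologicalSpace M] [ChartedSpace (EuclideanSpace ℝ (Fin 3)) M]

/-- Coordinates in which the knot `γ` is the line `0 × ℝ`, parametrized by the angle. -/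
structure IsSlice (γ : Circle → M) (Ψ : Coord M) : Prop where
  symm_eq : ∀ t, ((0, t) : ℂ × ℝ) ∈ Ψ.target → Ψ.symm (0, t) = γ (Circle.exp t)
  fst_eq_zero : ∀ q ∈ range γ, q ∈ Ψ.source → (Ψ q).1 = 0

/-- In the charts of the immersion `γ` the knot is a coordinate line; the coordinate along it is
replaced by the angle. -/
theorem exists_isSlice [IsManifold (𝓡 3) ∞ M] {γ : Circle → M}
    (hγ : IsSmoothEmbedding (𝓡 1) (𝓡 3) ∞ γ) (u : Circle) :
    ∃ Ψ : Coord M, γ u ∈ Ψ.source ∧ IsSlice γ Ψ := by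
  obtain ⟨t₀, rfl⟩ := Circle.exp_surjective u
  obtain ⟨F, _, _, h⟩ : IsImmersionAt (𝓡 1) (𝓡 3) ∞ γ (Circle.exp t₀) :=
    hγ.isImmersion.isImmersionAt _
  -- the complement of the tangent line has dimension two
  have hfin : FiniteDimensional ℝ F :=
    FiniteDimensional.of_injective
      (h.equiv.toLinearEquiv.toLinearMap ∘ₗ LinearMap.inr ℝ (EuclideanSpace ℝ (Fin 1)) F)
      (h.equiv.injective.comp (Prod.mk_right_injective 0))
  have hdim : Module.finrank ℝ ℂ = Module.finrank ℝ F := by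
    have h1 := h.equiv.toLinearEquiv.finrank_eq
    rw [Module.finrank_prod] at h1
    simp only [finrank_euclideanSpace, Fintype.card_fin] at h1
    rw [Complex.finrank_real_complex]
    omega
  let k : ℂ ≃L[ℝ] F := ContinuousLinearEquiv.ofFinrankEq hdim
  let A : (ℂ × EuclideanSpace ℝ (Fin 1)) ≃L[ℝ] EuclideanSpace ℝ (Fin 3) :=
    (ContinuousLinearEquiv.prodComm ℝ ℂ (EuclideanSpace ℝ (Fin 1))).trans
      (((ContinuousLinearEquiv.refl ℝ _).prodCongr k).trans h.equiv)
  have hA : ∀ w, A (0, w) = h.equiv (w, 0) := fun w => by simp [A]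
  let φ := partialDiffeomorphOfChart h.domChart h.domChart_mem_maximalAtlas
  let ψ := partialDiffeomorphOfChart h.codChart h.codChart_mem_maximalAtlas
  let φ' : PartialDiffeomorph (𝓘(ℝ, ℂ).prod (𝓡 1)) (𝓘(ℝ, ℂ).prod (𝓡 1)) (ℂ × Circle)
      (ℂ × EuclideanSpace ℝ (Fin 1)) ∞ :=
    { toPartialEquiv := ((OpenPartialHomeomorph.refl ℂ).prod h.domChart).toPartialEquiv
      open_source := ((OpenPartialHomeomorph.refl ℂ).prod h.domChart).open_source
      open_target := ((OpenPartialHomeomorph.refl ℂ).prod h.domChart).open_target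
      contMDiffOn_toFun := (contMDiffOn_id (s := univ)).prodMap φ.contMDiffOn_toFun
      contMDiffOn_invFun := (contMDiffOn_id (s := univ)).prodMap φ.contMDiffOn_invFun }
  have hsrc : Circle.exp t₀ ∈ h.domChart.source := h.mem_domChart_source
  have hval : ∀ v ∈ h.domChart.source, A (φ' (0, v)) = h.codChart (γ v) := fun v hv => by
    have h0 : h.domChart v ∈ (h.domChart.extend (𝓡 1)).target := by
      simpa using h.domChart.map_source hv
    have h1 := h.writtenInCharts h0
    have h2 : h.codChart (γ v) = h.equiv (h.domChart v, 0) := by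
      simpa [h.domChart.left_inv hv] using h1
    rw [h2, ← hA]; rfl
  let G : ℂ × ℝ → M := fun p => ψ.symm (A (φ' (expCover p)))
  have hG0 : ∀ t, Circle.exp t ∈ h.domChart.source → G (0, t) = γ (Circle.exp t) := fun t ht => by
    change ψ.symm (A (φ' (0, Circle.exp t))) = _
    rw [hval _ ht]
    exact h.codChart.left_inv (h.source_subset_preimage_source ht)
  have hG : IsLocalDiffeomorphAt 𝓘(ℝ, ℂ × ℝ) (𝓡 3) ∞ G (0, t₀) := by
    have h1 : IsLocalDiffeomorphAt (𝓘(ℝ, ℂ).prod (𝓡 1)) (𝓘(ℝ, ℂ).prod (𝓡 1)) ∞ φ'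
        (expCover (0, t₀)) := φ'.isLocalDiffeomorphAt _ _ _ ⟨trivial, hsrc⟩
    have h2 := isLocalDiffeomorph_continuousLinearEquiv A (φ' (expCover (0, t₀)))
    rw [modelWithCornersSelf_prod, ← chartedSpaceSelf_prod] at h2
    have h3 : IsLocalDiffeomorphAt (𝓡 3) (𝓡 3) ∞ ψ.symm (A (φ' (expCover (0, t₀)))) := by
      refine ψ.symm.isLocalDiffeomorphAt _ _ _ ?_
      change A (φ' (0, Circle.exp t₀)) ∈ h.codChart.target
      rw [hval _ hsrc]
      exact h.codChart.map_source h.mem_codChart_source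
    exact ((isLocalDiffeomorph_expCover (0, t₀)).comp _ _ h1).comp _ _ h2 |>.comp _ _ h3
  obtain ⟨Φ, hΦ0, hΦ⟩ := hG
  let Φ₁ := restrictPartialDiffeomorph Φ {p | Circle.exp p.2 ∈ h.domChart.source}
    (h.domChart.open_source.preimage (by fun_prop))
  have hΦ₁0 : ((0, t₀) : ℂ × ℝ) ∈ Φ₁.source := ⟨hΦ0, hsrc⟩
  have hΦ₁ : ∀ t, ((0, t) : ℂ × ℝ) ∈ Φ₁.source → Φ₁ (0, t) = γ (Circle.exp t) := fun t ht =>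
    (hΦ ht.1).symm.trans (hG0 t ht.2)
  -- since `γ` is an embedding, the points of the knot near `γ (exp t₀)` have angle near `t₀`
  have hT : Circle.exp '' {t | ((0, t) : ℂ × ℝ) ∈ Φ₁.source} ∈ 𝓝 (Circle.exp t₀) :=
    (isLocalHomeomorph_circleExp.isOpenMap _
      (Φ₁.open_source.preimage (by fun_prop))).mem_nhds ⟨t₀, hΦ₁0, rfl⟩
  rw [hγ.isEmbedding.nhds_eq_comap, Filter.mem_comap] at hT
  obtain ⟨s, hs, hsT⟩ := hT
  obtain ⟨s', hs's, hs'o, hs'0⟩ := mem_nhds_iff.1 hs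
  let Ψ : Coord M := restrictPartialDiffeomorph Φ₁.symm s' hs'o
  refine ⟨Ψ, ⟨?_, hs'0⟩, fun t ht => hΦ₁ t ht.1, ?_⟩
  · rw [← hΦ₁ t₀ hΦ₁0]; exact Φ₁.map_source' hΦ₁0
  · rintro _ ⟨v, rfl⟩ hv
    obtain ⟨t, ht, rfl⟩ := hsT (hs's hv.2)
    change (Φ₁.symm (γ (Circle.exp t))).1 = 0
    rw [← hΦ₁ t ht]
    have : Φ₁.symm (Φ₁ (0, t)) = (0, t) := Φ₁.left_inv' ht
    rw [this]

variable {γ : Circle → M} {Ψ : Coord M}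

theorem IsSlice.apply_eq (h : IsSlice γ Ψ) {q : M} (hq : q ∈ range γ) (hs : q ∈ Ψ.source) :
    Ψ q = (0, (Ψ q).2) := Prod.ext (h.fst_eq_zero q hq hs) rfl

theorem IsSlice.eventually (h : IsSlice γ Ψ) {q : M} (hq : q ∈ range γ) (hs : q ∈ Ψ.source) :
    ∀ᶠ t in 𝓝 (Ψ q).2, Ψ.symm (0, t) = γ (Circle.exp t) := by
  have h1 : ContinuousAt (fun t : ℝ => ((0, t) : ℂ × ℝ)) (Ψ q).2 := by fun_prop
  refine (h1.eventually_mem (s := Ψ.target) ?_).mono fun t ht => h.symm_eq t ht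
  rw [← h.apply_eq hq hs]
  exact Coord.eventually_target hs

variable {F : Type*} [NormedAddCommGroup F] [NormedSpace ℝ F]

theorem IsSlice.hasDerivAt (h : IsSlice γ Ψ) {q : M} (hq : q ∈ range γ) (hs : q ∈ Ψ.source)
    {f : M → F} (hf : ContMDiffAt (𝓡 3) 𝓘(ℝ, F) ∞ f q) :
    HasDerivAt (fun t => f (γ (Circle.exp t))) (dIn Ψ f q (0, 1)) (Ψ q).2 := by
  have h1 := (differentiableAt_comp_symm hf hs).hasFDerivAt
  have h2 : HasDerivAt (fun t : ℝ => ((0, t) : ℂ × ℝ)) (0, 1) (Ψ q).2 :=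
    (hasDerivAt_const _ _).prodMk (hasDerivAt_id _)
  rw [h.apply_eq hq hs] at h1
  have h3 := h1.comp_hasDerivAt _ h2
  rw [← h.apply_eq hq hs] at h3
  refine h3.congr_of_eventuallyEq ?_
  filter_upwards [h.eventually hq hs] with t ht
  rw [Function.comp_apply, Function.comp_apply, ht]

theorem IsSlice.dIn_eq_zero (h : IsSlice γ Ψ) {q : M} (hq : q ∈ range γ) (hs : q ∈ Ψ.source)
    {f : M → F} (hf : ContMDiffAt (𝓡 3) 𝓘(ℝ, F) ∞ f q) (h0 : ∀ x ∈ range γ, f x = 0) :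
    dIn Ψ f q (0, 1) = 0 := by
  have h1 := h.hasDerivAt hq hs hf
  simp only [h0 _ (mem_range_self _)] at h1
  exact h1.unique (hasDerivAt_const _ _)

/-- If `W` extends the inverse of `γ` up to positive factors, the argument of `W` increases
along `γ`. -/
theorem IsSlice.angForm_pos (h : IsSlice γ Ψ) {q : M} (hq : q ∈ range γ) (hs : q ∈ Ψ.source)
    {W : M → ℂ} (hW : ContMDiffAt (𝓡 3) 𝓘(ℝ, ℂ) ∞ W q)
    (hWγ : ∀ u, ∃ ρ : ℝ, 0 < ρ ∧ W (γ u) = ρ * u) : 0 < angForm Ψ W q (0, 1) := by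
  set t := (Ψ q).2 with ht
  have hqt : q = γ (Circle.exp t) := by
    have h1 := (h.eventually hq hs).self_of_nhds
    rw [← h.apply_eq hq hs, Coord.symm_apply hs] at h1
    exact h1
  obtain ⟨ρ, hρ, hρt⟩ := hWγ (Circle.exp t)
  have h1 := h.hasDerivAt hq hs hW
  rw [← ht] at h1
  set w := dIn Ψ W q (0, 1)
  have h2 : HasDerivAt (fun s : ℝ => Complex.exp (-(s * Complex.I)))
      (Complex.exp (-(t * Complex.I)) * -(1 * Complex.I)) t :=
    (((Complex.ofRealCLM.hasDerivAt (x := t)).mul_const Complex.I).neg).cexp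
  have h3 := Complex.imCLM.hasFDerivAt.comp_hasDerivAt t (h1.mul h2)
  have h4 : (fun s : ℝ => (W (γ (Circle.exp s)) * Complex.exp (-(s * Complex.I))).im) = 0 := by
    funext s
    obtain ⟨r, -, hr⟩ := hWγ (Circle.exp s)
    rw [hr, Circle.coe_exp, mul_assoc, ← Complex.exp_add]
    simp
  have h5 : (w * Complex.exp (-(t * Complex.I)) + W (γ (Circle.exp t)) *
      (Complex.exp (-(t * Complex.I)) * -(1 * Complex.I))).im = 0 := by
    refine h3.unique ?_
    have : (⇑Complex.imCLM ∘ ((fun t => W (γ (Circle.exp t))) * fun s : ℝ =>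
        Complex.exp (-(s * Complex.I)))) = 0 := h4
    rw [this]
    exact hasDerivAt_const _ _
  have h6 : W (γ (Circle.exp t)) * (Complex.exp (-(t * Complex.I)) * -(1 * Complex.I))
      = -(ρ * Complex.I) := by
    rw [hρt, Circle.coe_exp, mul_mul_mul_comm, ← mul_assoc, mul_assoc (ρ : ℂ), ← Complex.exp_add]
    simp
  rw [h6, Complex.add_im] at h5
  have h7 : (w * Complex.exp (-(t * Complex.I))).im = ρ := by
    simp at h5 ⊢
    linarith
  rw [angForm_apply, hqt, hρt, ← hqt]
  have h8 : (starRingEnd ℂ) (ρ * (Circle.exp t : ℂ)) * w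
      = ρ * (w * Complex.exp (-(t * Complex.I))) := by
    rw [map_mul, Complex.conj_ofReal, Circle.coe_exp, ← Complex.exp_conj]
    simp; ring
  change 0 < ((starRingEnd ℂ) (ρ * (Circle.exp t : ℂ)) * w).im
  rw [h8, Complex.im_ofReal_mul, h7]
  positivity

end Slice

end MobiusFlop

namespace MobiusFlop

/-! ### Existence of a tube -/

section TubeExists

variable {M : Type*} [TopologicalSpace M] [ChartedSpace (EuclideanSpace ℝ (Fin 3)) M]

/-- Local coordinates that are compatible, in the orientation sense, at the points of `L`. -/
structure IsOrientedAtlas (A : Set (Coord M)) (L : Set M) : Prop where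
  cover : ∀ q ∈ L, ∃ e ∈ A, q ∈ e.source
  det_pos : ∀ e ∈ A, ∀ e' ∈ A, ∀ q ∈ L, q ∈ e.source → q ∈ e'.source →
    0 < (fderiv ℝ (e' ∘ e.symm) (e q)).det

theorem exists_isOrientedAtlas [IsManifold (𝓡 3) ∞ M] {L : Set M} (h : OrientableAlong L) :
    ∃ A : Set (Coord M), IsOrientedAtlas A L := by
  obtain ⟨A, hA, hcov, hdet⟩ := h
  let κ : EuclideanSpace ℝ (Fin 3) ≃L[ℝ] ℂ × ℝ := ContinuousLinearEquiv.ofFinrankEq (by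
    rw [Module.finrank_prod, Complex.finrank_real_complex]; simp)
  let f : A → Coord M := fun e =>
    (partialDiffeomorphOfChart e.1 (hA e.2)).trans κ.toDiffeomorph.toPartialDiffeomorph
  have hsrc : ∀ e : A, (f e).source = e.1.source := fun e => by
    change e.1.source ∩ e.1 ⁻¹' univ = _
    simp
  refine ⟨range f, fun q hq => ?_, ?_⟩
  · obtain ⟨e, he, hqe⟩ := hcov q hq
    exact ⟨_, ⟨⟨e, he⟩, rfl⟩, by rwa [hsrc]⟩
  · rintro _ ⟨e, rfl⟩ _ ⟨e', rfl⟩ q hq hqe hqe'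
    rw [hsrc] at hqe hqe'
    have h1 := hdet e.1 e.2 e'.1 e'.2 q hq hqe hqe'
    have h2 : (f e' ∘ (f e).symm) = κ ∘ (e'.1 ∘ e.1.symm) ∘ κ.symm := rfl
    have h3 : f e q = κ (e.1 q) := rfl
    rw [h2, h3, ContinuousLinearEquiv.comp_fderiv, ContinuousLinearEquiv.comp_right_fderiv,
      ContinuousLinearEquiv.symm_apply_apply]
    have h4 := LinearMap.det_conj
      (fderiv ℝ (e'.1 ∘ e.1.symm) (e.1 q)).toLinearMap κ.toLinearEquiv
    refine lt_of_lt_of_eq h1 ?_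
    rw [ContinuousLinearMap.det, ← h4]
    rfl

/-- Smooth functions on an open set become globally smooth when multiplied by a function that
vanishes near the complement. -/
theorem contMDiff_mul_of_eventually_eq_zero {χ g : M → ℝ} {U : Set M} (hU : IsOpen U)
    (hχ : ContMDiff (𝓡 3) 𝓘(ℝ, ℝ) ∞ χ) (h0 : ∀ᶠ q in 𝓝ˢ Uᶜ, χ q = 0)
    (hg : ContMDiffOn (𝓡 3) 𝓘(ℝ, ℝ) ∞ g U) :
    ContMDiff (𝓡 3) 𝓘(ℝ, ℝ) ∞ fun q => χ q * g q := by
  intro q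
  by_cases hq : q ∈ U
  · exact (hχ q).mul (hg.contMDiffAt (hU.mem_nhds hq))
  · refine (contMDiffAt_const (c := (0 : ℝ))).congr_of_eventuallyEq ?_
    filter_upwards [h0.filter_mono (nhds_le_nhdsSet hq)] with x hx
    rw [hx, zero_mul]

variable [T2Space M] [SecondCountableTopology M] [IsManifold (𝓡 3) ∞ M]

theorem exists_bump {U : Set M} (hU : IsOpen U) {q : M} (hq : q ∈ U) :
    ∃ χ : M → ℝ, ContMDiff (𝓡 3) 𝓘(ℝ, ℝ) ∞ χ ∧ (∀ᶠ x in 𝓝 q, χ x = 1) ∧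
      (∀ᶠ x in 𝓝ˢ Uᶜ, χ x = 0) ∧ ∀ x, 0 ≤ χ x := by
  have := ChartedSpace.locallyCompactSpace (EuclideanSpace ℝ (Fin 3)) M
  obtain ⟨χ, h0, h1, h⟩ := exists_contMDiffMap_zero_one_nhds_of_isClosed (n := ⊤) (𝓡 3)
    hU.isClosed_compl (isClosed_singleton (x := q)) (by simpa using hq)
  rw [nhdsSet_singleton] at h1
  exact ⟨χ, χ.contMDiff, h1, h0, fun x => (h x).1⟩

variable {γ : Circle → M}

/-- An angular function near the knot. -/
theorem exists_angular (hγ : IsSmoothEmbedding (𝓡 1) (𝓡 3) ∞ γ) :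
    ∃ W : M → ℂ, ContMDiff (𝓡 3) 𝓘(ℝ, ℂ) ∞ W ∧ ∀ u, ∃ ρ : ℝ, 0 < ρ ∧ W (γ u) = ρ * u := by
  have := ChartedSpace.locallyCompactSpace (EuclideanSpace ℝ (Fin 3)) M
  have hcl : IsClosed (range γ) := (isCompact_range hγ.isEmbedding.continuous).isClosed
  obtain ⟨W, hW⟩ := exists_contMDiffMap_forall_mem_convex_of_local (n := ⊤) (𝓡 3) (M := M) (F := ℂ)
    (t := fun q => {w | ∀ u, γ u = q → ∃ ρ : ℝ, 0 < ρ ∧ w = ρ * u})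
    (fun q => by
      intro w hw w' hw' a b ha hb hab u hu
      obtain ⟨r, hr, rfl⟩ := hw u hu
      obtain ⟨r', hr', rfl⟩ := hw' u hu
      refine ⟨a * r + b * r', ?_, by simp; ring⟩
      rcases ha.eq_or_lt with rfl | ha
      · have : b = 1 := by linarith
        subst this; simpa using hr'
      · positivity) (fun q => by
      by_cases hq : q ∈ range γ
      · obtain ⟨v, rfl⟩ := hq
        obtain ⟨Ψ, hv, hΨ⟩ := exists_isSlice hγ v
        refine ⟨Ψ.source, Ψ.open_source.mem_nhds hv, fun q => (Circle.exp (Ψ q).2 : Circle),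
          ?_, ?_⟩
        · have h1 : ContMDiffOn (𝓡 3) 𝓘(ℝ, ℝ) ∞ (fun q => (Ψ q).2) Ψ.source :=
            contDiff_snd.contMDiff.comp_contMDiffOn Ψ.contMDiffOn_toFun
          exact (contMDiff_coe_circle.comp contMDiff_circleExp).comp_contMDiffOn h1
        · rintro _ hq u rfl
          refine ⟨1, one_pos, ?_⟩
          have h1 := (hΨ.eventually ⟨u, rfl⟩ hq).self_of_nhds
          rw [← hΨ.apply_eq ⟨u, rfl⟩ hq, Coord.symm_apply hq] at h1
          change ((Circle.exp (Ψ (γ u)).2 : Circle) : ℂ) = _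
          rw [← hγ.isEmbedding.injective h1, Complex.ofReal_one, one_mul]
      · refine ⟨(range γ)ᶜ, hcl.isOpen_compl.mem_nhds hq, fun _ => 0, contMDiffOn_const, ?_⟩
        rintro x hx u rfl
        exact absurd ⟨u, rfl⟩ hx)
  exact ⟨W, W.contMDiff, fun u => hW (γ u) u rfl⟩

variable {L : Set M}

/-- The differential of `f` does not vanish at `q`. -/
def NonvanishingAt (f : M → ℝ) (q : M) : Prop :=
  ∀ e : Coord M, q ∈ e.source → dIn e f q ≠ 0

omit [T2Space M] [SecondCountableTopology M] [IsManifold (𝓡 3) ∞ M] in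
theorem nonvanishingAt_of_coord {f : M → ℝ} {q : M} (hf : ContMDiffAt (𝓡 3) 𝓘(ℝ, ℝ) ∞ f q)
    {e : Coord M} (hq : q ∈ e.source) (h : dIn e f q ≠ 0) : NonvanishingAt f q := by
  intro e' hq' h0
  rw [dIn_change hf hq hq', h0] at h
  exact h (ContinuousLinearMap.zero_comp _)

omit [T2Space M] [SecondCountableTopology M] in
/-- Nonvanishing of the differential on a compact piece of the knot is stable under small
perturbations. -/
theorem eventually_nonvanishingAt (hγ : IsSmoothEmbedding (𝓡 1) (𝓡 3) ∞ γ) {α f₁ f₂ : M → ℝ}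
    (hα : ContMDiff (𝓡 3) 𝓘(ℝ, ℝ) ∞ α) (hf₁ : ContMDiff (𝓡 3) 𝓘(ℝ, ℝ) ∞ f₁)
    (hf₂ : ContMDiff (𝓡 3) 𝓘(ℝ, ℝ) ∞ f₂) {K : Set M} (hK : IsCompact K) (hKγ : K ⊆ range γ)
    (hαK : ∀ q ∈ K, NonvanishingAt α q) :
    ∀ᶠ c : ℂ in 𝓝 0, ∀ q ∈ K, NonvanishingAt (fun x => α x + (c.re * f₁ x + c.im * f₂ x)) q := by
  refine hK.eventually_forall_of_forall_eventually fun y hy => ?_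
  obtain ⟨u, rfl⟩ := hKγ hy
  obtain ⟨e, he, -⟩ := exists_isSlice hγ u
  have hd : ∀ f : M → ℝ, ContMDiff (𝓡 3) 𝓘(ℝ, ℝ) ∞ f →
      ContinuousAt (fun z : ℂ × M => dIn e f z.2) ((0 : ℂ), γ u) := fun f hf =>
    ContinuousAt.comp (f := Prod.snd) (g := dIn e f)
      ((continuousOn_dIn hf).continuousAt (e.open_source.mem_nhds he)) continuousAt_snd
  have hre : ContinuousAt (fun z : ℂ × M => z.1.re) ((0 : ℂ), γ u) :=
    (Complex.continuous_re.comp continuous_fst).continuousAt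
  have him : ContinuousAt (fun z : ℂ × M => z.1.im) ((0 : ℂ), γ u) :=
    (Complex.continuous_im.comp continuous_fst).continuousAt
  have hcont : ContinuousAt (fun z : ℂ × M =>
      dIn e α z.2 + (z.1.re • dIn e f₁ z.2 + z.1.im • dIn e f₂ z.2)) ((0 : ℂ), γ u) :=
    (hd α hα).add ((hre.smul (hd f₁ hf₁)).add (him.smul (hd f₂ hf₂)))
  have h1 := hcont.eventually_ne (y := 0) (by simpa using hαK _ hy e he)
  have h2 : ∀ᶠ z : ℂ × M in 𝓝 ((0 : ℂ), γ u), z.2 ∈ e.source :=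
    continuousAt_snd.eventually_mem (e.open_source.mem_nhds he)
  filter_upwards [h1, h2] with z hz hz2
  have hs₁ : ContMDiff (𝓡 3) 𝓘(ℝ, ℝ) ∞ fun x => z.1.re * f₁ x := contMDiff_const.mul hf₁
  have hs₂ : ContMDiff (𝓡 3) 𝓘(ℝ, ℝ) ∞ fun x => z.1.im * f₂ x := contMDiff_const.mul hf₂
  have hs : ContMDiff (𝓡 3) 𝓘(ℝ, ℝ) ∞ fun x => z.1.re * f₁ x + z.1.im * f₂ x := hs₁.add hs₂
  refine nonvanishingAt_of_coord (hα.add hs _) hz2 ?_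
  rw [dIn_add (hα _) (hs _) hz2]
  have h3 : dIn e (fun x => z.1.re * f₁ x + z.1.im * f₂ x) z.2
      = z.1.re • dIn e f₁ z.2 + z.1.im • dIn e f₂ z.2 := by
    rw [dIn_add (hs₁ _) (hs₂ _) hz2, dIn_const_mul _ (hf₁ _) hz2, dIn_const_mul _ (hf₂ _) hz2]
  exact fun h => hz (by rw [← h3]; exact h)

/-- The transverse part of the differential of `α` along an arc of the knot is a curve in a plane,
so it avoids the negative of some arbitrarily small constant; adding this constant to the
differential makes it nonzero along the arc. -/
theorem exists_local_nonvanishing (hγ : IsSmoothEmbedding (𝓡 1) (𝓡 3) ∞ γ) (u : Circle) :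
    ∃ C ∈ 𝓝[range γ] (γ u), IsCompact C ∧ C ⊆ range γ ∧
      ∀ K ⊆ range γ, IsCompact K → ∀ α : M → ℝ, ContMDiff (𝓡 3) 𝓘(ℝ, ℝ) ∞ α →
        (∀ q ∈ range γ, α q = 0) → (∀ q ∈ K, NonvanishingAt α q) →
        ∃ α' : M → ℝ, ContMDiff (𝓡 3) 𝓘(ℝ, ℝ) ∞ α' ∧ (∀ q ∈ range γ, α' q = 0) ∧
          ∀ q ∈ K ∪ C, NonvanishingAt α' q := by
  obtain ⟨Ψ, hu, hΨ⟩ := exists_isSlice hγ u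
  obtain ⟨χ, hχ, hχ1, hχ0, -⟩ := exists_bump Ψ.open_source hu
  have hγu : γ u ∈ range γ := ⟨u, rfl⟩
  set t₀ := (Ψ (γ u)).2 with ht₀
  have hline : ContinuousAt (fun t : ℝ => ((0, t) : ℂ × ℝ)) t₀ := by fun_prop
  have hsymm : ContinuousAt (fun t : ℝ => Ψ.symm (0, t)) t₀ := by
    refine ContinuousAt.comp (f := fun t : ℝ => ((0, t) : ℂ × ℝ)) (g := Ψ.symm) ?_ hline
    rw [ht₀, ← hΨ.apply_eq hγu hu]
    exact (Ψ.contMDiffOn_invFun.contMDiffAt (Coord.eventually_target hu)).continuousAt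
  have hsymm0 : Ψ.symm (0, t₀) = γ u := by
    rw [ht₀, ← hΨ.apply_eq hγu hu, Coord.symm_apply hu]
  have hev1 : ∀ᶠ t in 𝓝 t₀, ((0, t) : ℂ × ℝ) ∈ Ψ.target := by
    refine hline.eventually_mem ?_
    rw [ht₀, ← hΨ.apply_eq hγu hu]
    exact Coord.eventually_target hu
  have hev2 : ∀ᶠ t in 𝓝 t₀, ∀ᶠ x in 𝓝 (Ψ.symm (0, t)), χ x = 1 := by
    refine hsymm.eventually (p := fun y => ∀ᶠ x in 𝓝 y, χ x = 1) ?_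
    simp only [hsymm0]
    exact hχ1.eventually_nhds
  obtain ⟨η, hη, hball⟩ := Metric.nhds_basis_closedBall.eventually_iff.1 (hev1.and hev2)
  have hIcc : ∀ t ∈ Icc (t₀ - η) (t₀ + η), ((0, t) : ℂ × ℝ) ∈ Ψ.target ∧
      ∀ᶠ x in 𝓝 (Ψ.symm (0, t)), χ x = 1 := fun t ht =>
    hball (by rwa [Real.closedBall_eq_Icc])
  let C := (fun t : ℝ => Ψ.symm (0, t)) '' Icc (t₀ - η) (t₀ + η)
  have hCγ : C ⊆ range γ := by
    rintro _ ⟨t, ht, rfl⟩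
    exact ⟨_, (hΨ.symm_eq t (hIcc t ht).1).symm⟩
  have hCs : ∀ t ∈ Icc (t₀ - η) (t₀ + η), Ψ.symm (0, t) ∈ Ψ.source ∧
      Ψ (Ψ.symm (0, t)) = (0, t) := fun t ht =>
    ⟨Ψ.map_target' (hIcc t ht).1, Ψ.right_inv' (hIcc t ht).1⟩
  refine ⟨C, ?_, isCompact_Icc.image_of_continuousOn ?_, hCγ, ?_⟩
  · have h1 : ∀ᶠ q in 𝓝 (γ u), (Ψ q).2 ∈ Icc (t₀ - η) (t₀ + η) :=
      (continuousAt_snd.comp (Coord.continuousAt hu)).eventually_mem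
        (Icc_mem_nhds (sub_lt_self t₀ hη) (lt_add_of_pos_right t₀ hη))
    filter_upwards [self_mem_nhdsWithin, h1.filter_mono nhdsWithin_le_nhds,
      nhdsWithin_le_nhds (Ψ.open_source.mem_nhds hu)] with q hq hq2 hqs
    refine ⟨(Ψ q).2, hq2, ?_⟩
    change Ψ.symm (0, (Ψ q).2) = q
    rw [← hΨ.apply_eq hq hqs, Coord.symm_apply hqs]
  · exact Ψ.contMDiffOn_invFun.continuousOn.comp (by fun_prop) fun t ht => (hIcc t ht).1
  · intro K hK hKc α hα hα0 hαK
    have hΨfst : ContMDiffOn (𝓡 3) 𝓘(ℝ, ℂ) ∞ (fun q => (Ψ q).1) Ψ.source :=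
      contDiff_fst.contMDiff.comp_contMDiffOn Ψ.contMDiffOn_toFun
    have hf₁ := contMDiff_mul_of_eventually_eq_zero Ψ.open_source hχ hχ0
      (Complex.reCLM.contDiff.contMDiff.comp_contMDiffOn hΨfst)
    have hf₂ := contMDiff_mul_of_eventually_eq_zero Ψ.open_source hχ hχ0
      (Complex.imCLM.contDiff.contMDiff.comp_contMDiffOn hΨfst)
    set f₁ := fun q => χ q * (Complex.reCLM ∘ fun q => (Ψ q).1) q with hf₁d
    set f₂ := fun q => χ q * (Complex.imCLM ∘ fun q => (Ψ q).1) q with hf₂d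
    -- minus the transverse part of the differential of `α`
    let g : ℝ → ℂ := fun t =>
      ⟨-(fderiv ℝ (α ∘ Ψ.symm) (0, t) (1, 0)), -(fderiv ℝ (α ∘ Ψ.symm) (0, t) (Complex.I, 0))⟩
    have hg : ContDiffOn ℝ 1 g (Icc (t₀ - η) (t₀ + η)) := by
      have h1 : ContDiffOn ℝ 1 (fun t : ℝ => fderiv ℝ (α ∘ Ψ.symm) (0, t))
          (Icc (t₀ - η) (t₀ + η)) :=
        ((contDiffOn_comp_symm hα).fderiv_of_isOpen Ψ.open_target (m := ∞) (by simp)).of_le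
          (by simp) |>.comp (by fun_prop) fun t ht => (hIcc t ht).1
      have h2 : ∀ v, ContDiffOn ℝ 1 (fun t : ℝ => -(fderiv ℝ (α ∘ Ψ.symm) (0, t) v))
          (Icc (t₀ - η) (t₀ + η)) := fun v => (h1.clm_apply contDiffOn_const).neg
      exact Complex.equivRealProdCLM.symm.contDiff.comp_contDiffOn
        ((h2 (1, 0)).prodMk (h2 (Complex.I, 0)))
    have hdense : Dense (g '' Icc (t₀ - η) (t₀ + η))ᶜ := by
      refine hg.dense_compl_image_of_dimH_lt_finrank (convex_Icc _ _) subset_rfl ?_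
      rw [Complex.finrank_real_complex]
      refine lt_of_le_of_lt (dimH_mono (subset_univ _)) ?_
      rw [Real.dimH_univ]
      norm_num
    obtain ⟨c, hc, hcK⟩ := hdense.exists_mem_open isOpen_interior
      ⟨0, mem_interior_iff_mem_nhds.2 (eventually_nonvanishingAt hγ hα hf₁ hf₂ hKc hK hαK)⟩
    have hcK := interior_subset hcK
    have hs₁ : ContMDiff (𝓡 3) 𝓘(ℝ, ℝ) ∞ fun x => c.re * f₁ x := contMDiff_const.mul hf₁
    have hs₂ : ContMDiff (𝓡 3) 𝓘(ℝ, ℝ) ∞ fun x => c.im * f₂ x := contMDiff_const.mul hf₂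
    have hα' : ContMDiff (𝓡 3) 𝓘(ℝ, ℝ) ∞ fun x => α x + (c.re * f₁ x + c.im * f₂ x) :=
      hα.add (hs₁.add hs₂)
    have hs : ContMDiff (𝓡 3) 𝓘(ℝ, ℝ) ∞ fun x => c.re * f₁ x + c.im * f₂ x := hs₁.add hs₂
    refine ⟨_, hα', fun q hq => ?_, ?_⟩
    · by_cases hqs : q ∈ Ψ.source
      · simp [hα0 q hq, hf₁d, hf₂d, hΨ.fst_eq_zero q hq hqs]
      · simp [hα0 q hq, hf₁d, hf₂d, hχ0.self_of_nhdsSet q hqs]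
    rintro q (hq | ⟨t, ht, rfl⟩)
    · exact hcK q hq
    obtain ⟨hts, htr⟩ := hCs t ht
    refine nonvanishingAt_of_coord (hα' _) hts fun h0 => hc ⟨t, ht, ?_⟩
    change dIn Ψ _ (Ψ.symm (0, t)) = 0 at h0
    rw [dIn_add (hα _) (hs _) hts] at h0
    have h1 : dIn Ψ (fun x => c.re * f₁ x + c.im * f₂ x) (Ψ.symm (0, t))
        = (c.re • Complex.reCLM + c.im • Complex.imCLM).comp
          (ContinuousLinearMap.fst ℝ ℂ ℝ) := by
      refine HasFDerivAt.fderiv ?_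
      refine (ContinuousLinearMap.hasFDerivAt _).congr_of_eventuallyEq ?_
      have h2 : ContinuousAt Ψ.symm (Ψ (Ψ.symm (0, t))) :=
        (Ψ.contMDiffOn_invFun.contMDiffAt (Coord.eventually_target hts)).continuousAt
      have h3 : ∀ᶠ y in 𝓝 (Ψ (Ψ.symm (0, t))), χ (Ψ.symm y) = 1 := by
        refine h2.eventually (p := fun x => χ x = 1) ?_
        rw [htr]
        exact (hIcc t ht).2
      filter_upwards [h3, Coord.eventually_target hts] with y hy hyt
      have h4 : Ψ (Ψ.symm y) = y := Ψ.right_inv' hyt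
      simp only [Function.comp_apply, hf₁d, hf₂d, hy, h4, one_mul]
      simp
    rw [h1] at h0
    have h5 : dIn Ψ α (Ψ.symm (0, t)) = fderiv ℝ (α ∘ Ψ.symm) (0, t) := by rw [dIn, htr]
    rw [h5] at h0
    have h6 := DFunLike.congr_fun h0 ((1, 0) : ℂ × ℝ)
    have h7 := DFunLike.congr_fun h0 ((Complex.I, 0) : ℂ × ℝ)
    simp at h6 h7
    refine Complex.ext ?_ ?_
    · change -(fderiv ℝ (α ∘ Ψ.symm) (0, t) (1, 0)) = _
      exact (neg_eq_of_add_eq_zero_right h6)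
    · change -(fderiv ℝ (α ∘ Ψ.symm) (0, t) (Complex.I, 0)) = _
      exact (neg_eq_of_add_eq_zero_right h7)

end TubeExists

end MobiusFlop

namespace MobiusFlop

section TubeExists

variable {M : Type*} [TopologicalSpace M] [ChartedSpace (EuclideanSpace ℝ (Fin 3)) M]
  [T2Space M] [SecondCountableTopology M] [IsManifold (𝓡 3) ∞ M] {γ : Circle → M}

/-- A function that vanishes on the knot and whose differential vanishes nowhere on it. -/
theorem exists_nonvanishing (hγ : IsSmoothEmbedding (𝓡 1) (𝓡 3) ∞ γ) :
    ∃ α : M → ℝ, ContMDiff (𝓡 3) 𝓘(ℝ, ℝ) ∞ α ∧ (∀ q ∈ range γ, α q = 0) ∧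
      ∀ q ∈ range γ, NonvanishingAt α q := by
  have hL : IsCompact (range γ) := isCompact_range hγ.isEmbedding.continuous
  suffices h : ∃ C, range γ ⊆ C ∧ IsCompact C ∧ C ⊆ range γ ∧
      ∀ K ⊆ range γ, IsCompact K → ∀ α : M → ℝ, ContMDiff (𝓡 3) 𝓘(ℝ, ℝ) ∞ α →
        (∀ q ∈ range γ, α q = 0) → (∀ q ∈ K, NonvanishingAt α q) →
        ∃ α' : M → ℝ, ContMDiff (𝓡 3) 𝓘(ℝ, ℝ) ∞ α' ∧ (∀ q ∈ range γ, α' q = 0) ∧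
          ∀ q ∈ K ∪ C, NonvanishingAt α' q by
    obtain ⟨C, hC, -, -, h⟩ := h
    obtain ⟨α, hα, hα0, hαC⟩ := h ∅ (empty_subset _) isCompact_empty (fun _ => 0)
      contMDiff_const (fun _ _ => rfl) (by simp)
    exact ⟨α, hα, hα0, fun q hq => hαC q (Or.inr (hC hq))⟩
  refine hL.induction_on (p := fun s => ∃ C, s ⊆ C ∧ IsCompact C ∧ C ⊆ range γ ∧
      ∀ K ⊆ range γ, IsCompact K → ∀ α : M → ℝ, ContMDiff (𝓡 3) 𝓘(ℝ, ℝ) ∞ α →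
        (∀ q ∈ range γ, α q = 0) → (∀ q ∈ K, NonvanishingAt α q) →
        ∃ α' : M → ℝ, ContMDiff (𝓡 3) 𝓘(ℝ, ℝ) ∞ α' ∧ (∀ q ∈ range γ, α' q = 0) ∧
          ∀ q ∈ K ∪ C, NonvanishingAt α' q) ?_ ?_ ?_ ?_
  · exact ⟨∅, subset_rfl, isCompact_empty, empty_subset _, fun K _ _ α hα hα0 hαK =>
      ⟨α, hα, hα0, by simpa using hαK⟩⟩
  · rintro s t hst ⟨C, hC, h⟩
    exact ⟨C, hst.trans hC, h⟩
  · rintro s t ⟨C, hsC, hCc, hCγ, hC⟩ ⟨D, htD, hDc, hDγ, hD⟩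
    refine ⟨C ∪ D, union_subset_union hsC htD, hCc.union hDc, union_subset hCγ hDγ, ?_⟩
    intro K hK hKc α hα hα0 hαK
    obtain ⟨α', hα', hα'0, hα'K⟩ := hC K hK hKc α hα hα0 hαK
    rw [← union_assoc]
    exact hD (K ∪ C) (union_subset hK hCγ) (hKc.union hCc) α' hα' hα'0 hα'K
  · rintro _ ⟨u, rfl⟩
    obtain ⟨C, hC, h⟩ := exists_local_nonvanishing hγ u
    exact ⟨C, hC, C, subset_rfl, h⟩

variable {A : Set (Coord M)}

/-- Near each point of the knot, the transverse plane has a covector that completes `α` and the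
angle to a coordinate system. -/
theorem exists_local_jac_ne_zero (hγ : IsSmoothEmbedding (𝓡 1) (𝓡 3) ∞ γ) {α : M → ℝ}
    (hα : ContMDiff (𝓡 3) 𝓘(ℝ, ℝ) ∞ α) (hα0 : ∀ q ∈ range γ, α q = 0)
    (hαn : ∀ q ∈ range γ, NonvanishingAt α q) {W : M → ℂ} (hW : ContMDiff (𝓡 3) 𝓘(ℝ, ℂ) ∞ W)
    (hWγ : ∀ u, ∃ ρ : ℝ, 0 < ρ ∧ W (γ u) = ρ * u) (u : Circle) {e : Coord M}
    (he : γ u ∈ e.source) :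
    ∃ β : M → ℝ, ContMDiff (𝓡 3) 𝓘(ℝ, ℝ) ∞ β ∧ (∀ q ∈ range γ, β q = 0) ∧
      jac e α β W (γ u) ≠ 0 := by
  obtain ⟨Ψ, hu, hΨ⟩ := exists_isSlice hγ u
  have hγu : γ u ∈ range γ := ⟨u, rfl⟩
  obtain ⟨χ, hχ, hχ1, hχ0, -⟩ := exists_bump Ψ.open_source hu
  set a := dIn Ψ α (γ u) with ha
  let l : ℂ × ℝ →L[ℝ] ℝ := (a (1, 0) • Complex.imCLM - a (Complex.I, 0) • Complex.reCLM).comp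
    (ContinuousLinearMap.fst ℝ ℂ ℝ)
  have hl : ∀ v, l v = a (1, 0) * v.1.im - a (Complex.I, 0) * v.1.re := fun v => by simp [l]
  have hβ := contMDiff_mul_of_eventually_eq_zero Ψ.open_source hχ hχ0
    (l.contDiff.contMDiff.comp_contMDiffOn Ψ.contMDiffOn_toFun)
  set β := fun q => χ q * (l ∘ Ψ) q with hβd
  have hdβ : dIn Ψ β (γ u) = l := by
    refine HasFDerivAt.fderiv (l.hasFDerivAt.congr_of_eventuallyEq ?_)
    have h2 : ContinuousAt Ψ.symm (Ψ (γ u)) :=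
      (Ψ.contMDiffOn_invFun.contMDiffAt (Coord.eventually_target hu)).continuousAt
    have h3 : ∀ᶠ y in 𝓝 (Ψ (γ u)), χ (Ψ.symm y) = 1 := by
      refine h2.eventually (p := fun x => χ x = 1) ?_
      rwa [Coord.symm_apply hu]
    filter_upwards [h3, Coord.eventually_target hu] with y hy hyt
    have h4 : Ψ (Ψ.symm y) = y := Ψ.right_inv' hyt
    simp only [Function.comp_apply, hβd, hy, h4, one_mul]
  have hτ : a (0, 1) = 0 := hΨ.dIn_eq_zero hγu hu (hα _) hα0
  have hc := hΨ.angForm_pos hγu hu (hW _) hWγ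
  have hav : ∀ v : ℂ × ℝ, a v = v.1.re * a (1, 0) + v.1.im * a (Complex.I, 0) := fun v => by
    have hv : v = v.1.re • ((1, 0) : ℂ × ℝ) + v.1.im • ((Complex.I, 0) : ℂ × ℝ)
        + v.2 • ((0, 1) : ℂ × ℝ) := by
      refine Prod.ext (Complex.ext ?_ ?_) ?_ <;> simp
    conv_lhs => rw [hv]
    simp only [map_add, map_smul, hτ, smul_eq_mul]
    ring
  refine ⟨β, hβ, fun q hq => ?_, fun h => ?_⟩
  · by_cases hqs : q ∈ Ψ.source
    · simp [hβd, hl, hΨ.fst_eq_zero q hq hqs]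
    · simp [hβd, hχ0.self_of_nhdsSet q hqs]
  · have h1 : jac Ψ α β W (γ u) = 0 := by
      rw [jac_change (e' := e) (hα _) (hβ _) (hW _) hu he, h, zero_mul]
    refine vol_ne_zero (fun v hv1 hv2 hv3 => ?_) h1
    rw [hdβ, hl] at hv2
    rw [← ha, hav] at hv1
    have hpos : 0 < a (1, 0) ^ 2 + a (Complex.I, 0) ^ 2 := by
      by_contra! hle
      have e1 : a (1, 0) = 0 := by nlinarith [sq_nonneg (a (1, 0)), sq_nonneg (a (Complex.I, 0))]
      have e2 : a (Complex.I, 0) = 0 := by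
        nlinarith [sq_nonneg (a (1, 0)), sq_nonneg (a (Complex.I, 0))]
      refine hαn _ hγu Ψ hu (ContinuousLinearMap.ext fun v => ?_)
      rw [← ha, hav, e1, e2]; simp
    have hre : v.1.re = 0 := by
      have : (a (1, 0) ^ 2 + a (Complex.I, 0) ^ 2) * v.1.re = 0 := by
        linear_combination a (1, 0) * hv1 - a (Complex.I, 0) * hv2
      exact (mul_eq_zero.1 this).resolve_left hpos.ne'
    have him : v.1.im = 0 := by
      have : (a (1, 0) ^ 2 + a (Complex.I, 0) ^ 2) * v.1.im = 0 := by
        linear_combination a (Complex.I, 0) * hv1 + a (1, 0) * hv2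
      exact (mul_eq_zero.1 this).resolve_left hpos.ne'
    have hv : v = v.2 • ((0, 1) : ℂ × ℝ) :=
      Prod.ext (Complex.ext (by simp [hre]) (by simp [him])) (by simp)
    rw [hv, map_smul, smul_eq_mul] at hv3
    have : v.2 = 0 := (mul_eq_zero.1 hv3).resolve_right hc.ne'
    rw [hv, this, zero_smul]

/-- A function `β` that completes `α` and the angle to positively oriented coordinates along the
knot. Such functions form a convex set, so local ones can be glued; this uses the orientability of
the manifold along the knot. -/
theorem exists_jac_pos (hγ : IsSmoothEmbedding (𝓡 1) (𝓡 3) ∞ γ)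
    (hA : IsOrientedAtlas A (range γ)) {α : M → ℝ}
    (hα : ContMDiff (𝓡 3) 𝓘(ℝ, ℝ) ∞ α) (hα0 : ∀ q ∈ range γ, α q = 0)
    (hαn : ∀ q ∈ range γ, NonvanishingAt α q) {W : M → ℂ} (hW : ContMDiff (𝓡 3) 𝓘(ℝ, ℂ) ∞ W)
    (hWγ : ∀ u, ∃ ρ : ℝ, 0 < ρ ∧ W (γ u) = ρ * u) :
    ∃ β : M → ℝ, ContMDiff (𝓡 3) 𝓘(ℝ, ℝ) ∞ β ∧ (∀ q ∈ range γ, β q = 0) ∧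
      ∀ q ∈ range γ, ∀ e ∈ A, q ∈ e.source → 0 < jac e α β W q := by
  have hL : IsCompact (range γ) := isCompact_range hγ.isEmbedding.continuous
  suffices h : ∃ β : M → ℝ, ContMDiff (𝓡 3) 𝓘(ℝ, ℝ) ∞ β ∧ (∀ q ∈ range γ, β q = 0) ∧
      ∀ q ∈ range γ, ∀ e ∈ A, q ∈ e.source →
        0 ≤ jac e α β W q ∧ (q ∈ range γ → 0 < jac e α β W q) by
    obtain ⟨β, hβ, hβ0, h⟩ := h
    exact ⟨β, hβ, hβ0, fun q hq e he hqe => (h q hq e he hqe).2 hq⟩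
  refine hL.induction_on (p := fun s => ∃ β : M → ℝ, ContMDiff (𝓡 3) 𝓘(ℝ, ℝ) ∞ β ∧
    (∀ q ∈ range γ, β q = 0) ∧ ∀ q ∈ range γ, ∀ e ∈ A, q ∈ e.source →
      0 ≤ jac e α β W q ∧ (q ∈ s → 0 < jac e α β W q)) ?_ ?_ ?_ ?_
  · refine ⟨fun _ => 0, contMDiff_const, fun _ _ => rfl, fun q _ e _ hq => ⟨?_, fun h => h.elim⟩⟩
    have h1 : dIn e (fun _ : M => (0 : ℝ)) q = 0 := by
      simp [dIn, Function.comp_def]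
    simp [jac, vol_eq, h1]
  · rintro s t hst ⟨β, hβ, hβ0, h⟩
    exact ⟨β, hβ, hβ0, fun q hq e he hqe =>
      ⟨(h q hq e he hqe).1, fun hqs => (h q hq e he hqe).2 (hst hqs)⟩⟩
  · rintro s t ⟨β, hβ, hβ0, h⟩ ⟨β', hβ', hβ'0, h'⟩
    refine ⟨fun x => β x + β' x, hβ.add hβ', fun q hq => by simp only [hβ0 q hq, hβ'0 q hq, add_zero],
      fun q hq e he hqe => ?_⟩
    rw [jac_add (hβ _) (hβ' _) hqe]
    obtain ⟨h1, h2⟩ := h q hq e he hqe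
    obtain ⟨h3, h4⟩ := h' q hq e he hqe
    refine ⟨add_nonneg h1 h3, ?_⟩
    rintro (hs | ht)
    · exact add_pos_of_pos_of_nonneg (h2 hs) h3
    · exact add_pos_of_nonneg_of_pos h1 (h4 ht)
  · rintro _ ⟨u, rfl⟩
    obtain ⟨e, heA, he⟩ := hA.cover _ ⟨u, rfl⟩
    obtain ⟨β₁, hβ₁, hβ₁0, hne⟩ := exists_local_jac_ne_zero hγ hα hα0 hαn hW hWγ u he
    -- multiplication by the value of the Jacobian makes the sign positive
    set r := jac e α β₁ W (γ u) with hr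
    have hβ : ContMDiff (𝓡 3) 𝓘(ℝ, ℝ) ∞ fun x => r * β₁ x := contMDiff_const.mul hβ₁
    have hβ0 : ∀ q ∈ range γ, r * β₁ q = 0 := fun q hq => by rw [hβ₁0 q hq, mul_zero]
    have hpos : 0 < jac e α (fun x => r * β₁ x) W (γ u) := by
      rw [jac_mul contMDiffAt_const (hβ₁ _) (hβ₁0 _ ⟨u, rfl⟩) he, ← hr]
      exact mul_self_pos.2 hne
    set β := fun x => r * β₁ x
    have hU : IsOpen (e.source ∩ jac e α β W ⁻¹' Ioi 0) :=
      (continuousOn_jac hα hβ hW).isOpen_inter_preimage e.open_source isOpen_Ioi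
    obtain ⟨χ, hχ, hχ1, hχ0, hχn⟩ := exists_bump hU ⟨he, hpos⟩
    have hsm : ContMDiff (𝓡 3) 𝓘(ℝ, ℝ) ∞ fun x => χ x * β x := hχ.mul hβ
    refine ⟨{x | χ x = 1}, nhdsWithin_le_nhds hχ1, fun x => χ x * β x, hsm,
      fun q hq => mul_eq_zero_of_right _ (hβ0 q hq), fun q hq e' he' hqe' => ?_⟩
    rw [jac_mul (hχ _) (hβ _) (hβ0 q hq) hqe']
    by_cases hqU : q ∈ e.source ∩ jac e α β W ⁻¹' Ioi 0
    · have h1 : 0 < jac e' α β W q := by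
        rw [jac_change (e' := e) (hα _) (hβ _) (hW _) hqe' hqU.1]
        exact mul_pos hqU.2 (hA.det_pos e' he' e heA q hq hqe' hqU.1)
      exact ⟨mul_nonneg (hχn q) h1.le, fun h => by rw [h, one_mul]; exact h1⟩
    · have h0 : χ q = 0 := hχ0.self_of_nhdsSet q hqU
      refine ⟨by rw [h0, zero_mul], fun h => ?_⟩
      exact absurd (h0.symm.trans h) zero_ne_one

omit [T2Space M] [SecondCountableTopology M] [IsManifold (𝓡 3) ∞ M] in
/-- Where their Jacobian determinant does not vanish, `α`, `β` and the argument of `W` are local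
coordinates. -/
theorem isLocalDiffeomorphAt_of_jac_ne_zero {α β : M → ℝ} {W : M → ℂ}
    (hα : ContMDiff (𝓡 3) 𝓘(ℝ, ℝ) ∞ α) (hβ : ContMDiff (𝓡 3) 𝓘(ℝ, ℝ) ∞ β)
    (hW : ContMDiff (𝓡 3) 𝓘(ℝ, ℂ) ∞ W) {q : M} (hWq : W q ≠ 0) {e : Coord M}
    (hq : q ∈ e.source) (hjac : jac e α β W q ≠ 0) :
    IsLocalDiffeomorphAt (𝓡 3) (𝓘(ℝ, ℂ).prod (𝓡 1)) ∞
      (fun x => ((⟨α x, β x⟩ : ℂ), Circle.exp (Complex.arg (W x)))) q := by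
  -- a branch of the argument of `W` near `q`
  let θ : M → ℝ := fun x => (Complex.log (W x * (W q)⁻¹)).im + Complex.arg (W q)
  let Q : M → ℂ × ℝ := fun x => (⟨α x, β x⟩, θ x)
  have hslit : ∀ᶠ x in 𝓝 q, W x * (W q)⁻¹ ∈ Complex.slitPlane := by
    refine (hW.continuous.mul continuous_const).continuousAt.eventually_mem
      (Complex.isOpen_slitPlane.mem_nhds ?_)
    change W q * (W q)⁻¹ ∈ _
    rw [mul_inv_cancel₀ hWq]; simp
  have hQs : ∀ x, W x * (W q)⁻¹ ∈ Complex.slitPlane → ContMDiffAt (𝓡 3) 𝓘(ℝ, ℂ × ℝ) ∞ Q x := by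
    intro x hx
    have h1 : ContMDiffAt (𝓡 3) 𝓘(ℝ, ℂ) ∞ (fun x => (⟨α x, β x⟩ : ℂ)) x :=
      Complex.equivRealProdCLM.symm.contDiff.contMDiff.contMDiffAt.comp x
        ((hα x).prodMk_space (hβ x))
    have h2 : ContMDiffAt (𝓡 3) 𝓘(ℝ, ℂ) ∞ (fun x => Complex.log (W x * (W q)⁻¹)) x :=
      ((Complex.contDiffAt_log hx).restrict_scalars ℝ).contMDiffAt.comp x
        ((contDiff_id.mul contDiff_const : ContDiff ℝ ∞ fun z : ℂ => z * (W q)⁻¹).contMDiff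
          |>.contMDiffAt.comp x (hW x))
    exact h1.prodMk_space ((Complex.imCLM.contDiff.contMDiff.contMDiffAt.comp x h2).add
      contMDiffAt_const)
  let c : ℂ × ℝ →L[ℝ] ℝ := Complex.imCLM.comp ((W q)⁻¹ • dIn e W q)
  have hderiv : HasFDerivAt (Q ∘ e.symm) (packForms (dIn e α q) (dIn e β q) c) (e q) := by
    have ha := (differentiableAt_comp_symm (hα q) hq).hasFDerivAt
    have hb := (differentiableAt_comp_symm (hβ q) hq).hasFDerivAt
    have hw := (differentiableAt_comp_symm (hW q) hq).hasFDerivAt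
    have h1 : HasFDerivAt (fun y => Complex.log ((W ∘ e.symm) y * (W q)⁻¹))
        ((W q)⁻¹ • dIn e W q) (e q) := by
      have h2 := hw.mul_const' ((W q)⁻¹)
      have h3 : (W ∘ e.symm) (e q) * (W q)⁻¹ = 1 := by
        rw [Function.comp_apply, Coord.symm_apply hq, mul_inv_cancel₀ hWq]
      have h4 := ((Complex.hasDerivAt_log (z := (W ∘ e.symm) (e q) * (W q)⁻¹)
        (by rw [h3]; simp)).hasFDerivAt.restrictScalars ℝ).comp (e q) h2
      rw [h3] at h4
      refine HasFDerivAt.congr_fderiv h4 (ContinuousLinearMap.ext fun v => ?_)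
      simp [dIn, mul_comm]
    have h5 := (Complex.imCLM.hasFDerivAt.comp (e q) h1).add_const (Complex.arg (W q))
    exact (Complex.equivRealProdCLM.symm.hasFDerivAt.comp (e q) (ha.prodMk hb)).prodMk h5
  have hcdet : (packForms (dIn e α q) (dIn e β q) c).det ≠ 0 := by
    have h1 : angForm e W q = Complex.normSq (W q) • c := by
      refine ContinuousLinearMap.ext fun v => ?_
      have h2 : (starRingEnd ℂ) (W q) = (Complex.normSq (W q) : ℂ) * (W q)⁻¹ := by
        rw [Complex.normSq_eq_conj_mul_self, mul_assoc, mul_inv_cancel₀ hWq, mul_one]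
      rw [angForm_apply, h2, mul_assoc, Complex.im_ofReal_mul]
      rfl
    intro h0
    refine hjac ?_
    have h3 : vol (dIn e α q) (dIn e β q) c = 0 := h0
    rw [vol_eq] at h3
    rw [jac, vol_eq, h1]
    simp only [smul_apply, smul_eq_mul]
    linear_combination Complex.normSq (W q) * h3
  have hQ : IsLocalDiffeomorphAt (𝓡 3) 𝓘(ℝ, ℂ × ℝ) ∞ Q q := by
    have h1 : IsLocalDiffeomorphAt 𝓘(ℝ, ℂ × ℝ) 𝓘(ℝ, ℂ × ℝ) ∞ (Q ∘ e.symm) (e q) := by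
      refine isLocalDiffeomorphAt_of_hasFDerivAt
        (f' := ContinuousLinearMap.toContinuousLinearEquivOfDetNeZero _ hcdet) ?_ ?_
      · have h2 : ContinuousAt e.symm (e q) :=
          (e.contMDiffOn_invFun.contMDiffAt (Coord.eventually_target hq)).continuousAt
        have h3 : ∀ᶠ y in 𝓝 (e q), W (e.symm y) * (W q)⁻¹ ∈ Complex.slitPlane := by
          refine h2.eventually (p := fun x => W x * (W q)⁻¹ ∈ Complex.slitPlane) ?_
          rwa [Coord.symm_apply hq]
        filter_upwards [h3, Coord.eventually_target hq] with y hy hyt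
        exact ((hQs _ hy).comp y
          (e.contMDiffOn_invFun.contMDiffAt (e.open_target.mem_nhds hyt))).contDiffAt
      · simpa using hderiv
    refine isLocalDiffeomorphAt_congr
      ((e.isLocalDiffeomorphAt _ _ _ hq).comp 𝓘(ℝ, ℂ × ℝ) (ℂ × ℝ) h1) ?_
    filter_upwards [e.open_source.mem_nhds hq] with x hx
    simp only [Function.comp_apply, Coord.symm_apply hx]
  refine isLocalDiffeomorphAt_congr (hQ.comp _ _ (isLocalDiffeomorph_expCover (Q q))) ?_
  filter_upwards [hW.continuous.continuousAt.eventually_ne hWq] with x hx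
  refine Prod.ext rfl ?_
  change Circle.exp (Complex.arg (W x))
    = Circle.exp ((Complex.log (W x * (W q)⁻¹)).im + Complex.arg (W q))
  rw [Complex.log_im]
  refine Circle.ext ?_
  rw [Circle.exp_add, Circle.coe_mul, Circle.coe_exp, Circle.coe_exp, Circle.coe_exp]
  have hn : ∀ z : ℂ, z ≠ 0 → Complex.exp (Complex.arg z * Complex.I) = z / ‖z‖ := fun z hz => by
    rw [eq_div_iff (by simpa using hz), mul_comm]
    exact Complex.norm_mul_exp_arg_mul_I z
  rw [hn _ hx, hn _ hWq, hn _ (mul_ne_zero hx (inv_ne_zero hWq)), norm_mul, norm_inv]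
  have h1 : (‖W q‖ : ℂ) ≠ 0 := by simpa using hWq
  have h2 : (‖W x‖ : ℂ) ≠ 0 := by simpa using hx
  push_cast
  field_simp

/-- A knot along which the manifold is orientable has a tubular neighbourhood that is a solid
torus. -/
theorem nonempty_tube {L : Set M} (hL : IsKnot L) (hor : OrientableAlong L) :
    Nonempty (Tube L) := by
  obtain ⟨γ, hγ, rfl⟩ := hL
  obtain ⟨A, hA⟩ := exists_isOrientedAtlas hor
  obtain ⟨W, hW, hWγ⟩ := exists_angular hγ
  obtain ⟨α, hα, hα0, hαn⟩ := exists_nonvanishing hγ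
  obtain ⟨β, hβ, hβ0, hjac⟩ := exists_jac_pos hγ hA hα hα0 hαn hW hWγ
  have hP : ∀ u, (((⟨α (γ u), β (γ u)⟩ : ℂ), Circle.exp (Complex.arg (W (γ u)))) : ℂ × Circle)
      = (0, u) := fun u => by
    obtain ⟨ρ, hρ, h⟩ := hWγ u
    refine Prod.ext ?_ ?_
    · rw [hα0 _ ⟨u, rfl⟩, hβ0 _ ⟨u, rfl⟩]; rfl
    · rw [h, Complex.arg_real_mul _ hρ, Circle.exp_arg]
  refine nonempty_tube_of_map (isCompact_range hγ.isEmbedding.continuous)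
    (P := fun x => ((⟨α x, β x⟩ : ℂ), Circle.exp (Complex.arg (W x)))) ?_ ?_ ?_ ?_
  · rintro _ ⟨u, rfl⟩
    obtain ⟨e, he, hue⟩ := hA.cover _ ⟨u, rfl⟩
    obtain ⟨ρ, hρ, h⟩ := hWγ u
    refine isLocalDiffeomorphAt_of_jac_ne_zero hα hβ hW ?_ hue (hjac _ ⟨u, rfl⟩ e he hue).ne'
    rw [h]
    exact mul_ne_zero (by exact_mod_cast hρ.ne') (Circle.coe_ne_zero u)
  · rintro _ ⟨u, rfl⟩ _ ⟨v, rfl⟩ h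
    have h := (hP u).symm.trans (h.trans (hP v))
    exact congrArg γ (Prod.ext_iff.1 h).2
  · rintro _ ⟨u, rfl⟩
    exact congrArg Prod.fst (hP u)
  · exact fun u => ⟨γ u, ⟨u, rfl⟩, hP u⟩

end TubeExists

end MobiusFlop
theorem mainTheorem9 {M : Type*} [TopologicalSpace M] [T2Space M] [SecondCountableTopology M]
    [ChartedSpace (EuclideanSpace ℝ (Fin 3)) M] [IsManifold (𝓡 3) ∞ M]
    (L : Set M) (hL : MobiusFlop.IsKnot L) (hor : MobiusFlop.OrientableAlong L) :
    Nonempty (MobiusFlop.Tube L) ∧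
    ∀ T : MobiusFlop.Tube L,
      ∃ e : Quot (MobiusFlop.MobiusBand.Isotopic (L := L)) ≃
          Quot (MobiusFlop.TopologicalFlop.Same (T := T)),
        ∀ (B : MobiusFlop.MobiusBand L) (S : MobiusFlop.TopologicalFlop T),
          e (Quot.mk _ B) = Quot.mk _ S ↔
            ∃ (B' : MobiusFlop.MobiusBand L) (S' : MobiusFlop.TopologicalFlop T),
              Quot.mk MobiusFlop.MobiusBand.Isotopic B' = Quot.mk _ B ∧
              Quot.mk MobiusFlop.TopologicalFlop.Same S' = Quot.mk _ S ∧
              MobiusFlop.MeridianToBoundary B' S' := by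
  exact ⟨MobiusFlop.nonempty_tube hL hor, fun T => MobiusFlop.exists_equiv T⟩
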